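/- Let $(X,\mathcal A,\mu)$ be a $\sigma$-finite measure space and $T:X\to X$ a conservative, ergodic, $\mu$-preserving transformation. Let $d\ge 2$ and let $X=Y\cup A_1\cup\dots\cup A_d$ with pairwise disjoint measurable sets such that $0<\mu(Y)<\infty$, $\mu(A_i)=\infty$ for all $i$, and $Y$ dynamically separates $A_1,\dots,A_d$, i.e. $A_i\cap T^{-1}A_j=\emptyset$ whenever $i\ne j$. Notation. For a non-negative measurable $u$, $\hat T u=d(\mu_u\circ T^{-1})/d\mu$ is the transfer operator, where $\mu_u(B)=\int_B u\,d\mu$ (the same notation $\mu_u$ is used for $u\in L^1(\mu)$). Put $Y_n=T^{-n}Y\setminus\bigcup_{k=0}^{n-1}T^{-k}Y$ (so $Y_0=Y$), $w_n^{Y,A_i}=\mu\big(\bigcup_{k=0}^{n-1}(T^{-k}Y)\cap A_i\big)$, $h_n^{(i)}=\frac1{w_n^{Y,A_i}}\sum_{k=0}^{n-1}\hat T^k 1_{Y_k\cap A_i}$ $(n\ge2)$ and $S_n^{A_i}(x)=\sum_{k=1}^n 1_{A_i}(T^kx)$. A family $\mathfrak H$ of non-negative measurable functions is uniformly sweeping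 for $G\ge0$ if there are $C>0$ and $K\in\{0,1,2,\dots\}$ such that $C\sum_{k=0}^K\hat T^kH\ge G$ $\mu$-a.e. for every $H\in\mathfrak H$. As usual $a_n\sim b_n$ means $a_n/b_n\to1$, and a positive measurable $\ell:(0,\infty)\to(0,\infty)$ is slowly varying at $\infty$ if $\ell(rt)/\ell(t)\to1$ as $t\to\infty$ for every $r>0$. Assume that 1. $w_n^{Y,A_i}\sim\beta_i n^{1-\alpha}\ell(n)$ as $n\to\infty$ for $i=1,\dots,d$, where $\alpha,\beta_1,\dots,\beta_d\in(0,1)$, $\sum_{i=1}^d\beta_i=1$, and $\ell$ is slowly varying at $\infty$; 2. $\{h_n^{(d)}\}_{n\ge2}$ is bounded in $L^\infty(\mu)$; 3. for some $N\ge2$ the family $\{h_n^{(i)}: n\ge N,\ 1\le i\le d-1\}$ is uniformly sweeping for $1_Y$; 4. there are $H^{(1)},\dots,H^{(d-1)}\in L^\infty(\mu)$ with $h_n^{(i)}\to H^{(i)}$ in $L^\infty(\mu)$ as $n\to\infty$ for $i=1,\dots,d-1$. Let $\lambda_1,\dots,\lambda_{d-1}\in(0,\infty)$, let $\{c(n)\}_{n\ge0}$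 be a positive sequence with $c(n)\to0$ and $c(n)n\to\infty$, and set $\tilde H=\sum_{i=1}^{d-1}\beta_i\lambda_i^\alpha H^{(i)}$. Then $\tilde H\in L^1(\mu)$ and, as $n\to\infty$, $$\mu_{\tilde H}\Big(\frac1n\sum_{i=1}^{d-1}\lambda_iS_n^{A_i}\le c(n)\Big)\ \sim\ \beta_d\,\frac{\sin(\pi\alpha)}{\pi\alpha}\,\frac{c(n)^\alpha\,\ell(n)}{\ell(c(n)n)}.$$ -/

import Mathlib

open MeasureTheory Filter Topology Asymptotics
open scoped ENNReal NNReal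

noncomputable section

namespace InfiniteErgodic

variable {X : Type*} [MeasurableSpace X]

/-- The transfer operator `T̂ u = d(μ_u ∘ T⁻¹) / dμ` on non-negative functions, where `μ_u` is the
measure with density `u` with respect to `μ`. -/
def transferOp (μ : Measure X) (T : X → X) (u : X → ℝ≥0∞) : X → ℝ≥0∞ :=
  ((μ.withDensity u).map T).rnDeriv μ

/-- `Y_n = T⁻ⁿ Y \ ⋃_{k < n} T⁻ᵏ Y`: the points whose orbit, observed from time `0` on, visits `Y`
for the first time at time `n`.  In particular `Y_0 = Y`. -/
def firstVisitSet (T : X → X) (Y : Set X) (n : ℕ) : Set X :=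
  (T^[n] ⁻¹' Y) \ ⋃ k ∈ Finset.range n, T^[k] ⁻¹' Y

/-- The wandering rate of `Y` starting from `A`: `w_n^{Y,A} = μ (⋃_{k < n} (T⁻ᵏ Y) ∩ A)`. -/
def wanderingRate (μ : Measure X) (T : X → X) (Y A : Set X) (n : ℕ) : ℝ≥0∞ :=
  μ (⋃ k ∈ Finset.range n, (T^[k] ⁻¹' Y) ∩ A)

/-- The normalized sum `(1 / w_n^{Y,A}) ∑_{k < n} T̂ᵏ 1_{Y_k ∩ A}`. -/
def entranceAverage (μ : Measure X) (T : X → X) (Y A : Set X) (n : ℕ) : X → ℝ≥0∞ :=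
  fun x => (wanderingRate μ T Y A n)⁻¹ *
    ∑ k ∈ Finset.range n, (transferOp μ T)^[k] ((firstVisitSet T Y k ∩ A).indicator 1) x

/-- The family `F` of non-negative functions is uniformly sweeping for `G`: for some constants
`C > 0` and `K`, every member `H` of `F` satisfies `C ∑_{k ≤ K} T̂ᵏ H ≥ G` almost everywhere. -/
def UniformlySweeping (μ : Measure X) (T : X → X) (F : Set (X → ℝ≥0∞)) (G : X → ℝ≥0∞) : Prop :=
  ∃ C : ℝ≥0, 0 < C ∧ ∃ K : ℕ, ∀ H ∈ F,
    ∀ᵐ x ∂μ, G x ≤ C * ∑ k ∈ Finset.range (K + 1), (transferOp μ T)^[k] H x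

/-- The occupation time `S_n^A(x) = ∑_{k=1}^n 1_A(Tᵏ x)`. -/
def occupationTime (T : X → X) (A : Set X) (n : ℕ) (x : X) : ℝ :=
  ∑ k ∈ Finset.Icc 1 n, A.indicator 1 (T^[k] x)

/-- `μ_u (B) = ∫_B u dμ`. -/
def densityMeasure (μ : Measure X) (u : X → ℝ) (B : Set X) : ℝ :=
  ∫ x in B, u x ∂μ

/-- `Y` dynamically separates the sets `A i`: `A i ∩ T⁻¹ (A j) = ∅` whenever `i ≠ j`. -/
def DynamicallySeparates {ι : Type*} (T : X → X) (A : ι → Set X) : Prop :=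
  ∀ i j, i ≠ j → A i ∩ T ⁻¹' A j = ∅

/-- `ℓ` restricts to a positive measurable function on `(0, ∞)` that is slowly varying at `∞`.
The values of `ℓ` outside `(0, ∞)` play no role. -/
structure SlowlyVaryingAtInfty (ℓ : ℝ → ℝ) : Prop where
  pos : ∀ t, 0 < t → 0 < ℓ t
  measurable : Measurable (fun t : Set.Ioi (0 : ℝ) => ℓ t)
  slow : ∀ r, 0 < r → Tendsto (fun t => ℓ (r * t) / ℓ t) atTop (𝓝 1)

end InfiniteErgodic

end

/-! Put `R_n = ∑_{i<d} λ_i S_n^{A_i}`. One function encodes the double Laplace transform of `R`. Let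
`v = e^{-q}` on `Y` and `A_d`, `v = e^{-(q+κλ_i)}` on `A_i` for `i < d`, and `V(x) = ∑_n
v(Tx)⋯v(Tⁿx) = ∑_n e^{-qn} e^{-κR_n(x)}`. Then `V = 1 + (vV)∘T`, so `(1-v)V - 1` is the coboundary
`(vV)∘T - vV`, and by conservativity its integrals over `⋃_{k<n} T⁻ᵏY` tend to `0`. By dynamical
separation an orbit starting in `Y_k ∩ A_i` stays in `A_i` until it enters `Y`, so the same
integrals can be computed cell by cell. This gives the renewal identity
`measureReal_add_sum_tsum_eq`: `μ(Y) + ∑_i Q_i(s_i) = (1-e^{-q}) ∫_Y V + ∑_i (e^{s_i}-1) e^{-q} ∑_k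
e^{-s_i k} ∫_{Y_k∩A_i} V∘Tᵏ`, where `s_i = q+κλ_i` for `i < d`, `s_d = q` and `Q_i(s) = ∑_k e^{-sk}
μ(Y_k∩A_i)`.

Karamata's Abelian theorem gives `Q_i(s) ~ β_i Γ(2-α) s^{α-1} ℓ(1/s)`. In the regime `q/κ → 0`,
which is what `c(n) → 0` produces, `Q_d(q)` dominates the left side. On the right, duality for the
transfer operator and `h_n^{(i)} → H^{(i)}` replace the inner series for `i < d` by `Q_i(s_i) ∫
H^{(i)} V`, up to errors measured by `∫_Y V`. Boundedness of `h_n^{(d)}` makes the terms carrying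
`1-e^{-q}` negligible against `κ^α ℓ(1/κ) ∫_Y V`. The sweeping condition bounds `∫_Y V` by a
multiple of `∫ H̃V`, so every error is a relative one (`tendsto_of_renewal_equation`), and `∫ H̃V ~
β_d q^{α-1} ℓ(1/q) / (κ^α ℓ(1/κ))`.

Substituting `q/n` and `κ/(c(n)n)` turns this into convergence of a rescaled double Laplace
transform to `β_d κ^{-α} q^{-(1-α)}`. Since `R_n` is nondecreasing in `n`, a monotone density
theorem inverts the transform in `q` exactly at time `n`, leaving `β_d κ^{-α}/Γ(1-α)`. The
continuity theorem for Laplace transforms then inverts in `κ`, leaving `β_d/(Γ(1-α)Γ(1+α)) = β_d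
sin(πα)/(πα)`. -/

namespace InfiniteErgodic

/-! ### Slowly varying functions: uniform convergence and Potter bounds -/

/-- If `f` is measurable and `f (x + u) - f x → 0` for every `u`, then the convergence is uniform
in `u ∈ [0, 1]`. -/
theorem exists_forall_abs_sub_le_of_tendsto_add_sub {f : ℝ → ℝ} (hf : Measurable f)
    (h : ∀ u, Tendsto (fun x => f (x + u) - f x) atTop (𝓝 0)) {ε : ℝ} (hε : 0 < ε) :
    ∃ x₀, ∀ x, x₀ ≤ x → ∀ y, x ≤ y → y ≤ x + 1 → |f y - f x| ≤ ε := by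
  by_contra! hcon
  choose a ha b hab hba hlt using fun n : ℕ => hcon n
  have hat : Tendsto a atTop atTop := tendsto_atTop_mono ha tendsto_natCast_atTop_atTop
  have hbt : Tendsto b atTop atTop := tendsto_atTop_mono hab hat
  -- For fixed `u` the increments along the sequence are eventually small, so the sets of `u ∈ [0,
  -- 2]` that have settled from time `n` on increase to `[0, 2]`; their measure eventually exceeds
  -- `3/2`.
  have key : ∀ a : ℕ → ℝ, Tendsto a atTop atTop → ∀ᶠ n in atTop,
      ENNReal.ofReal (3 / 2) < volume
        (Set.Icc (0 : ℝ) 2 ∩ {u | ∀ m, n ≤ m → |f (a m + u) - f (a m)| < ε / 2}) := by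
    intro a ha
    have hmono : Monotone fun n : ℕ =>
        Set.Icc (0 : ℝ) 2 ∩ {u | ∀ m, n ≤ m → |f (a m + u) - f (a m)| < ε / 2} :=
      fun n k hnk u hu => ⟨hu.1, fun m hm => hu.2 m (hnk.trans hm)⟩
    have hU : (⋃ n : ℕ, Set.Icc (0 : ℝ) 2 ∩
        {u | ∀ m, n ≤ m → |f (a m + u) - f (a m)| < ε / 2}) = Set.Icc (0 : ℝ) 2 := by
      ext u
      simp only [Set.mem_iUnion, Set.mem_inter_iff, Set.mem_ofPred_eq]
      refine ⟨fun ⟨n, hn⟩ => hn.1, fun hu => ?_⟩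
      have h1 := ((h u).comp ha).abs
      rw [abs_zero] at h1
      obtain ⟨n, hn⟩ := eventually_atTop.1 (h1.eventually_lt_const (half_pos hε))
      exact ⟨n, hu, fun m hm => hn m hm⟩
    have ht := tendsto_measure_iUnion_atTop (μ := volume) hmono
    rw [hU, Real.volume_Icc] at ht
    exact ht.eventually_const_lt ((ENNReal.ofReal_lt_ofReal_iff (by norm_num)).2 (by norm_num))
  obtain ⟨n, h1, h2⟩ := ((key a hat).and (key b hbt)).exists
  set U := Set.Icc (0 : ℝ) 2 ∩ {u | ∀ m, n ≤ m → |f (a m + u) - f (a m)| < ε / 2} with hUdef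
  set Z := Set.Icc (0 : ℝ) 2 ∩ {u | ∀ m, n ≤ m → |f (b m + u) - f (b m)| < ε / 2} with hZdef
  have hmeas : ∀ a : ℕ → ℝ, MeasurableSet
      (Set.Icc (0 : ℝ) 2 ∩ {u | ∀ m, n ≤ m → |f (a m + u) - f (a m)| < ε / 2}) := by
    intro a
    refine measurableSet_Icc.inter ?_
    simp only [Set.ofPred_forall]
    refine MeasurableSet.iInter fun m => MeasurableSet.iInter fun _ => ?_
    exact measurableSet_lt (by fun_prop) measurable_const
  -- `Z'` is `Z` translated by `b n - a n ∈ [0, 1]`, so `U` and `Z'` both lie in `[0, 3]` with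
  -- measure above `3/2` each and must meet. A common point compares `f (a n)` and `f (b n)` through
  -- the single value `f (a n + u)`.
  set Z' := (fun u => u + (a n - b n)) ⁻¹' Z with hZ'def
  have hZ' : volume Z' = volume Z := measure_preimage_add_right _ _ _
  have hsub : U ∪ Z' ⊆ Set.Icc 0 3 := by
    rintro u (hu | hu)
    · exact ⟨hu.1.1, hu.1.2.trans (by norm_num)⟩
    · have h3 : u + (a n - b n) ∈ Set.Icc (0 : ℝ) 2 := hu.1
      have h4 := hab n
      have h5 := hba n
      exact ⟨by linarith [h3.1], by linarith [h3.2]⟩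
  have hnd : ¬ Disjoint U Z' := by
    intro hd
    have h3 : volume (U ∪ Z') = volume U + volume Z' :=
      measure_union hd ((measurable_id.add_const _) (hmeas b))
    have h4 : volume (U ∪ Z') ≤ ENNReal.ofReal 3 := by
      have h6 := measure_mono (μ := volume) hsub
      rwa [Real.volume_Icc, sub_zero] at h6
    have h5 : ENNReal.ofReal (3 / 2) + ENNReal.ofReal (3 / 2) < volume U + volume Z' := by
      rw [hZ']
      exact ENNReal.add_lt_add h1 h2
    rw [← ENNReal.ofReal_add (by norm_num) (by norm_num)] at h5
    norm_num at h5
    exact absurd (h5.trans_le (h3 ▸ h4)) (by norm_num)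
  obtain ⟨u, huU, huZ⟩ := Set.not_disjoint_iff.1 hnd
  have h3 := huU.2 n le_rfl
  have h4 : |f (b n + (u + (a n - b n))) - f (b n)| < ε / 2 := huZ.2 n le_rfl
  rw [show b n + (u + (a n - b n)) = a n + u by ring] at h4
  have h5 := hlt n
  rw [abs_lt] at h3 h4
  have h6 : |f (b n) - f (a n)| < ε := abs_lt.2 ⟨by linarith, by linarith⟩
  linarith

namespace SlowlyVaryingAtInfty

variable {ℓ : ℝ → ℝ} (hℓ : SlowlyVaryingAtInfty ℓ)

include hℓ

/-- Potter bounds. -/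
theorem exists_forall_abs_log_sub_log_le {δ : ℝ} (hδ : 0 < δ) :
    ∃ t₀, 0 < t₀ ∧ ∀ t, t₀ ≤ t → ∀ s, t ≤ s →
      |Real.log (ℓ s) - Real.log (ℓ t)| ≤ δ * (1 + Real.log (s / t)) := by
  set f : ℝ → ℝ := fun x => Real.log (ℓ (Real.exp x)) with hf
  have hfm : Measurable f := by
    have h1 : Measurable fun x : ℝ => (⟨Real.exp x, Real.exp_pos x⟩ : Set.Ioi (0 : ℝ)) :=
      Real.measurable_exp.subtype_mk
    exact Real.measurable_log.comp (hℓ.measurable.comp h1)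
  have hlim : ∀ u, Tendsto (fun x => f (x + u) - f x) atTop (𝓝 0) := by
    intro u
    have h1 := ((hℓ.slow (Real.exp u) (Real.exp_pos u)).comp Real.tendsto_exp_atTop).log one_ne_zero
    rw [Real.log_one] at h1
    refine h1.congr fun x => ?_
    simp only [Function.comp, hf]
    rw [Real.log_div (hℓ.pos _ (by positivity)).ne' (hℓ.pos _ (by positivity)).ne', add_comm x,
      Real.exp_add]
  obtain ⟨x₀, hx₀⟩ := exists_forall_abs_sub_le_of_tendsto_add_sub hfm hlim hδ
  -- In the logarithmic variable, chaining unit steps makes the error grow linearly with the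
  -- distance.
  have hstep : ∀ k : ℕ, ∀ x, x₀ ≤ x → ∀ y, x ≤ y → y ≤ x + k → |f y - f x| ≤ δ * k := by
    intro k
    induction k with
    | zero =>
      intro x _ y hxy hyx
      have : y = x := le_antisymm (by simpa using hyx) hxy
      simp [this]
    | succ k ih =>
      intro x hx y hxy hyx
      push_cast at hyx ⊢
      rcases le_total y (x + k) with h1 | h1
      · have := ih x hx y hxy h1
        linarith
      · have hk : (0 : ℝ) ≤ k := k.cast_nonneg
        have h2 := ih x hx (x + k) (by linarith) le_rfl
        have h3 := hx₀ (x + k) (by linarith) y h1 (by linarith)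
        calc |f y - f x| ≤ |f y - f (x + k)| + |f (x + k) - f x| := abs_sub_le _ _ _
          _ ≤ δ * (k + 1) := by linarith
  refine ⟨Real.exp x₀, Real.exp_pos _, fun t ht s hts => ?_⟩
  have ht0 : 0 < t := (Real.exp_pos _).trans_le ht
  have hs0 : 0 < s := ht0.trans_le hts
  have hxy : Real.log t ≤ Real.log s := Real.log_le_log ht0 hts
  -- Rounding the number of unit steps up costs the additive `1` in the bound.
  have h1 := hstep ⌈Real.log s - Real.log t⌉₊ (Real.log t) ((Real.le_log_iff_exp_le ht0).2 ht)
    (Real.log s) hxy (by linarith [Nat.le_ceil (Real.log s - Real.log t)])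
  simp only [hf, Real.exp_log ht0, Real.exp_log hs0] at h1
  refine h1.trans (mul_le_mul_of_nonneg_left ?_ hδ.le)
  rw [Real.log_div hs0.ne' ht0.ne']
  linarith [Nat.ceil_lt_add_one (sub_nonneg.2 hxy)]

theorem eventually_abs_log_sub_log_le {ι : Type*} {l : Filter ι} {f g : ι → ℝ}
    (hf : Tendsto f l atTop) (hg : Tendsto g l atTop) {δ : ℝ} (hδ : 0 < δ) :
    ∀ᶠ i in l, |Real.log (ℓ (f i)) - Real.log (ℓ (g i))| ≤ δ * (1 + |Real.log (f i / g i)|) := by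
  obtain ⟨t₀, ht₀, h⟩ := hℓ.exists_forall_abs_log_sub_log_le hδ
  filter_upwards [hf.eventually_ge_atTop t₀, hg.eventually_ge_atTop t₀] with i h1 h2
  rcases le_total (g i) (f i) with h3 | h3
  · refine (h _ h2 _ h3).trans (mul_le_mul_of_nonneg_left ?_ hδ.le)
    linarith [le_abs_self (Real.log (f i / g i))]
  · rw [abs_sub_comm]
    refine (h _ h1 _ h3).trans (mul_le_mul_of_nonneg_left ?_ hδ.le)
    rw [← abs_neg, ← Real.log_inv, inv_div]
    linarith [le_abs_self (Real.log (g i / f i))]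

/-- The logarithm of `f / g` stays bounded, so a Potter bound with arbitrarily small `δ` forces the
logarithms of `ℓ (f i)` and `ℓ (g i)` together. -/
theorem tendsto_div_of_tendsto_div {ι : Type*} {l : Filter ι} {f g : ι → ℝ}
    (hf : Tendsto f l atTop) (hg : Tendsto g l atTop) {r : ℝ} (hr : 0 < r)
    (hfg : Tendsto (fun i => f i / g i) l (𝓝 r)) :
    Tendsto (fun i => ℓ (f i) / ℓ (g i)) l (𝓝 1) := by
  have hlog : Tendsto (fun i => Real.log (ℓ (f i)) - Real.log (ℓ (g i))) l (𝓝 0) := by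
    rw [Metric.tendsto_nhds]
    intro ε hε
    set M := 2 + |Real.log r| with hM
    have hM0 : 0 < M := by positivity
    have hb : ∀ᶠ i in l, |Real.log (f i / g i)| < 1 + |Real.log r| :=
      ((hfg.log hr.ne').abs).eventually_lt_const (by linarith)
    filter_upwards [hb, hℓ.eventually_abs_log_sub_log_le hf hg
      (show 0 < ε / (2 * M) by positivity)] with i h1 h2
    rw [Real.dist_eq, sub_zero]
    refine h2.trans_lt ?_
    calc ε / (2 * M) * (1 + |Real.log (f i / g i)|) ≤ ε / (2 * M) * M := by
          refine mul_le_mul_of_nonneg_left ?_ (by positivity)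
          linarith
      _ = ε / 2 := by field_simp
      _ < ε := half_lt_self hε
  have h1 := (Real.continuous_exp.tendsto 0).comp hlog
  rw [Real.exp_zero] at h1
  refine h1.congr' ?_
  filter_upwards [hf.eventually_gt_atTop 0, hg.eventually_gt_atTop 0] with i h2 h3
  simp only [Function.comp]
  rw [Real.exp_sub, Real.exp_log (hℓ.pos _ h2), Real.exp_log (hℓ.pos _ h3)]

/-- By Potter with `δ = ρ / 2`, the quotient of the values of `ℓ`, in either direction, consumes at
most half of the power `(g / f) ^ ρ`. -/
theorem tendsto_rpow_mul_div_zero {ι : Type*} {l : Filter ι} {f g : ι → ℝ}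
    (hf : Tendsto f l atTop) (hg : Tendsto g l atTop) {ρ : ℝ} (hρ : 0 < ρ)
    (hfg : Tendsto (fun i => f i / g i) l atTop) :
    Tendsto (fun i => (g i / f i) ^ ρ * (ℓ (f i) / ℓ (g i))) l (𝓝 0) ∧
    Tendsto (fun i => (g i / f i) ^ ρ * (ℓ (g i) / ℓ (f i))) l (𝓝 0) := by
  have hx : Tendsto (fun i => Real.log (f i / g i)) l atTop := Real.tendsto_log_atTop.comp hfg
  have hbnd : Tendsto (fun i => Real.exp (ρ / 2 - ρ / 2 * Real.log (f i / g i))) l (𝓝 0) := by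
    refine Real.tendsto_exp_atBot.comp ?_
    refine tendsto_atBot_add_const_left _ _ ?_
    exact tendsto_neg_atTop_atBot.comp (hx.const_mul_atTop (half_pos hρ))
  have hev := hℓ.eventually_abs_log_sub_log_le hf hg (half_pos hρ)
  have key : ∀ᶠ i in l, 0 ≤ (g i / f i) ^ ρ * (ℓ (f i) / ℓ (g i)) ∧
      0 ≤ (g i / f i) ^ ρ * (ℓ (g i) / ℓ (f i)) ∧
      (g i / f i) ^ ρ * (ℓ (f i) / ℓ (g i)) ≤ Real.exp (ρ / 2 - ρ / 2 * Real.log (f i / g i)) ∧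
      (g i / f i) ^ ρ * (ℓ (g i) / ℓ (f i)) ≤ Real.exp (ρ / 2 - ρ / 2 * Real.log (f i / g i)) := by
    filter_upwards [hev, hx.eventually_ge_atTop 0, hf.eventually_gt_atTop 0,
      hg.eventually_gt_atTop 0] with i h1 h2 h3 h4
    have hlf := hℓ.pos _ h3
    have hlg := hℓ.pos _ h4
    have e1 : (g i / f i) ^ ρ = Real.exp (-(ρ * Real.log (f i / g i))) := by
      rw [Real.rpow_def_of_pos (by positivity), Real.log_div h4.ne' h3.ne',
        Real.log_div h3.ne' h4.ne']
      ring_nf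
    have e2 : ℓ (f i) / ℓ (g i) = Real.exp (Real.log (ℓ (f i)) - Real.log (ℓ (g i))) := by
      rw [Real.exp_sub, Real.exp_log hlf, Real.exp_log hlg]
    have e3 : ℓ (g i) / ℓ (f i) = Real.exp (Real.log (ℓ (g i)) - Real.log (ℓ (f i))) := by
      rw [Real.exp_sub, Real.exp_log hlf, Real.exp_log hlg]
    rw [abs_of_nonneg h2, abs_le] at h1
    refine ⟨by positivity, by positivity, ?_, ?_⟩
    · rw [e1, e2, ← Real.exp_add, Real.exp_le_exp]
      nlinarith [h1.1, h1.2]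
    · rw [e1, e3, ← Real.exp_add, Real.exp_le_exp]
      nlinarith [h1.1, h1.2]
  exact ⟨squeeze_zero' (key.mono fun i h => h.1) (key.mono fun i h => h.2.2.1) hbnd,
    squeeze_zero' (key.mono fun i h => h.2.1) (key.mono fun i h => h.2.2.2) hbnd⟩

theorem tendsto_rpow_mul_atTop {ρ : ℝ} (hρ : 0 < ρ) :
    Tendsto (fun t : ℝ => t ^ ρ * ℓ t) atTop atTop := by
  obtain ⟨t₀, ht₀, h⟩ := hℓ.exists_forall_abs_log_sub_log_le (half_pos hρ)
  have h1 : Tendsto (fun t : ℝ => Real.exp (ρ / 2 * Real.log t +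
      (Real.log (ℓ t₀) - ρ / 2 + ρ / 2 * Real.log t₀))) atTop atTop :=
    Real.tendsto_exp_atTop.comp (tendsto_atTop_add_const_right _ _
      (Real.tendsto_log_atTop.const_mul_atTop (half_pos hρ)))
  refine tendsto_atTop_mono' _ ?_ h1
  filter_upwards [eventually_ge_atTop t₀] with t ht
  have ht0 := ht₀.trans_le ht
  have h2 := (abs_le.1 (h t₀ le_rfl t ht)).1
  rw [Real.log_div ht0.ne' ht₀.ne'] at h2
  rw [Real.rpow_def_of_pos ht0, ← Real.exp_log (hℓ.pos t ht0), ← Real.exp_add, Real.exp_le_exp]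
  linarith

end SlowlyVaryingAtInfty

/-! ### Continuity theorem for Laplace transforms -/

section LaplaceContinuity

variable {ι Ω Ω' : Type*} [MeasurableSpace Ω] [MeasurableSpace Ω'] {l : Filter ι}
  {P : ι → Measure Ω} {Z : ι → Ω → ℝ} {M : Measure Ω'} {U : Ω' → ℝ}

theorem integrable_exp_neg_mul_comp {f : ℝ → ℝ} (hf : Continuous f) (hU : Measurable U)
    (hU0 : ∀ x, 0 ≤ U x) (hint : Integrable (fun x => Real.exp (-U x)) M) :
    Integrable (fun x => Real.exp (-U x) * f (Real.exp (-U x))) M := by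
  obtain ⟨B, hB⟩ := (isCompact_Icc (a := (0 : ℝ)) (b := 1)).exists_bound_of_continuousOn
    hf.continuousOn
  refine hint.mul_bdd (c := B) (hf.measurable.comp
    (Real.measurable_exp.comp hU.neg)).aestronglyMeasurable (ae_of_all _ fun x => ?_)
  exact hB _ ⟨(Real.exp_pos _).le, Real.exp_le_one_iff.2 (by linarith [hU0 x])⟩

theorem integral_exp_neg_mul_polynomial (hU : Measurable U) (hU0 : ∀ x, 0 ≤ U x)
    (hint : Integrable (fun x => Real.exp (-U x)) M) (p : Polynomial ℝ) :
    ∫ x, Real.exp (-U x) * p.eval (Real.exp (-U x)) ∂M =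
      ∑ k ∈ Finset.range (p.natDegree + 1),
        p.coeff k * ∫ x, Real.exp (-((k + 1 : ℕ) * U x)) ∂M := by
  have h1 : ∀ x, Real.exp (-U x) * p.eval (Real.exp (-U x)) =
      ∑ k ∈ Finset.range (p.natDegree + 1),
        p.coeff k * (Real.exp (-U x) * Real.exp (-U x) ^ k) := by
    intro x
    rw [Polynomial.eval_eq_sum_range, Finset.mul_sum]
    exact Finset.sum_congr rfl fun k _ => by ring
  simp only [h1]
  rw [integral_finsetSum]
  · refine Finset.sum_congr rfl fun k _ => ?_
    rw [integral_const_mul]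
    congr 1
    refine integral_congr_ae (ae_of_all _ fun x => ?_)
    simp only
    rw [← pow_succ', ← Real.exp_nat_mul]
    ring_nf
  · intro k _
    exact (integrable_exp_neg_mul_comp (f := fun y => y ^ k) (by fun_prop) hU hU0 hint).const_mul _

theorem abs_integral_exp_neg_mul_sub_le {f g : ℝ → ℝ} (hf : Continuous f) (hg : Continuous g)
    (hU : Measurable U) (hU0 : ∀ x, 0 ≤ U x) (hint : Integrable (fun x => Real.exp (-U x)) M)
    {η : ℝ} (hη : ∀ y ∈ Set.Icc (0 : ℝ) 1, |f y - g y| ≤ η) :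
    |∫ x, Real.exp (-U x) * f (Real.exp (-U x)) ∂M -
      ∫ x, Real.exp (-U x) * g (Real.exp (-U x)) ∂M| ≤ η * ∫ x, Real.exp (-U x) ∂M := by
  rw [← integral_sub (integrable_exp_neg_mul_comp hf hU hU0 hint)
    (integrable_exp_neg_mul_comp hg hU hU0 hint), ← integral_const_mul]
  rw [← Real.norm_eq_abs]
  refine norm_integral_le_of_norm_le (hint.const_mul η) (ae_of_all _ fun x => ?_)
  rw [← mul_sub, norm_mul, Real.norm_eq_abs, Real.norm_eq_abs, abs_of_pos (Real.exp_pos _),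
    mul_comm]
  exact mul_le_mul_of_nonneg_right
    (hη _ ⟨(Real.exp_pos _).le, Real.exp_le_one_iff.2 (by linarith [hU0 x])⟩) (Real.exp_pos _).le

/-- By Weierstrass, `f` is uniformly close on `[0, 1]` to a polynomial, and `e^{-U}` times a
polynomial in `e^{-U}` only involves Laplace transforms at positive integers. The weight `e^{-U}` is
kept throughout because the measures may be infinite; it also controls the approximation error. -/
theorem tendsto_integral_exp_neg_mul_comp (hZ : ∀ i, Measurable (Z i)) (hZ0 : ∀ i ω, 0 ≤ Z i ω)
    (hZint : ∀ i, Integrable (fun ω => Real.exp (-Z i ω)) (P i))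
    (hU : Measurable U) (hU0 : ∀ x, 0 ≤ U x) (hUint : Integrable (fun x => Real.exp (-U x)) M)
    (hlim : ∀ k : ℕ, Tendsto (fun i => ∫ ω, Real.exp (-((k + 1 : ℕ) * Z i ω)) ∂(P i)) l
      (𝓝 (∫ x, Real.exp (-((k + 1 : ℕ) * U x)) ∂M)))
    {f : ℝ → ℝ} (hf : Continuous f) :
    Tendsto (fun i => ∫ ω, Real.exp (-Z i ω) * f (Real.exp (-Z i ω)) ∂(P i)) l
      (𝓝 (∫ x, Real.exp (-U x) * f (Real.exp (-U x)) ∂M)) := by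
  rw [Metric.tendsto_nhds]
  intro ε hε
  set B := ∫ x, Real.exp (-U x) ∂M with hB
  have hB0 : 0 ≤ B := integral_nonneg fun x => (Real.exp_pos _).le
  have hBlim : Tendsto (fun i => ∫ ω, Real.exp (-Z i ω) ∂(P i)) l (𝓝 B) := by
    simpa using hlim 0
  set η := ε / (4 * (B + 1)) with hη
  have hη0 : 0 < η := by positivity
  obtain ⟨p, hp⟩ := exists_polynomial_near_of_continuousOn 0 1 f hf.continuousOn η hη0
  have hp' : ∀ y ∈ Set.Icc (0 : ℝ) 1, |f y - p.eval y| ≤ η := fun y hy => by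
    rw [abs_sub_comm]
    exact (hp y hy).le
  have hplim : Tendsto (fun i => ∫ ω, Real.exp (-Z i ω) * p.eval (Real.exp (-Z i ω)) ∂(P i)) l
      (𝓝 (∫ x, Real.exp (-U x) * p.eval (Real.exp (-U x)) ∂M)) := by
    rw [integral_exp_neg_mul_polynomial hU hU0 hUint]
    simp only [fun i => integral_exp_neg_mul_polynomial (hZ i) (hZ0 i) (hZint i) p]
    exact tendsto_finsetSum _ fun k _ => (hlim k).const_mul _
  filter_upwards [hBlim.eventually_lt_const (lt_add_one B),
    (Metric.tendsto_nhds.1 hplim) (ε / 4) (by positivity)] with i h1 h2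
  have h3 := abs_integral_exp_neg_mul_sub_le hf p.continuous (hZ i) (hZ0 i) (hZint i) hp'
  have h4 := abs_integral_exp_neg_mul_sub_le hf p.continuous hU hU0 hUint hp'
  have h5 : η * (B + 1) = ε / 4 := by rw [hη]; field_simp
  have h6 : η * ∫ ω, Real.exp (-Z i ω) ∂(P i) ≤ η * (B + 1) :=
    mul_le_mul_of_nonneg_left h1.le hη0.le
  rw [← hB] at h4
  have h7 : η * B ≤ η * (B + 1) := mul_le_mul_of_nonneg_left (by linarith) hη0.le
  rw [Real.dist_eq] at h2 ⊢
  rw [abs_le] at h3 h4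
  rw [abs_lt] at h2 ⊢
  constructor <;> linarith [h3.1, h3.2, h4.1, h4.2, h2.1, h2.2]

/-- A continuous cutoff which, multiplied by `y`, lies between the indicators of `[e⁻ʳ, ∞)` and
of `[e⁻ᵗ, ∞)`. -/
noncomputable def expCutoff (r t y : ℝ) : ℝ :=
  max 0 (min 1 ((y - Real.exp (-t)) / (Real.exp (-r) - Real.exp (-t)))) / max y (Real.exp (-t))

theorem continuous_expCutoff (r t : ℝ) : Continuous (expCutoff r t) := by
  unfold expCutoff
  refine Continuous.div (by fun_prop) (by fun_prop) fun y => ?_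
  exact ((Real.exp_pos _).trans_le (le_max_right _ _)).ne'

theorem exp_neg_mul_expCutoff_mem {r t : ℝ} (hrt : r < t) (x : ℝ) :
    (Set.Iic r).indicator 1 x ≤ Real.exp (-x) * expCutoff r t (Real.exp (-x)) ∧
    Real.exp (-x) * expCutoff r t (Real.exp (-x)) ≤ (Set.Iic t).indicator 1 x := by
  have hd : 0 < Real.exp (-r) - Real.exp (-t) := sub_pos.2 (Real.exp_lt_exp.2 (by linarith))
  unfold expCutoff
  rcases le_or_gt x t with h | h
  · have h1 : Real.exp (-t) ≤ Real.exp (-x) := Real.exp_le_exp.2 (by linarith)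
    rw [max_eq_left h1, mul_div_cancel₀ _ (Real.exp_pos _).ne', Set.indicator_of_mem
      (show x ∈ Set.Iic t from h)]
    refine ⟨?_, max_le zero_le_one (min_le_left _ _)⟩
    rcases le_or_gt x r with h2 | h2
    · rw [Set.indicator_of_mem (show x ∈ Set.Iic r from h2), min_eq_left, max_eq_right]
      · rfl
      · exact zero_le_one
      · rw [le_div_iff₀ hd, one_mul]
        have : Real.exp (-r) ≤ Real.exp (-x) := Real.exp_le_exp.2 (by linarith)
        linarith
    · rw [Set.indicator_of_notMem (show x ∉ Set.Iic r from not_le.2 h2)]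
      exact le_max_left _ _
  · have h1 : Real.exp (-x) ≤ Real.exp (-t) := Real.exp_le_exp.2 (by linarith)
    have h2 : (Real.exp (-x) - Real.exp (-t)) / (Real.exp (-r) - Real.exp (-t)) ≤ 0 :=
      div_nonpos_of_nonpos_of_nonneg (by linarith) hd.le
    rw [Set.indicator_of_notMem (show x ∉ Set.Iic r from not_le.2 (hrt.trans h)),
      Set.indicator_of_notMem (show x ∉ Set.Iic t from not_le.2 h),
      max_eq_left ((min_le_right _ _).trans h2)]
    simp

theorem measure_le_lt_top (hUint : Integrable (fun x => Real.exp (-U x)) M)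
    (r : ℝ) : M {x | U x ≤ r} < ∞ := by
  refine (measure_mono fun x (hx : U x ≤ r) => ?_).trans_lt
    (hUint.measure_ge_lt_top (Real.exp_pos (-r)))
  exact Real.exp_le_exp.2 (by linarith)

theorem measureReal_le_integral_expCutoff (hU : Measurable U) (hU0 : ∀ x, 0 ≤ U x)
    (hUint : Integrable (fun x => Real.exp (-U x)) M) {r t : ℝ} (hrt : r < t) :
    M.real {x | U x ≤ r} ≤ ∫ x, Real.exp (-U x) * expCutoff r t (Real.exp (-U x)) ∂M ∧
    ∫ x, Real.exp (-U x) * expCutoff r t (Real.exp (-U x)) ∂M ≤ M.real {x | U x ≤ t} := by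
  have hm : ∀ r : ℝ, MeasurableSet {x | U x ≤ r} := fun r => measurableSet_le hU measurable_const
  have hi : ∀ r : ℝ, Integrable (fun x => {x | U x ≤ r}.indicator (1 : Ω' → ℝ) x) M := fun r =>
    (integrable_indicator_iff (hm r)).2
      (integrableOn_const (measure_le_lt_top hUint r).ne)
  have hc := integrable_exp_neg_mul_comp (continuous_expCutoff r t) hU hU0 hUint
  have he : ∀ r : ℝ, M.real {x | U x ≤ r} = ∫ x, {x | U x ≤ r}.indicator (1 : Ω' → ℝ) x ∂M :=
    fun r => (integral_indicator_one (hm r)).symm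
  rw [he r, he t]
  exact ⟨integral_mono (hi r) hc fun x => (exp_neg_mul_expCutoff_mem hrt (U x)).1,
    integral_mono hc (hi t) fun x => (exp_neg_mul_expCutoff_mem hrt (U x)).2⟩

/-- The continuity theorem for Laplace transforms, with a power law in the limit. -/
theorem tendsto_measureReal_le_one_of_tendsto_laplace {ρ C : ℝ} (hρ : 0 < ρ) (hC : 0 ≤ C)
    (hZ : ∀ i, Measurable (Z i)) (hZ0 : ∀ i ω, 0 ≤ Z i ω)
    (hZint : ∀ i, Integrable (fun ω => Real.exp (-Z i ω)) (P i))
    (hlim : ∀ q : ℝ, 0 < q → Tendsto (fun i => ∫ ω, Real.exp (-(q * Z i ω)) ∂(P i)) l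
      (𝓝 (C * q ^ (-ρ)))) :
    Tendsto (fun i => (P i).real {ω | Z i ω ≤ 1}) l (𝓝 (C / Real.Gamma (1 + ρ))) := by
  have hΓ : 0 < Real.Gamma ρ := Real.Gamma_pos_of_pos hρ
  -- The limit law is `D x^{ρ-1} dx` on `(0, ∞)`: by the Gamma integral its Laplace transform is `C
  -- q^{-ρ}`, and it gives `(0, r]` mass `C r^ρ / Γ(1+ρ)`.
  set D := C / Real.Gamma ρ with hD
  have hD0 : 0 ≤ D := by positivity
  set N : Measure (Set.Ioi (0 : ℝ)) := (volume.comap Subtype.val).withDensity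
    fun x => ENNReal.ofReal (D * (x : ℝ) ^ (ρ - 1)) with hN
  have hdm : Measurable fun x : Set.Ioi (0 : ℝ) => (D * (x : ℝ) ^ (ρ - 1)) := by fun_prop
  have hintN : ∀ g : ℝ → ℝ, ∫ x : Set.Ioi (0 : ℝ), g x ∂N =
      ∫ x in Set.Ioi (0 : ℝ), D * x ^ (ρ - 1) * g x := by
    intro g
    rw [hN, integral_withDensity_eq_integral_toReal_smul (by fun_prop)
      (ae_of_all _ fun _ => ENNReal.ofReal_lt_top),
      ← integral_subtype_comap measurableSet_Ioi (fun x : ℝ => D * x ^ (ρ - 1) * g x)]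
    refine integral_congr_ae (ae_of_all _ fun x => ?_)
    have hx : (0 : ℝ) < x := x.2
    simp only [smul_eq_mul]
    rw [ENNReal.toReal_ofReal (by positivity)]
  have hNint : Integrable (fun x : Set.Ioi (0 : ℝ) => Real.exp (-(x : ℝ))) N := by
    rw [hN, integrable_withDensity_iff_integrable_smul' (by fun_prop)
      (ae_of_all _ fun _ => ENNReal.ofReal_lt_top)]
    have h1 : IntegrableOn (fun x : ℝ => D * (Real.exp (-x) * x ^ (ρ - 1))) (Set.Ioi 0) :=
      (Real.GammaIntegral_convergent hρ).const_mul D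
    rw [integrableOn_iff_comap_subtypeVal measurableSet_Ioi] at h1
    refine h1.congr (ae_of_all _ fun x => ?_)
    have hx : (0 : ℝ) < x := x.2
    simp only [smul_eq_mul, Function.comp]
    rw [ENNReal.toReal_ofReal (by positivity)]
    ring
  have hNlap : ∀ q : ℝ, 0 < q → ∫ x : Set.Ioi (0 : ℝ), Real.exp (-(q * x)) ∂N = C * q ^ (-ρ) := by
    intro q hq
    rw [hintN fun x => Real.exp (-(q * x))]
    simp only [mul_assoc]
    rw [integral_const_mul, Real.integral_rpow_mul_exp_neg_mul_Ioi hρ hq, hD, one_div,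
      Real.inv_rpow hq.le, Real.rpow_neg hq.le]
    field_simp
  have hNle : ∀ r : ℝ, 0 < r → N.real {x | (x : ℝ) ≤ r} = C / Real.Gamma (1 + ρ) * r ^ ρ := by
    intro r hr
    have h0 : MeasurableSet {x : Set.Ioi (0 : ℝ) | (x : ℝ) ≤ r} :=
      measurableSet_le measurable_subtype_coe measurable_const
    rw [← integral_indicator_one h0]
    have h1 := hintN ((Set.Iic r).indicator 1)
    have h2 : ∀ x : Set.Ioi (0 : ℝ), {x : Set.Ioi (0 : ℝ) | (x : ℝ) ≤ r}.indicator 1 x =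
      (Set.Iic r).indicator (1 : ℝ → ℝ) x := fun x => by
        simp [Set.indicator_apply]
    simp only [h2]
    rw [h1]
    have h3 : ∀ x : ℝ, D * x ^ (ρ - 1) * (Set.Iic r).indicator 1 x =
        (Set.Iic r).indicator (fun x => D * x ^ (ρ - 1)) x := fun x => by
      by_cases hx : x ∈ Set.Iic r <;> simp [hx]
    simp only [h3]
    rw [setIntegral_indicator measurableSet_Iic, Set.Ioi_inter_Iic,
      ← intervalIntegral.integral_of_le hr.le, intervalIntegral.integral_const_mul,
      integral_rpow (Or.inl (by linarith)), hD, add_comm 1 ρ, Real.Gamma_add_one hρ.ne']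
    rw [sub_add_cancel, Real.zero_rpow hρ.ne', sub_zero]
    field_simp
  have hcut : ∀ r t : ℝ, Tendsto (fun i => ∫ ω, Real.exp (-Z i ω) *
      expCutoff r t (Real.exp (-Z i ω)) ∂(P i)) l
      (𝓝 (∫ x : Set.Ioi (0 : ℝ), Real.exp (-(x : ℝ)) * expCutoff r t (Real.exp (-(x : ℝ))) ∂N)) := by
    intro r t
    refine tendsto_integral_exp_neg_mul_comp hZ hZ0 hZint measurable_subtype_coe
      (fun x => le_of_lt x.2) hNint (fun k => ?_) (continuous_expCutoff r t)
    have hk : (0 : ℝ) < (k + 1 : ℕ) := by positivity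
    have h1 := hlim _ hk
    rw [← hNlap _ hk] at h1
    exact h1
  have hcont : Tendsto (fun r : ℝ => C / Real.Gamma (1 + ρ) * r ^ ρ) (𝓝 1)
      (𝓝 (C / Real.Gamma (1 + ρ))) := by
    have h1 : ContinuousAt (fun r : ℝ => C / Real.Gamma (1 + ρ) * r ^ ρ) 1 :=
      continuousAt_const.mul (Real.continuousAt_rpow_const _ _ (Or.inl one_ne_zero))
    simpa [ContinuousAt] using h1
  -- The indicator of `(-∞, 1]` is squeezed between cutoffs for `(r, 1)` with `r < 1` and for `(1,
  -- r)` with `r > 1`. Letting `r → 1` loses nothing because the limiting distribution function is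
  -- continuous.
  rw [tendsto_order]
  constructor
  · intro b hb
    have h1 := (hcont.eventually_const_lt hb).filter_mono (nhdsWithin_le_nhds (s := Set.Iio 1))
    obtain ⟨r, hr1, hr2, hr0⟩ := (h1.and ((eventually_mem_nhdsWithin).and
      ((eventually_gt_nhds (show (0 : ℝ) < 1 from one_pos)).filter_mono
        nhdsWithin_le_nhds))).exists
    have h2 := (measureReal_le_integral_expCutoff measurable_subtype_coe
      (fun x : Set.Ioi (0 : ℝ) => le_of_lt x.2) hNint (show r < 1 from hr2)).1
    rw [hNle r hr0] at h2
    filter_upwards [(hcut r 1).eventually_const_lt (hr1.trans_le h2)] with i hi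
    exact hi.trans_le (measureReal_le_integral_expCutoff (hZ i) (hZ0 i) (hZint i)
      (show r < 1 from hr2)).2
  · intro b hb
    have h1 := (hcont.eventually_lt_const hb).filter_mono (nhdsWithin_le_nhds (s := Set.Ioi 1))
    obtain ⟨r, hr1, hr2⟩ := (h1.and eventually_mem_nhdsWithin).exists
    have h2 := (measureReal_le_integral_expCutoff measurable_subtype_coe
      (fun x : Set.Ioi (0 : ℝ) => le_of_lt x.2) hNint (show 1 < r from hr2)).2
    rw [hNle r (one_pos.trans hr2)] at h2
    filter_upwards [(hcut 1 r).eventually_lt_const (h2.trans_lt hr1)] with i hi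
    exact (measureReal_le_integral_expCutoff (hZ i) (hZ0 i) (hZint i)
      (show 1 < r from hr2)).1.trans_lt hi

end LaplaceContinuity

/-! ### Monotone density theorem along the diagonal -/

section MonotoneDensity

theorem integrable_withDensity_count {v : ℕ → ℝ} (hv : ∀ k, 0 ≤ v k) {f : ℕ → ℝ}
    (hf : Summable fun k => f k * v k) :
    Integrable f (Measure.count.withDensity fun k => ENNReal.ofReal (v k)) := by
  rw [integrable_withDensity_iff_integrable_smul' (measurable_of_countable _)
      (ae_of_all _ fun _ => ENNReal.ofReal_lt_top), integrable_count_iff]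
  refine hf.norm.congr fun k => ?_
  rw [ENNReal.toReal_ofReal (hv k), smul_eq_mul, mul_comm]

theorem integral_withDensity_count {v : ℕ → ℝ} (hv : ∀ k, 0 ≤ v k) {f : ℕ → ℝ}
    (hf : Summable fun k => f k * v k) :
    ∫ k, f k ∂(Measure.count.withDensity fun k => ENNReal.ofReal (v k)) = ∑' k, f k * v k := by
  rw [integral_countable (integrable_withDensity_count hv hf)]
  refine tsum_congr fun k => ?_
  rw [measureReal_def, withDensity_apply _ (measurableSet_singleton k), lintegral_singleton,
    Measure.count_singleton, mul_one, ENNReal.toReal_ofReal (hv k), smul_eq_mul, mul_comm]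

theorem measureReal_withDensity_count_div_le_one {v : ℕ → ℝ} (hv : ∀ k, 0 ≤ v k) {n : ℕ}
    (hn : 0 < n) {r : ℝ} (hr : 0 < r) :
    (Measure.count.withDensity fun k => ENNReal.ofReal (v k)).real {k : ℕ | (k : ℝ) / (n * r) ≤ 1} =
      ∑ k ∈ Finset.range (⌊n * r⌋₊ + 1), v k := by
  have hn' : (0 : ℝ) < n := by exact_mod_cast hn
  have hset : {k : ℕ | (k : ℝ) / (n * r) ≤ 1} = ↑(Finset.range (⌊n * r⌋₊ + 1)) := by
    ext k
    simp only [Set.mem_ofPred_eq, Finset.coe_range, Set.mem_Iio]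
    rw [div_le_one (by positivity), Nat.lt_add_one_iff, Nat.le_floor_iff (by positivity)]
  rw [hset, measureReal_def, withDensity_apply _ (Finset.measurableSet _), lintegral_finset,
    ENNReal.toReal_sum (fun k _ => by simp)]
  simp [hv]

/-- A monotone density theorem: a doubly indexed antitone sequence whose rescaled Laplace
transforms converge to a power law converges along the diagonal. -/
theorem tendsto_diagonal_of_antitone_of_tendsto_laplace {u : ℕ → ℕ → ℝ} (hu0 : ∀ n k, 0 ≤ u n k)
    (hanti : ∀ n, Antitone (u n)) {ρ C : ℝ} (hρ : 0 < ρ) (hC : 0 ≤ C)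
    (hlim : ∀ q : ℝ, 0 < q → Tendsto (fun n : ℕ =>
      1 / (n : ℝ) * ∑' k : ℕ, Real.exp (-(q / n * k)) * u n k) atTop (𝓝 (C * q ^ (-ρ)))) :
    Tendsto (fun n => u n n) atTop (𝓝 (C / Real.Gamma ρ)) := by
  have hv : ∀ n k : ℕ, 0 ≤ 1 / (n : ℝ) * u n k := fun n k => mul_nonneg (by positivity) (hu0 n k)
  have hsum : ∀ s : ℝ, 0 < s → ∀ n : ℕ,
      Summable fun k : ℕ => Real.exp (-(s / n * k)) * (1 / (n : ℝ) * u n k) := by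
    intro s hs n
    rcases Nat.eq_zero_or_pos n with rfl | hn
    · simp
    have hn' : (0 : ℝ) < n := by exact_mod_cast hn
    have h1 : Summable fun k : ℕ => Real.exp (-(s / n)) ^ k * (1 / (n : ℝ) * u n 0) :=
      (summable_geometric_of_lt_one (Real.exp_pos _).le
        (Real.exp_lt_one_iff.2 (by have := div_pos hs hn'; linarith))).mul_right _
    refine h1.of_nonneg_of_le (fun k => mul_nonneg (Real.exp_pos _).le (hv n k)) fun k => ?_
    rw [← Real.exp_nat_mul, show (k : ℝ) * -(s / n) = -(s / n * k) by ring]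
    exact mul_le_mul_of_nonneg_left
      (mul_le_mul_of_nonneg_left (hanti n (Nat.zero_le k)) (by positivity)) (Real.exp_pos _).le
  set P : ℕ → Measure ℕ := fun n =>
    Measure.count.withDensity fun k => ENNReal.ofReal (1 / (n : ℝ) * u n k) with hP
  set g : ℝ → ℝ := fun r => C / Real.Gamma (1 + ρ) * r ^ ρ with hg
  -- The continuity theorem is applied to the measure with mass `u n k / n` at `k`, observed through
  -- `k / (n r)`; the event that this is at most `1` is `k ≤ ⌊n r⌋`.
  have hS : ∀ r : ℝ, 0 < r → Tendsto (fun n : ℕ =>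
      ∑ k ∈ Finset.range (⌊n * r⌋₊ + 1), 1 / (n : ℝ) * u n k) atTop (𝓝 (g r)) := by
    intro r hr
    have h1 := tendsto_measureReal_le_one_of_tendsto_laplace (l := atTop) (P := P)
      (Z := fun n k => (k : ℝ) / (n * r)) (C := C * r ^ ρ) hρ (by positivity)
      (fun n => measurable_of_countable _) (fun n k => by positivity) (fun n => by
        refine integrable_withDensity_count (hv n) ((hsum (1 / r) (by positivity) n).congr
          fun k => ?_)
        rw [show 1 / r / n * k = k / (n * r) by field_simp]) (fun q hq => by
        have h2 := hlim (q / r) (by positivity)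
        have e1 : C * (q / r) ^ (-ρ) = C * r ^ ρ * q ^ (-ρ) := by
          rw [Real.div_rpow hq.le hr.le, Real.rpow_neg hr.le, div_inv_eq_mul]
          ring
        rw [e1] at h2
        refine h2.congr fun n => ?_
        have h3 : ∀ k : ℕ, Real.exp (-(q * ((k : ℝ) / (n * r)))) =
            Real.exp (-(q / r / n * k)) := fun k => by
          rw [show q * ((k : ℝ) / (n * r)) = q / r / n * k by field_simp]
        simp only [h3]
        rw [integral_withDensity_count (hv n) (hsum (q / r) (by positivity) n), ← tsum_mul_left]
        exact tsum_congr fun k => by ring)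
    have e2 : C * r ^ ρ / Real.Gamma (1 + ρ) = g r := by
      simp only [hg]
      ring
    rw [e2] at h1
    refine h1.congr' ?_
    filter_upwards [eventually_gt_atTop 0] with n hn
    exact measureReal_withDensity_count_div_le_one (hv n) hn hr
  -- There are at most `δ n` indices in `(n, n(1+δ)]`, and there `u n k ≤ u n n`.
  have hup : ∀ δ : ℝ, 0 < δ → ∀ᶠ n : ℕ in atTop,
      ∑ k ∈ Finset.range (⌊n * (1 + δ)⌋₊ + 1), 1 / (n : ℝ) * u n k -
        ∑ k ∈ Finset.range (⌊n * (1 : ℝ)⌋₊ + 1), 1 / (n : ℝ) * u n k ≤ δ * u n n := by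
    intro δ hδ
    filter_upwards [eventually_gt_atTop 0] with n hn
    have hn' : (0 : ℝ) < n := by exact_mod_cast hn
    have hle : n ≤ ⌊n * (1 + δ)⌋₊ := Nat.le_floor (by nlinarith)
    rw [mul_one, Nat.floor_natCast, Finset.sum_range_sub_sum_range (by omega)]
    have hfl := Nat.floor_le (show 0 ≤ n * (1 + δ) by positivity)
    refine (Finset.sum_le_card_nsmul _ _ (1 / (n : ℝ) * u n n) fun k hk => ?_).trans ?_
    · simp only [Finset.mem_filter, Finset.mem_range] at hk
      exact mul_le_mul_of_nonneg_left (hanti n (by omega)) (by positivity)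
    · have hcard : ((Finset.range (⌊n * (1 + δ)⌋₊ + 1)).filter fun k => n + 1 ≤ k) =
          Finset.Ico (n + 1) (⌊n * (1 + δ)⌋₊ + 1) := by
        ext k
        simp only [Finset.mem_filter, Finset.mem_range, Finset.mem_Ico]
        omega
      rw [hcard, Nat.card_Ico, nsmul_eq_mul, Nat.add_sub_add_right, Nat.cast_sub hle, ← mul_assoc]
      refine mul_le_mul_of_nonneg_right ?_ (hu0 n n)
      rw [mul_one_div, div_le_iff₀ hn']
      linarith
  -- At least `δ n` indices lie between `⌊n(1-δ)⌋` and `n`, and there `u n k ≥ u n n`.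
  have hlow : ∀ δ : ℝ, 0 < δ → δ < 1 → ∀ᶠ n : ℕ in atTop,
      δ * u n n ≤ ∑ k ∈ Finset.range (⌊n * (1 : ℝ)⌋₊ + 1), 1 / (n : ℝ) * u n k -
        ∑ k ∈ Finset.range (⌊n * (1 - δ)⌋₊ + 1), 1 / (n : ℝ) * u n k := by
    intro δ hδ hδ1
    filter_upwards [eventually_gt_atTop 0] with n hn
    have hn' : (0 : ℝ) < n := by exact_mod_cast hn
    have hfl := Nat.floor_le (show 0 ≤ n * (1 - δ) from mul_nonneg hn'.le (by linarith))
    have hle : ⌊n * (1 - δ)⌋₊ ≤ n := by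
      have : (⌊n * (1 - δ)⌋₊ : ℝ) ≤ n := hfl.trans (by nlinarith)
      exact_mod_cast this
    rw [mul_one, Nat.floor_natCast, Finset.sum_range_sub_sum_range (by omega)]
    refine le_trans ?_ (Finset.card_nsmul_le_sum _ _ (1 / (n : ℝ) * u n n) fun k hk => ?_)
    · have hcard : ((Finset.range (n + 1)).filter fun k => ⌊n * (1 - δ)⌋₊ + 1 ≤ k) =
          Finset.Ico (⌊n * (1 - δ)⌋₊ + 1) (n + 1) := by
        ext k
        simp only [Finset.mem_filter, Finset.mem_range, Finset.mem_Ico]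
        omega
      rw [hcard, Nat.card_Ico, nsmul_eq_mul, Nat.add_sub_add_right, Nat.cast_sub hle, ← mul_assoc]
      refine mul_le_mul_of_nonneg_right ?_ (hu0 n n)
      rw [mul_one_div, le_div_iff₀ hn']
      linarith
    · simp only [Finset.mem_filter, Finset.mem_range] at hk
      exact mul_le_mul_of_nonneg_left (hanti n (by omega)) (by positivity)
  -- Both difference quotients of `g` at `1` tend to `g' 1`, which is `C / Γ(ρ)` because `Γ(1+ρ) = ρ
  -- Γ(ρ)`.
  have hder : HasDerivAt g (C / Real.Gamma ρ) 1 := by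
    have h1 := (Real.hasDerivAt_rpow_const (x := 1) (p := ρ) (Or.inl one_ne_zero)).const_mul
      (C / Real.Gamma (1 + ρ))
    refine h1.congr_deriv ?_
    have := Real.Gamma_pos_of_pos hρ
    rw [add_comm 1 ρ, Real.Gamma_add_one hρ.ne', Real.one_rpow]
    field_simp
  have hslope := hder.tendsto_slope_zero
  rw [tendsto_order]
  constructor
  · intro b hb
    have h1 := (hslope.mono_left (nhdsGT_le_nhdsNE 0)).eventually_const_lt hb
    obtain ⟨δ, hδ1, hδ⟩ := (h1.and eventually_mem_nhdsWithin).exists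
    have hδ0 : (0 : ℝ) < δ := hδ
    rw [smul_eq_mul, ← div_eq_inv_mul, lt_div_iff₀ hδ0] at hδ1
    filter_upwards [hup δ hδ0, ((hS (1 + δ) (by linarith)).sub
      (hS 1 one_pos)).eventually_const_lt hδ1] with n h2 h3
    nlinarith [h3.trans_le h2]
  · intro b hb
    have h1 := (hslope.mono_left (nhdsLT_le_nhdsNE 0)).eventually_lt_const hb
    obtain ⟨δ, hδ1, hδ, hδ2⟩ := (h1.and (eventually_mem_nhdsWithin.and
      ((eventually_gt_nhds (show (-1 : ℝ) < 0 by norm_num)).filter_mono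
        nhdsWithin_le_nhds))).exists
    have hδ0 : δ < 0 := hδ
    rw [smul_eq_mul, ← div_eq_inv_mul, div_lt_iff_of_neg hδ0] at hδ1
    have hS1 := hS (1 - -δ) (by linarith)
    have h4 : b * δ < g (1 + δ) - g 1 := hδ1
    rw [← sub_neg_eq_add 1 δ] at h4
    have h5 : g 1 - g (1 - -δ) < b * -δ := by linarith
    filter_upwards [hlow (-δ) (by linarith) (by linarith), ((hS 1 one_pos).sub
      hS1).eventually_lt_const h5] with n h2 h3
    nlinarith [h2.trans_lt h3]

end MonotoneDensity

/-! ### Abelian theorems for power series -/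

section Abelian

/-- Summation by parts against the decreasing weights `z ^ k`. The sign of `f` is unrestricted,
which is what allows differences of two series to be compared later. -/
theorem tsum_pow_mul_le_of_sum_le {f : ℕ → ℝ} {B : ℝ} (hf : ∀ n, ∑ k ∈ Finset.range n, f k ≤ B)
    {z : ℝ} (hz0 : 0 ≤ z) (hz1 : z ≤ 1) (hsum : Summable fun k => z ^ k * f k) :
    ∑' k, z ^ k * f k ≤ B := by
  -- The bound is strengthened so that the induction closes: the slack `B - ∑ f` is carried with
  -- weight `z ^ n`, and it is nonnegative.
  have h1 : ∀ n, ∑ k ∈ Finset.range n, z ^ k * f k ≤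
      B - z ^ n * (B - ∑ k ∈ Finset.range n, f k) := by
    intro n
    induction n with
    | zero => simp
    | succ n ih =>
      rw [Finset.sum_range_succ, Finset.sum_range_succ]
      have h2 := hf (n + 1)
      rw [Finset.sum_range_succ] at h2
      have h3 : z ^ (n + 1) ≤ z ^ n := pow_le_pow_of_le_one hz0 hz1 (Nat.le_succ n)
      nlinarith
  refine hsum.tsum_le_of_sum_range_le fun n => (h1 n).trans ?_
  have := mul_nonneg (pow_nonneg hz0 n) (sub_nonneg.2 (hf n))
  linarith

/-- Write `e^{-k/t}` as the integral of `e^{-y}` over `y ≥ k/t` and exchange sum and integral; the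
terms present at `y` are those with `k ≤ y t`. -/
theorem tsum_exp_neg_mul_eq_integral {a : ℕ → ℝ} {B : ℝ} (ha0 : ∀ k, 0 ≤ a k) (haB : ∀ k, a k ≤ B)
    {t : ℝ} (ht : 0 < t) :
    ∑' k : ℕ, Real.exp (-(k / t)) * a k =
      ∫ y in Set.Ioi (0 : ℝ), Real.exp (-y) * ∑ k ∈ Finset.range (⌊y * t⌋₊ + 1), a k := by
  have hexp : ∀ k : ℕ, IntegrableOn (fun y : ℝ => Real.exp (-y)) (Set.Ici ((k : ℝ) / t)) := by
    intro k
    rw [integrableOn_Ici_iff_integrableOn_Ioi]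
    exact integrableOn_exp_neg_Ioi _
  set F : ℕ → ℝ → ℝ := fun k => (Set.Ici ((k : ℝ) / t)).indicator fun y => Real.exp (-y) * a k
    with hF
  have hFi : ∀ k, Integrable (F k) (volume.restrict (Set.Ioi 0)) := fun k =>
    (((integrable_indicator_iff measurableSet_Ici).2 ((hexp k).mul_const (a k)))).integrableOn
  have hFint : ∀ k : ℕ, ∫ y in Set.Ioi (0 : ℝ), F k y = Real.exp (-(k / t)) * a k := by
    intro k
    rw [← integral_Ici_eq_integral_Ioi, setIntegral_indicator measurableSet_Ici,
      Set.Ici_inter_Ici, max_eq_right (by positivity), integral_mul_const,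
      integral_Ici_eq_integral_Ioi, integral_exp_neg_Ioi]
  have hF0 : ∀ k y, 0 ≤ F k y := fun k y =>
    Set.indicator_nonneg (fun y _ => mul_nonneg (Real.exp_pos _).le (ha0 k)) y
  have hsum : Summable fun k : ℕ => Real.exp (-(k / t)) * a k := by
    have h1 : Summable fun k : ℕ => Real.exp (-(1 / t)) ^ k * B :=
      (summable_geometric_of_lt_one (Real.exp_pos _).le
        (Real.exp_lt_one_iff.2 (by have := one_div_pos.2 ht; linarith))).mul_right _
    refine h1.of_nonneg_of_le (fun k => mul_nonneg (Real.exp_pos _).le (ha0 k)) fun k => ?_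
    rw [← Real.exp_nat_mul, show (k : ℝ) * -(1 / t) = -(k / t) by ring]
    exact mul_le_mul_of_nonneg_left (haB k) (Real.exp_pos _).le
  have h2 := integral_tsum_of_summable_integral_norm hFi (by
    refine hsum.congr fun k => ?_
    rw [← hFint]
    exact integral_congr_ae (ae_of_all _ fun y => by
      simp only
      rw [Real.norm_of_nonneg (hF0 k y)]))
  simp only [hFint] at h2
  rw [h2]
  refine setIntegral_congr_fun measurableSet_Ioi fun y hy => ?_
  have hy0 : 0 < y := hy
  have h3 : ∀ k : ℕ, (y ∈ Set.Ici ((k : ℝ) / t)) ↔ k ∈ Finset.range (⌊y * t⌋₊ + 1) := fun k => by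
    rw [Finset.mem_range, Nat.lt_add_one_iff, Nat.le_floor_iff (by positivity), Set.mem_Ici,
      div_le_iff₀ ht]
  rw [tsum_eq_sum (s := Finset.range (⌊y * t⌋₊ + 1)), Finset.mul_sum]
  · refine Finset.sum_congr rfl fun k hk => ?_
    simp only [hF]
    rw [Set.indicator_of_mem ((h3 k).2 hk)]
  · intro k hk
    simp only [hF]
    rw [Set.indicator_of_notMem (mt (h3 k).1 hk)]

/-- Karamata's Abelian theorem for power series. -/
theorem tendsto_tsum_exp_neg_mul_div {ℓ : ℝ → ℝ} (hℓ : SlowlyVaryingAtInfty ℓ) {a : ℕ → ℝ} {B : ℝ}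
    (ha0 : ∀ k, 0 ≤ a k) (haB : ∀ k, a k ≤ B) {σ b : ℝ} (hσ0 : 0 ≤ σ) (hσ1 : σ ≤ 1) (hb : 0 < b)
    (hw : (fun n : ℕ => ∑ k ∈ Finset.range n, a k) ~[atTop]
      fun n : ℕ => b * (n : ℝ) ^ σ * ℓ n) :
    Tendsto (fun t : ℝ => (∑' k : ℕ, Real.exp (-(k / t)) * a k) / (t ^ σ * ℓ t)) atTop
      (𝓝 (b * Real.Gamma (1 + σ))) := by
  set w : ℕ → ℝ := fun n => ∑ k ∈ Finset.range n, a k with hwdef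
  have hwmono : Monotone w := fun m n hmn =>
    Finset.sum_le_sum_of_subset_of_nonneg (Finset.range_mono hmn) fun k _ _ => ha0 k
  have hw0 : ∀ n, 0 ≤ w n := fun n => Finset.sum_nonneg fun k _ => ha0 k
  have hratio : Tendsto (fun n : ℕ => w n / ((n : ℝ) ^ σ * ℓ n)) atTop (𝓝 b) := by
    have hne : ∀ᶠ n : ℕ in atTop, b * (n : ℝ) ^ σ * ℓ n ≠ 0 := by
      filter_upwards [eventually_gt_atTop 0] with n hn
      have hn' : (0 : ℝ) < n := by exact_mod_cast hn
      have := hℓ.pos n hn'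
      positivity
    have h1 := ((isEquivalent_iff_tendsto_one hne).1 hw).mul_const b
    rw [one_mul] at h1
    refine h1.congr' ?_
    filter_upwards [eventually_gt_atTop 0] with n hn
    have hn' : (0 : ℝ) < n := by exact_mod_cast hn
    have := hℓ.pos n hn'
    simp only [Pi.div_apply]
    field_simp
  have hfl : ∀ y : ℝ, 0 < y → Tendsto (fun t : ℝ => ⌊y * t⌋₊ + 1) atTop atTop := fun y hy =>
    (tendsto_add_atTop_nat 1).comp
      (tendsto_nat_floor_atTop.comp (tendsto_id.const_mul_atTop hy))
  have hflr : ∀ y : ℝ, 0 < y →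
      Tendsto (fun t : ℝ => ((⌊y * t⌋₊ + 1 : ℕ) : ℝ) / t) atTop (𝓝 y) := by
    intro y hy
    have h1 := (tendsto_nat_floor_mul_div_atTop hy.le).add
      (tendsto_inv_atTop_zero (𝕜 := ℝ))
    rw [add_zero] at h1
    refine h1.congr fun t => ?_
    push_cast
    rw [add_div, one_div]
  have hpt : ∀ y : ℝ, 0 < y → Tendsto (fun t : ℝ => w (⌊y * t⌋₊ + 1) / (t ^ σ * ℓ t)) atTop
      (𝓝 (b * y ^ σ)) := by
    intro y hy
    have hcast : Tendsto (fun t : ℝ => ((⌊y * t⌋₊ + 1 : ℕ) : ℝ)) atTop atTop :=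
      tendsto_natCast_atTop_atTop.comp (hfl y hy)
    have h1 := (hratio.comp (hfl y hy)).mul (((hflr y hy).rpow_const (p := σ) (Or.inl hy.ne')).mul
      (hℓ.tendsto_div_of_tendsto_div hcast tendsto_id hy (hflr y hy)))
    rw [mul_one] at h1
    refine h1.congr' ?_
    filter_upwards [eventually_gt_atTop 0] with t ht
    have hm : (0 : ℝ) < ((⌊y * t⌋₊ + 1 : ℕ) : ℝ) := by positivity
    have := hℓ.pos _ hm
    have := hℓ.pos _ ht
    simp only [Function.comp, id]
    rw [Real.div_rpow hm.le ht.le]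
    have h3 : (((⌊y * t⌋₊ + 1 : ℕ) : ℝ)) ^ σ ≠ 0 := (Real.rpow_pos_of_pos hm _).ne'
    have h4 : t ^ σ ≠ 0 := (Real.rpow_pos_of_pos ht _).ne'
    field_simp
  obtain ⟨t₀, ht₀, hpot⟩ := hℓ.exists_forall_abs_log_sub_log_le one_pos
  obtain ⟨n₀, hn₀⟩ := eventually_atTop.1 (hratio.eventually_lt_const (show b < 2 * b by linarith))
  -- Domination uniform in `t`. Replacing `y` by `max y 1` makes the summation index `m` at least
  -- `t`, so Potter with `δ = 1` yields `ℓ m ≤ e (m/t) ℓ t`. Together with `(m/t) ^ σ ≤ m/t` this is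
  -- quadratic in `m/t ≤ 2 max y 1`, hence integrable against `e^{-y}`.
  have hbound : ∀ᶠ t : ℝ in atTop, ∀ y : ℝ, 0 < y →
      w (⌊y * t⌋₊ + 1) / (t ^ σ * ℓ t) ≤ 8 * b * Real.exp 1 * (1 + y ^ 2) := by
    filter_upwards [eventually_ge_atTop t₀, eventually_ge_atTop (n₀ : ℝ), eventually_ge_atTop 1]
      with t h1 h2 h3 y hy
    have ht : 0 < t := by linarith
    set Y := max y 1 with hY
    have hY1 : 1 ≤ Y := le_max_right _ _
    set m := ⌊Y * t⌋₊ + 1 with hm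
    have hmt : t ≤ m := by
      have := (Nat.lt_floor_add_one (Y * t)).le
      rw [hm]
      push_cast
      nlinarith
    have hm2 : (m : ℝ) ≤ 2 * Y * t := by
      have := Nat.floor_le (show 0 ≤ Y * t by positivity)
      rw [hm]
      push_cast
      nlinarith
    have hm0 : (0 : ℝ) < m := ht.trans_le hmt
    have hlm := hℓ.pos _ hm0
    have hlt := hℓ.pos _ ht
    have h4 : w (⌊y * t⌋₊ + 1) ≤ w m := by
      refine hwmono (Nat.add_le_add_right (Nat.floor_mono ?_) 1)
      exact mul_le_mul_of_nonneg_right (le_max_left _ _) ht.le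
    have h5 : w m ≤ 2 * b * ((m : ℝ) ^ σ * ℓ m) := by
      have := hn₀ m (by exact_mod_cast h2.trans hmt)
      rw [div_lt_iff₀ (by positivity)] at this
      exact this.le
    have hx1 : 1 ≤ (m : ℝ) / t := (one_le_div ht).2 hmt
    have h6 : ℓ m ≤ Real.exp 1 * ((m : ℝ) / t) * ℓ t := by
      have := (abs_le.1 (hpot t h1 m hmt)).2
      rw [one_mul] at this
      rw [← Real.exp_log hlm, ← Real.exp_log hlt, ← Real.exp_log (show 0 < (m : ℝ) / t by positivity),
        ← Real.exp_add, ← Real.exp_add, Real.exp_le_exp]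
      linarith
    have h7 : (m : ℝ) ^ σ ≤ (m : ℝ) / t * t ^ σ := by
      have h8 : ((m : ℝ) / t) ^ σ ≤ (m : ℝ) / t := by
        conv_rhs => rw [← Real.rpow_one ((m : ℝ) / t)]
        exact Real.rpow_le_rpow_of_exponent_le hx1 hσ1
      rw [Real.div_rpow hm0.le ht.le, div_le_iff₀ (by positivity)] at h8
      exact h8
    have h9 : ((m : ℝ) / t) ^ 2 ≤ 4 * (1 + y ^ 2) := by
      have h10 : (m : ℝ) / t ≤ 2 * Y := (div_le_iff₀ ht).2 hm2
      have h11 : Y ^ 2 ≤ 1 + y ^ 2 := by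
        rcases max_cases y 1 with h | h <;> rw [hY, h.1] <;> nlinarith
      nlinarith
    rw [div_le_iff₀ (by positivity)]
    calc w (⌊y * t⌋₊ + 1) ≤ 2 * b * ((m : ℝ) ^ σ * ℓ m) := h4.trans h5
      _ ≤ 2 * b * (((m : ℝ) / t * t ^ σ) * (Real.exp 1 * ((m : ℝ) / t) * ℓ t)) := by gcongr
      _ = 2 * b * Real.exp 1 * (t ^ σ * ℓ t) * ((m : ℝ) / t) ^ 2 := by ring
      _ ≤ 2 * b * Real.exp 1 * (t ^ σ * ℓ t) * (4 * (1 + y ^ 2)) := by gcongr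
      _ = 8 * b * Real.exp 1 * (1 + y ^ 2) * (t ^ σ * ℓ t) := by ring
  have hGammaInt : ∀ s : ℝ, 0 ≤ s →
      IntegrableOn (fun y : ℝ => Real.exp (-y) * y ^ s) (Set.Ioi 0) := fun s hs => by
    have := Real.GammaIntegral_convergent (show 0 < s + 1 by linarith)
    rwa [add_sub_cancel_right] at this
  have hlimit : ∫ y in Set.Ioi (0 : ℝ), Real.exp (-y) * (b * y ^ σ) =
      b * Real.Gamma (1 + σ) := by
    rw [add_comm 1 σ, Real.Gamma_eq_integral (by linarith), ← integral_const_mul,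
      add_sub_cancel_right]
    exact integral_congr_ae (ae_of_all _ fun y => by simp only; ring)
  rw [← hlimit]
  have hmeas : ∀ t : ℝ, Measurable fun y : ℝ => w (⌊y * t⌋₊ + 1) := fun t =>
    (measurable_of_countable w).comp
      ((Nat.measurable_floor.comp (measurable_id.mul_const t)).add_const 1)
  have hdct := tendsto_integral_filter_of_dominated_convergence (l := atTop)
    (μ := volume.restrict (Set.Ioi (0 : ℝ)))
    (F := fun t y => Real.exp (-y) * (w (⌊y * t⌋₊ + 1) / (t ^ σ * ℓ t)))
    (f := fun y => Real.exp (-y) * (b * y ^ σ))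
    (fun y => Real.exp (-y) * (8 * b * Real.exp 1 * (1 + y ^ 2)))
    (Eventually.of_forall fun t => (Real.measurable_exp.comp measurable_neg).mul
      ((hmeas t).div_const _) |>.aestronglyMeasurable)
    (by
      filter_upwards [hbound, eventually_gt_atTop 0] with t ht ht0
      filter_upwards [ae_restrict_mem measurableSet_Ioi] with y hy
      have := hℓ.pos t ht0
      rw [Real.norm_of_nonneg (mul_nonneg (Real.exp_pos _).le
        (div_nonneg (hw0 _) (by positivity)))]
      exact mul_le_mul_of_nonneg_left (ht y hy) (Real.exp_pos _).le)
    (by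
      have h1 := ((hGammaInt 0 le_rfl).add (hGammaInt 2 (by norm_num))).const_mul
        (8 * b * Real.exp 1)
      refine h1.congr (ae_of_all _ fun y => ?_)
      simp only [Real.rpow_zero, Pi.add_apply]
      rw [show y ^ (2 : ℝ) = y ^ 2 by norm_cast]
      ring)
    (by
      filter_upwards [ae_restrict_mem measurableSet_Ioi] with y hy
      exact (hpt y hy).const_mul _)
  refine hdct.congr' ?_
  filter_upwards [eventually_gt_atTop 0] with t ht
  rw [tsum_exp_neg_mul_eq_integral ha0 haB ht, ← integral_div]
  exact integral_congr_ae (ae_of_all _ fun y => by simp only; rw [mul_div_assoc])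

end Abelian

/-! ### Duality for the transfer operator and sweeping -/

section TransferOperator

variable {X : Type*} [MeasurableSpace X] {μ : Measure X} {T : X → X}

theorem measurable_transferOp (u : X → ℝ≥0∞) : Measurable (transferOp μ T u) :=
  Measure.measurable_rnDeriv _ _

theorem measurable_transferOp_iterate {u : X → ℝ≥0∞} (hu : Measurable u) (k : ℕ) :
    Measurable ((transferOp μ T)^[k] u) := by
  cases k with
  | zero => exact hu
  | succ k =>
    rw [Function.iterate_succ_apply']
    exact measurable_transferOp _

variable [SigmaFinite μ]

/-- Invariance of `μ` makes the image of `u μ` absolutely continuous, so the Radon–Nikodym density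
recovers the whole image measure. -/
theorem lintegral_transferOp_mul (hT : MeasurePreserving T μ μ) {u g : X → ℝ≥0∞}
    (hu : Measurable u) (hg : Measurable g) :
    ∫⁻ x, transferOp μ T u x * g x ∂μ = ∫⁻ x, u x * g (T x) ∂μ := by
  have hac : (μ.withDensity u).map T ≪ μ := by
    have h1 := (withDensity_absolutelyContinuous μ u).map hT.measurable
    rwa [hT.map_eq] at h1
  have h2 := Measure.withDensity_rnDeriv_eq _ _ hac
  have hgT : Measurable fun x => g (T x) := hg.comp hT.measurable
  calc ∫⁻ x, transferOp μ T u x * g x ∂μ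
      = ∫⁻ x, g x ∂(μ.withDensity (((μ.withDensity u).map T).rnDeriv μ)) := by
        rw [lintegral_withDensity_eq_lintegral_mul _ (Measure.measurable_rnDeriv _ _) hg]
        rfl
    _ = ∫⁻ x, u x * g (T x) ∂μ := by
        rw [h2, lintegral_map hg hT.measurable,
          lintegral_withDensity_eq_lintegral_mul _ hu hgT]
        rfl

theorem lintegral_transferOp_iterate_mul (hT : MeasurePreserving T μ μ) {u : X → ℝ≥0∞}
    (hu : Measurable u) (k : ℕ) {g : X → ℝ≥0∞} (hg : Measurable g) :
    ∫⁻ x, (transferOp μ T)^[k] u x * g x ∂μ = ∫⁻ x, u x * g (T^[k] x) ∂μ := by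
  induction k generalizing g with
  | zero => rfl
  | succ k ih =>
    simp only [Function.iterate_succ_apply']
    have hgT : Measurable fun x => g (T x) := hg.comp hT.measurable
    rw [lintegral_transferOp_mul hT (measurable_transferOp_iterate hu k) hg, ih hgT]

/-- Integrate the sweeping inequality against `V`. Duality moves each `T̂ᵏ` from `F` onto `V`, and
`V ∘ Tᵏ ≤ D ^ k V` brings everything back to `∫ F V`. -/
theorem setIntegral_le_of_sweeping (hT : MeasurePreserving T μ μ) {Y : Set X}
    (hY : MeasurableSet Y) {F : X → ℝ≥0∞} (hF : Measurable F) (hFfin : ∫⁻ x, F x ∂μ ≠ ∞)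
    {C : ℝ≥0} {K : ℕ}
    (hs : ∀ᵐ x ∂μ, Y.indicator 1 x ≤ C * ∑ k ∈ Finset.range (K + 1), (transferOp μ T)^[k] F x)
    {V : X → ℝ} (hV : Measurable V) (hV0 : ∀ x, 0 ≤ V x) {M : ℝ} (hVM : ∀ x, V x ≤ M)
    {D : ℝ} (hD : 0 ≤ D) (hVT : ∀ x, V (T x) ≤ D * V x) :
    ∫ x in Y, V x ∂μ ≤ C * (∑ k ∈ Finset.range (K + 1), D ^ k) * ∫ x, (F x).toReal * V x ∂μ := by
  have hVm : Measurable fun x => ENNReal.ofReal (V x) := hV.ennreal_ofReal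
  have hVTk : ∀ k x, V (T^[k] x) ≤ D ^ k * V x := by
    intro k x
    induction k with
    | zero => simp
    | succ k ih =>
      rw [Function.iterate_succ_apply', pow_succ', mul_assoc]
      exact (hVT _).trans (mul_le_mul_of_nonneg_left ih hD)
  have hI : ∫ x, (F x).toReal * V x ∂μ = (∫⁻ x, F x * ENNReal.ofReal (V x) ∂μ).toReal := by
    rw [integral_eq_lintegral_of_nonneg_ae
      (ae_of_all _ fun x => mul_nonneg ENNReal.toReal_nonneg (hV0 x))
      (hF.ennreal_toReal.mul hV).aestronglyMeasurable]
    congr 1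
    refine lintegral_congr_ae ?_
    filter_upwards [ae_lt_top hF hFfin] with x hx
    rw [ENNReal.ofReal_mul ENNReal.toReal_nonneg, ENNReal.ofReal_toReal hx.ne]
  have hfin : ∫⁻ x, F x * ENNReal.ofReal (V x) ∂μ ≠ ∞ := by
    refine ne_top_of_le_ne_top (ENNReal.mul_ne_top hFfin (ENNReal.ofReal_ne_top (r := M))) ?_
    rw [← lintegral_mul_const _ hF]
    exact lintegral_mono fun x => by gcongr; exact hVM x
  have hJ : ∫ x in Y, V x ∂μ = (∫⁻ x, Y.indicator 1 x * ENNReal.ofReal (V x) ∂μ).toReal := by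
    rw [integral_eq_lintegral_of_nonneg_ae (ae_of_all _ hV0) hV.aestronglyMeasurable,
      ← lintegral_indicator hY]
    congr 1
    refine lintegral_congr fun x => ?_
    by_cases hx : x ∈ Y <;> simp [hx]
  have hD0 : 0 ≤ ∑ k ∈ Finset.range (K + 1), D ^ k := Finset.sum_nonneg fun k _ => pow_nonneg hD k
  rw [hI, hJ, ← ENNReal.toReal_ofReal (mul_nonneg C.coe_nonneg hD0), ← ENNReal.toReal_mul]
  refine ENNReal.toReal_mono (ENNReal.mul_ne_top ENNReal.ofReal_ne_top hfin) ?_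
  calc ∫⁻ x, Y.indicator 1 x * ENNReal.ofReal (V x) ∂μ
      ≤ ∫⁻ x, (C * ∑ k ∈ Finset.range (K + 1), (transferOp μ T)^[k] F x) *
          ENNReal.ofReal (V x) ∂μ := by
        refine lintegral_mono_ae ?_
        filter_upwards [hs] with x hx
        gcongr
    _ = C * ∑ k ∈ Finset.range (K + 1),
          ∫⁻ x, (transferOp μ T)^[k] F x * ENNReal.ofReal (V x) ∂μ := by
        rw [← lintegral_finsetSum _ fun k _ => (measurable_transferOp_iterate hF k).fun_mul hVm,
          ← lintegral_const_mul]
        · refine lintegral_congr fun x => ?_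
          rw [mul_assoc, Finset.sum_mul]
        · exact Finset.measurable_fun_sum _ fun k _ => (measurable_transferOp_iterate hF k).fun_mul hVm
    _ ≤ C * ∑ k ∈ Finset.range (K + 1),
          ENNReal.ofReal (D ^ k) * ∫⁻ x, F x * ENNReal.ofReal (V x) ∂μ := by
        gcongr with k hk
        rw [lintegral_transferOp_iterate_mul hT hF k hVm, ← lintegral_const_mul _ (hF.fun_mul hVm)]
        refine lintegral_mono fun x => ?_
        rw [← mul_assoc, mul_comm (ENNReal.ofReal (D ^ k)), mul_assoc,
          ← ENNReal.ofReal_mul (pow_nonneg hD k)]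
        gcongr
        exact hVTk k x
    _ = ENNReal.ofReal (C * ∑ k ∈ Finset.range (K + 1), D ^ k) *
          ∫⁻ x, F x * ENNReal.ofReal (V x) ∂μ := by
        rw [← Finset.sum_mul, ← ENNReal.ofReal_sum_of_nonneg fun k _ => pow_nonneg hD k,
          ENNReal.ofReal_mul C.coe_nonneg, ENNReal.ofReal_coe_nnreal, mul_assoc]

end TransferOperator

/-! ### First visits, wandering rates and entrance averages -/

section FirstVisit

variable {X : Type*} {T : X → X} {Y : Set X}

theorem mem_firstVisitSet {n : ℕ} {x : X} :
    x ∈ firstVisitSet T Y n ↔ T^[n] x ∈ Y ∧ ∀ k < n, T^[k] x ∉ Y := by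
  simp [firstVisitSet]

theorem firstVisitSet_zero : firstVisitSet T Y 0 = Y := by
  ext x
  simp [mem_firstVisitSet]

theorem pairwise_disjoint_firstVisitSet :
    Pairwise fun m n => Disjoint (firstVisitSet T Y m) (firstVisitSet T Y n) := by
  intro m n hmn
  rw [Set.disjoint_left]
  intro x hm hn
  rw [mem_firstVisitSet] at hm hn
  rcases lt_or_gt_of_ne hmn with h | h
  · exact hn.2 m h hm.1
  · exact hm.2 n h hn.1

theorem biUnion_preimage_iterate_eq (n : ℕ) :
    ⋃ k ∈ Finset.range n, T^[k] ⁻¹' Y = ⋃ k ∈ Finset.range n, firstVisitSet T Y k := by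
  classical
  ext x
  simp only [Set.mem_iUnion, Finset.mem_range, exists_prop, Set.mem_preimage]
  constructor
  · rintro ⟨k, hk, hx⟩
    have hex : ∃ k, T^[k] x ∈ Y := ⟨k, hx⟩
    exact ⟨Nat.find hex, (Nat.find_min' hex hx).trans_lt hk,
      mem_firstVisitSet.2 ⟨Nat.find_spec hex, fun j hj => Nat.find_min hex hj⟩⟩
  · rintro ⟨k, hk, hx⟩
    exact ⟨k, hk, (mem_firstVisitSet.1 hx).1⟩

theorem map_mem_firstVisitSet {k : ℕ} {x : X} (hx : x ∈ firstVisitSet T Y (k + 1)) :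
    T x ∈ firstVisitSet T Y k := by
  rw [mem_firstVisitSet] at hx ⊢
  exact ⟨hx.1, fun j hj => hx.2 (j + 1) (by omega)⟩

theorem firstVisitSet_subset_iUnion {ι : Type*} {A : ι → Set X} (hX : Y ∪ ⋃ i, A i = Set.univ)
    (k : ℕ) : firstVisitSet T Y (k + 1) ⊆ ⋃ i, A i := by
  intro x hx
  have h1 : x ∈ Y ∪ ⋃ i, A i := hX ▸ Set.mem_univ x
  exact h1.resolve_left ((mem_firstVisitSet.1 hx).2 0 (Nat.succ_pos k))

/-- Between visits to `Y` the orbit stays in one of the separated sets. -/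
theorem map_mem_of_mem_firstVisitSet {ι : Type*} {A : ι → Set X} (hX : Y ∪ ⋃ i, A i = Set.univ)
    (hsep : DynamicallySeparates T A) {k : ℕ} {i : ι} {x : X}
    (hx : x ∈ firstVisitSet T Y (k + 2)) (hxi : x ∈ A i) : T x ∈ A i := by
  obtain ⟨j, hj⟩ := Set.mem_iUnion.1
    (firstVisitSet_subset_iUnion hX k (map_mem_firstVisitSet hx))
  by_cases hij : i = j
  · exact hij ▸ hj
  · have h1 : x ∈ A i ∩ T ⁻¹' A j := ⟨hxi, hj⟩
    rw [hsep i j hij] at h1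
    exact h1.elim

theorem firstVisitSet_zero_inter {A : Set X} (hYA : Disjoint Y A) :
    firstVisitSet T Y 0 ∩ A = ∅ := by
  rw [firstVisitSet_zero]
  exact hYA.inter_eq

variable [MeasurableSpace X] {μ : Measure X}

theorem measurableSet_firstVisitSet (hT : Measurable T) (hY : MeasurableSet Y) (n : ℕ) :
    MeasurableSet (firstVisitSet T Y n) :=
  (hT.iterate n hY).diff (Finset.measurableSet_biUnion _ fun k _ => hT.iterate k hY)

theorem measure_firstVisitSet_le (hT : MeasurePreserving T μ μ) (hY : MeasurableSet Y) (n : ℕ) :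
    μ (firstVisitSet T Y n) ≤ μ Y :=
  (measure_mono Set.sdiff_subset).trans_eq ((hT.iterate n).measure_preimage hY.nullMeasurableSet)

theorem wanderingRate_eq_sum (hT : Measurable T) (hY : MeasurableSet Y) {A : Set X}
    (hA : MeasurableSet A) (n : ℕ) :
    wanderingRate μ T Y A n = ∑ k ∈ Finset.range n, μ (firstVisitSet T Y k ∩ A) := by
  rw [wanderingRate, ← measure_biUnion_finset]
  · congr 1
    rw [← Set.iUnion₂_inter, ← Set.iUnion₂_inter, biUnion_preimage_iterate_eq]
  · intro j _ k _ hjk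
    exact (pairwise_disjoint_firstVisitSet hjk).mono Set.inter_subset_left Set.inter_subset_left
  · exact fun k _ => (measurableSet_firstVisitSet hT hY k).inter hA

theorem wanderingRate_ne_top (hT : MeasurePreserving T μ μ) (hY : MeasurableSet Y)
    (hY_fin : μ Y < ∞) {A : Set X} (hA : MeasurableSet A) (n : ℕ) :
    wanderingRate μ T Y A n ≠ ∞ := by
  rw [wanderingRate_eq_sum hT.measurable hY hA]
  refine ENNReal.sum_ne_top.2 fun k _ => ?_
  exact ((measure_mono Set.inter_subset_left).trans_lt
    ((measure_firstVisitSet_le hT hY k).trans_lt hY_fin)).ne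

theorem measurable_entranceAverage (hT : Measurable T) (hY : MeasurableSet Y) {A : Set X}
    (hA : MeasurableSet A) (n : ℕ) : Measurable (entranceAverage μ T Y A n) := by
  unfold entranceAverage
  refine Measurable.const_mul (Finset.measurable_fun_sum _ fun k _ => ?_) _
  exact measurable_transferOp_iterate
    (measurable_one.indicator ((measurableSet_firstVisitSet hT hY k).inter hA)) k

variable [SigmaFinite μ]

theorem lintegral_entranceAverage_mul (hT : MeasurePreserving T μ μ) (hY : MeasurableSet Y)
    {A : Set X} (hA : MeasurableSet A) (n : ℕ) {g : X → ℝ≥0∞} (hg : Measurable g) :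
    ∫⁻ x, entranceAverage μ T Y A n x * g x ∂μ = (wanderingRate μ T Y A n)⁻¹ *
      ∑ k ∈ Finset.range n, ∫⁻ x in firstVisitSet T Y k ∩ A, g (T^[k] x) ∂μ := by
  have hm : ∀ k, MeasurableSet (firstVisitSet T Y k ∩ A) := fun k =>
    (measurableSet_firstVisitSet hT.measurable hY k).inter hA
  have hm1 : ∀ k, Measurable
      ((transferOp μ T)^[k] ((firstVisitSet T Y k ∩ A).indicator 1)) := fun k =>
    measurable_transferOp_iterate (measurable_one.indicator (hm k)) k
  have h1 : ∀ k, ∫⁻ x in firstVisitSet T Y k ∩ A, g (T^[k] x) ∂μ =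
      ∫⁻ x, (transferOp μ T)^[k] ((firstVisitSet T Y k ∩ A).indicator 1) x * g x ∂μ := by
    intro k
    rw [lintegral_transferOp_iterate_mul hT (measurable_one.indicator (hm k)) k hg,
      ← lintegral_indicator (hm k)]
    refine lintegral_congr fun x => ?_
    by_cases hx : x ∈ firstVisitSet T Y k ∩ A
    · rw [Set.indicator_of_mem hx, Set.indicator_of_mem hx, Pi.one_apply, one_mul]
    · rw [Set.indicator_of_notMem hx, Set.indicator_of_notMem hx, zero_mul]
  simp only [h1]
  rw [← lintegral_finsetSum _ fun k _ => (hm1 k).fun_mul hg, ← lintegral_const_mul _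
    (Finset.measurable_fun_sum _ fun k _ => (hm1 k).fun_mul hg)]
  refine lintegral_congr fun x => ?_
  rw [entranceAverage, mul_assoc, Finset.sum_mul]

theorem lintegral_entranceAverage_ne_top (hT : MeasurePreserving T μ μ) (hY : MeasurableSet Y)
    {A : Set X} (hA : MeasurableSet A) (n : ℕ) :
    ∫⁻ x, entranceAverage μ T Y A n x ∂μ ≠ ∞ := by
  have h1 := lintegral_entranceAverage_mul hT hY hA n (g := fun _ => 1) measurable_const
  simp only [mul_one, lintegral_const, Measure.restrict_apply MeasurableSet.univ, Set.univ_inter,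
    one_mul] at h1
  rw [← wanderingRate_eq_sum hT.measurable hY hA] at h1
  rw [h1]
  exact ((ENNReal.inv_mul_le_one _).trans_lt ENNReal.one_lt_top).ne

/-- Test against the indicator of the complement of `Y`: by duality only the points `Tᵏ x` with `x ∈
Y_k` contribute, and these lie in `Y`. -/
theorem entranceAverage_ae_eq_zero (hT : MeasurePreserving T μ μ) (hY : MeasurableSet Y)
    {A : Set X} (hA : MeasurableSet A) (n : ℕ) :
    ∀ᵐ x ∂μ, x ∉ Y → entranceAverage μ T Y A n x = 0 := by
  have hg : Measurable (Yᶜ.indicator (1 : X → ℝ≥0∞)) := measurable_one.indicator hY.compl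
  have h1 := lintegral_entranceAverage_mul hT hY hA n hg
  have h2 : ∀ k, ∫⁻ x in firstVisitSet T Y k ∩ A, Yᶜ.indicator (1 : X → ℝ≥0∞) (T^[k] x) ∂μ = 0 := by
    intro k
    rw [← lintegral_zero (μ := μ.restrict (firstVisitSet T Y k ∩ A))]
    refine setLIntegral_congr_fun ((measurableSet_firstVisitSet hT.measurable hY k).inter hA)
      fun x hx => ?_
    exact Set.indicator_of_notMem (Set.notMem_compl_iff.2 (mem_firstVisitSet.1 hx.1).1) _
  simp only [h2, Finset.sum_const_zero, mul_zero] at h1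
  rw [lintegral_eq_zero_iff ((measurable_entranceAverage hT.measurable hY hA n).fun_mul hg)] at h1
  filter_upwards [h1] with x hx hxY
  rw [Pi.zero_apply, Set.indicator_of_mem (Set.mem_compl hxY), Pi.one_apply, mul_one] at hx
  exact hx

/-- This links the integrals over the cells, which the renewal identity produces, to the averages
`h_n`, about which the hypotheses speak. -/
theorem sum_setIntegral_comp_iterate (hT : MeasurePreserving T μ μ) (hY : MeasurableSet Y)
    (hY_fin : μ Y < ∞) {A : Set X} (hA : MeasurableSet A) {n : ℕ}
    (hw : wanderingRate μ T Y A n ≠ 0) {V : X → ℝ} (hV : Measurable V) (hV0 : ∀ x, 0 ≤ V x)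
    {M : ℝ} (hVM : ∀ x, V x ≤ M) :
    ∑ k ∈ Finset.range n, ∫ x in firstVisitSet T Y k ∩ A, V (T^[k] x) ∂μ =
      (wanderingRate μ T Y A n).toReal * ∫ x, (entranceAverage μ T Y A n x).toReal * V x ∂μ := by
  have hVm : Measurable fun x => ENNReal.ofReal (V x) := hV.ennreal_ofReal
  have hmeas := measurable_entranceAverage (μ := μ) hT.measurable hY hA n
  have h1 := lintegral_entranceAverage_mul hT hY hA n hVm
  have hwt := wanderingRate_ne_top hT hY hY_fin hA n
  have h2 : ∫ x, (entranceAverage μ T Y A n x).toReal * V x ∂μ =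
      (∫⁻ x, entranceAverage μ T Y A n x * ENNReal.ofReal (V x) ∂μ).toReal := by
    rw [integral_eq_lintegral_of_nonneg_ae
      (ae_of_all _ fun x => mul_nonneg ENNReal.toReal_nonneg (hV0 x))
      (hmeas.ennreal_toReal.mul hV).aestronglyMeasurable]
    congr 1
    refine lintegral_congr_ae ?_
    filter_upwards [ae_lt_top hmeas (lintegral_entranceAverage_ne_top hT hY hA n)] with x hx
    rw [ENNReal.ofReal_mul ENNReal.toReal_nonneg, ENNReal.ofReal_toReal hx.ne]
  rw [h2, h1, ← ENNReal.toReal_mul, ← mul_assoc, ENNReal.mul_inv_cancel hw hwt, one_mul,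
    ENNReal.toReal_sum]
  · refine Finset.sum_congr rfl fun k _ => ?_
    rw [integral_eq_lintegral_of_nonneg_ae (ae_of_all _ fun x => hV0 _)
      (hV.comp (hT.measurable.iterate k)).aestronglyMeasurable]
  · intro k _
    refine ((setLIntegral_mono measurable_const fun x _ =>
      ENNReal.ofReal_le_ofReal (hVM (T^[k] x))).trans_lt ?_).ne
    rw [setLIntegral_const]
    exact ENNReal.mul_lt_top ENNReal.ofReal_lt_top ((measure_mono Set.inter_subset_left).trans_lt
      ((measure_firstVisitSet_le hT hY k).trans_lt hY_fin))

end FirstVisit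

/-! ### Discounted sums along orbits -/

section DiscountedSum

variable {X : Type*} {T : X → X} {v : X → ℝ}

/-- The sum over `n` of the products of `v` along the first `n` points of the forward orbit. -/
noncomputable def discountedSum (T : X → X) (v : X → ℝ) (x : X) : ℝ :=
  ∑' n, ∏ k ∈ Finset.range n, v (T^[k + 1] x)

variable {θ : ℝ} (hv0 : ∀ x, 0 < v x)

include hv0

theorem discountedSum_nonneg (x : X) : 0 ≤ discountedSum T v x :=
  tsum_nonneg fun _ => Finset.prod_nonneg fun _ _ => (hv0 _).le

variable (hvθ : ∀ x, v x ≤ θ)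

include hvθ

theorem prod_orbit_le_pow (n : ℕ) (x : X) : ∏ k ∈ Finset.range n, v (T^[k + 1] x) ≤ θ ^ n := by
  refine (Finset.prod_le_prod (fun k _ => (hv0 _).le) fun k _ => hvθ _).trans_eq ?_
  simp

variable (hθ : θ < 1)

include hθ

theorem summable_prod_orbit (x : X) :
    Summable fun n => ∏ k ∈ Finset.range n, v (T^[k + 1] x) :=
  (summable_geometric_of_lt_one ((hv0 x).le.trans (hvθ x)) hθ).of_nonneg_of_le
    (fun _ => Finset.prod_nonneg fun _ _ => (hv0 _).le) fun n => prod_orbit_le_pow hv0 hvθ n x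

theorem discountedSum_le (x : X) : discountedSum T v x ≤ (1 - θ)⁻¹ := by
  have h0 : 0 ≤ θ := (hv0 x).le.trans (hvθ x)
  rw [← tsum_geometric_of_lt_one h0 hθ]
  exact (summable_prod_orbit hv0 hvθ hθ x).tsum_le_tsum
    (fun n => prod_orbit_le_pow hv0 hvθ n x) (summable_geometric_of_lt_one h0 hθ)

/-- The empty product contributes `1`, and every longer product starts at `T x`, not at `x`.
Consequently `(v V) ∘ T - v V = (1 - v) V - 1`, the coboundary behind the renewal identity. -/
theorem discountedSum_eq (x : X) :
    discountedSum T v x = 1 + v (T x) * discountedSum T v (T x) := by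
  rw [discountedSum, (summable_prod_orbit hv0 hvθ hθ x).tsum_eq_zero_add, discountedSum,
    ← tsum_mul_left]
  simp only [Finset.range_zero, Finset.prod_empty, Finset.prod_range_succ']
  congr 1
  exact tsum_congr fun n => mul_comm _ _

theorem one_le_discountedSum (x : X) : 1 ≤ discountedSum T v x := by
  rw [discountedSum_eq hv0 hvθ hθ]
  have := mul_nonneg (hv0 (T x)).le (discountedSum_nonneg (T := T) hv0 (T x))
  linarith

theorem measurable_discountedSum [MeasurableSpace X] (hT : Measurable T) (hv : Measurable v) :
    Measurable (discountedSum T v) := by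
  refine measurable_of_tendsto_metrizable (f := fun n x => ∑ m ∈ Finset.range n,
    ∏ k ∈ Finset.range m, v (T^[k + 1] x)) (fun n => ?_) (tendsto_pi_nhds.2 fun x =>
      (summable_prod_orbit hv0 hvθ hθ x).hasSum.tendsto_sum_nat)
  exact Finset.measurable_fun_sum _ fun m _ => Finset.measurable_fun_prod _ fun k _ =>
    hv.comp (hT.iterate (k + 1))

/-- The points `T x, …, Tᵏ x` lie in `A i` and `T^{k+1} x` lies in `Y`, so `V x = 1 + z + ⋯ + z ^ k
+ z ^ k y V (T^{k+1} x)`; multiplying by `1 - z` sums the geometric part. -/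
theorem one_sub_mul_discountedSum_sub_one {ι : Type*} {Y : Set X} {A : ι → Set X}
    (hX : Y ∪ ⋃ i, A i = Set.univ) (hsep : DynamicallySeparates T A) {y z : ℝ}
    (hvY : ∀ x ∈ Y, v x = y) {i : ι} (hvA : ∀ x ∈ A i, v x = z) (k : ℕ) {x : X}
    (hx : x ∈ firstVisitSet T Y (k + 1)) (hxi : x ∈ A i) :
    (1 - z) * discountedSum T v x - 1 =
      -z ^ (k + 1) + (1 - z) * z ^ k * y * discountedSum T v (T^[k + 1] x) := by
  induction k generalizing x with
  | zero =>
    have h1 : T x ∈ Y := (mem_firstVisitSet.1 hx).1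
    rw [discountedSum_eq hv0 hvθ hθ, hvY _ h1]
    simp only [zero_add, Function.iterate_one, pow_zero, pow_one]
    ring
  | succ k ih =>
    have h1 := map_mem_of_mem_firstVisitSet hX hsep hx hxi
    have h2 := ih (map_mem_firstVisitSet hx) h1
    rw [discountedSum_eq hv0 hvθ hθ, hvA _ h1, Function.iterate_succ_apply]
    calc (1 - z) * (1 + z * discountedSum T v (T x)) - 1
        = z * ((1 - z) * discountedSum T v (T x) - 1) := by ring
      _ = _ := by rw [h2]; ring

end DiscountedSum

/-! ### The renewal identity -/

section RenewalIdentity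

variable {X : Type*} [MeasurableSpace X] {μ : Measure X} {T : X → X} {Y : Set X}

/-- These sets decrease to the points of `Y` that never return, which form a null set by
conservativity; finiteness of `μ Y` allows passing to the limit. -/
theorem tendsto_measure_no_return (hT : Conservative T μ) (hY : MeasurableSet Y)
    (hY_fin : μ Y < ∞) :
    Tendsto (fun n => μ.real (Y \ ⋃ k ∈ Finset.range n, T^[k + 1] ⁻¹' Y)) atTop (𝓝 0) := by
  have hmeas : ∀ n, MeasurableSet (Y \ ⋃ k ∈ Finset.range n, T^[k + 1] ⁻¹' Y) := fun n =>
    hY.diff (Finset.measurableSet_biUnion _ fun k _ => hT.measurable.iterate (k + 1) hY)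
  have hanti : Antitone fun n => Y \ ⋃ k ∈ Finset.range n, T^[k + 1] ⁻¹' Y := fun m n hmn =>
    Set.sdiff_subset_sdiff_right (Set.biUnion_subset_biUnion_left (Finset.range_mono hmn))
  have h1 := tendsto_measure_iInter_atTop (μ := μ) (fun n => (hmeas n).nullMeasurableSet) hanti
    ⟨0, ((measure_mono Set.sdiff_subset).trans_lt hY_fin).ne⟩
  have h2 : μ (⋂ n, Y \ ⋃ k ∈ Finset.range n, T^[k + 1] ⁻¹' Y) = 0 := by
    refine measure_mono_null (fun x hx => ?_)
      (hT.measure_mem_forall_ge_image_notMem_eq_zero hY.nullMeasurableSet 1)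
    simp only [Set.mem_iInter, Set.mem_sdiff, Set.mem_iUnion, Finset.mem_range, exists_prop,
      Set.mem_preimage, not_exists, not_and] at hx
    refine ⟨(hx 0).1, fun m hm => ?_⟩
    obtain ⟨k, rfl⟩ := Nat.exists_eq_add_of_le' hm
    exact (hx (k + 1)).2 k (Nat.lt_succ_self k)
  rw [h2] at h1
  have h3 := (ENNReal.tendsto_toReal ENNReal.zero_ne_top).comp h1
  exact h3

/-- The integrals of a bounded coboundary over the sets reaching `Y` within a given time
tend to zero. -/
theorem tendsto_setIntegral_coboundary (hT : Conservative T μ) (hTm : MeasurePreserving T μ μ)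
    (hY : MeasurableSet Y) (hY_fin : μ Y < ∞) {G : X → ℝ} (hG : Measurable G) {M : ℝ}
    (hGM : ∀ x, |G x| ≤ M) :
    Tendsto (fun n => ∫ x in ⋃ k ∈ Finset.range n, T^[k] ⁻¹' Y, (G (T x) - G x) ∂μ) atTop
      (𝓝 0) := by
  set B : ℕ → Set X := fun n => ⋃ k ∈ Finset.range n, T^[k] ⁻¹' Y with hB
  set E : ℕ → Set X := fun n => Y \ ⋃ k ∈ Finset.range n, T^[k + 1] ⁻¹' Y with hE
  have hBm : ∀ n, MeasurableSet (B n) := fun n =>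
    Finset.measurableSet_biUnion _ fun k _ => hTm.measurable.iterate k hY
  have hBfin : ∀ n, μ (B n) < ∞ := fun n => by
    refine measure_biUnion_lt_top (Finset.finite_toSet _) fun k _ => ?_
    rw [(hTm.iterate k).measure_preimage hY.nullMeasurableSet]
    exact hY_fin
  have hB'm : ∀ n, MeasurableSet (T ⁻¹' B n) := fun n => hTm.measurable (hBm n)
  have hB'eq : ∀ n, μ (T ⁻¹' B n) = μ (B n) := fun n =>
    hTm.measure_preimage (hBm n).nullMeasurableSet
  -- `T⁻¹ B_n` is the union of the `T⁻ᵏ Y` for `1 ≤ k ≤ n`, so only `k = 0` can put a point in `B_n`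
  -- and outside `T⁻¹ B_n`. The reverse difference has the same measure by invariance.
  have hsub : ∀ n, B n \ T ⁻¹' B n ⊆ E n := by
    intro n x hx
    simp only [hB, hE, Set.mem_sdiff, Set.mem_iUnion, Finset.mem_range, exists_prop,
      Set.mem_preimage, not_exists, not_and] at hx ⊢
    obtain ⟨⟨k, hk, hxk⟩, hx2⟩ := hx
    refine ⟨?_, fun j hj => hx2 j hj⟩
    cases k with
    | zero => exact hxk
    | succ k => exact absurd hxk (hx2 k (by omega))
  have hM : ∀ n, μ.real (B n \ T ⁻¹' B n) ≤ μ.real (E n) := fun n =>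
    measureReal_mono (hsub n) ((measure_mono Set.sdiff_subset).trans_lt hY_fin).ne
  have hM' : ∀ n, μ.real (T ⁻¹' B n \ B n) ≤ μ.real (E n) := by
    intro n
    refine le_trans (le_of_eq ?_) (hM n)
    have h1 := measureReal_inter_add_sdiff (μ := μ) (s := B n) (hB'm n) (hBfin n).ne
    have h2 := measureReal_inter_add_sdiff (μ := μ) (s := T ⁻¹' B n) (hBm n)
      (by rw [hB'eq]; exact (hBfin n).ne)
    have h3 : μ.real (T ⁻¹' B n) = μ.real (B n) := by rw [Measure.real, Measure.real, hB'eq]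
    rw [Set.inter_comm] at h2
    linarith
  have hGT : Measurable fun x => G (T x) := hG.comp hTm.measurable
  have hint : ∀ (g : X → ℝ) (s : Set X), Measurable g → (∀ x, |g x| ≤ M) → μ s < ∞ →
      IntegrableOn g s μ := fun g s hg hgM hs =>
    IntegrableOn.of_bound hs hg.aestronglyMeasurable M (ae_of_all _ hgM)
  have hkey : ∀ n, |∫ x in B n, (G (T x) - G x) ∂μ| ≤ 2 * M * μ.real (E n) := by
    intro n
    have hB'fin : μ (T ⁻¹' B n) < ∞ := by rw [hB'eq]; exact hBfin n
    have h1 : ∫ x in T ⁻¹' B n, G (T x) ∂μ = ∫ x in B n, G x ∂μ := by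
      conv_rhs => rw [← hTm.map_eq]
      exact (setIntegral_map (hBm n) hG.aestronglyMeasurable hTm.measurable.aemeasurable).symm
    rw [integral_sub (hint _ _ hGT (fun x => hGM _) (hBfin n)) (hint _ _ hG hGM (hBfin n)), ← h1,
      ← integral_inter_add_sdiff (s := B n) (hB'm n) (hint _ _ hGT (fun x => hGM _) (hBfin n)),
      ← integral_inter_add_sdiff (s := T ⁻¹' B n) (hBm n)
        (hint _ _ hGT (fun x => hGM _) hB'fin), Set.inter_comm (T ⁻¹' B n),
      add_sub_add_left_eq_sub]
    have h2 : ‖∫ x in B n \ T ⁻¹' B n, G (T x) ∂μ‖ ≤ M * μ.real (B n \ T ⁻¹' B n) :=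
      norm_setIntegral_le_of_norm_le_const ((measure_mono Set.sdiff_subset).trans_lt (hBfin n))
        fun x _ => hGM _
    have h3 : ‖∫ x in T ⁻¹' B n \ B n, G (T x) ∂μ‖ ≤ M * μ.real (T ⁻¹' B n \ B n) :=
      norm_setIntegral_le_of_norm_le_const ((measure_mono Set.sdiff_subset).trans_lt hB'fin)
        fun x _ => hGM _
    rcases isEmpty_or_nonempty X with hX | ⟨⟨x₀⟩⟩
    · simp [Measure.eq_zero_of_isEmpty μ]
    have hM0 : 0 ≤ M := (abs_nonneg _).trans (hGM x₀)
    have h4 := mul_le_mul_of_nonneg_left (hM n) hM0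
    have h5 := mul_le_mul_of_nonneg_left (hM' n) hM0
    rw [← Real.norm_eq_abs]
    refine (norm_sub_le _ _).trans ?_
    linarith
  refine squeeze_zero_norm hkey ?_
  have := (tendsto_measure_no_return hT hY hY_fin).const_mul (2 * M)
  rwa [mul_zero] at this

variable {ι : Type*} [Fintype ι] {A : ι → Set X}

/-- The renewal identity for discounted sums whose weight is constant on `Y` and on each of the
sets separated by `Y`. -/
theorem measureReal_add_sum_tsum_eq (hT : Conservative T μ) (hTm : MeasurePreserving T μ μ)
    (hY : MeasurableSet Y) (hY_fin : μ Y < ∞) (hA : ∀ i, MeasurableSet (A i))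
    (hYA : ∀ i, Disjoint Y (A i)) (hAA : Pairwise fun i j => Disjoint (A i) (A j))
    (hX : Y ∪ ⋃ i, A i = Set.univ) (hsep : DynamicallySeparates T A)
    {v : X → ℝ} (hv : Measurable v) {θ : ℝ} (hv0 : ∀ x, 0 < v x) (hvθ : ∀ x, v x ≤ θ)
    (hθ : θ < 1) {y : ℝ} {z : ι → ℝ} (hz0 : ∀ i, 0 < z i) (hz1 : ∀ i, z i < 1)
    (hvY : ∀ x ∈ Y, v x = y) (hvA : ∀ i, ∀ x ∈ A i, v x = z i) :
    μ.real Y + ∑ i, ∑' k, z i ^ k * μ.real (firstVisitSet T Y k ∩ A i) =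
      (1 - y) * ∫ x in Y, discountedSum T v x ∂μ + ∑ i, (1 - z i) / z i * y *
        ∑' k, z i ^ k * ∫ x in firstVisitSet T Y k ∩ A i, discountedSum T v (T^[k] x) ∂μ := by
  classical
  set V := discountedSum T v with hVdef
  have hVm : Measurable V := measurable_discountedSum hv0 hvθ hθ hTm.measurable hv
  have hV0 : ∀ x, 0 ≤ V x := discountedSum_nonneg hv0
  have hVM : ∀ x, V x ≤ (1 - θ)⁻¹ := discountedSum_le hv0 hvθ hθ
  have hVeq : ∀ x, V x = 1 + v (T x) * V (T x) := discountedSum_eq hv0 hvθ hθ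
  have hYkm := measurableSet_firstVisitSet hTm.measurable hY
  have hYkfin : ∀ k, μ (firstVisitSet T Y k) < ∞ := fun k =>
    (measure_firstVisitSet_le hTm hY k).trans_lt hY_fin
  have hcell_fin : ∀ k i, μ (firstVisitSet T Y k ∩ A i) < ∞ := fun k i =>
    (measure_mono Set.inter_subset_left).trans_lt (hYkfin k)
  have hcell_le : ∀ k i, μ.real (firstVisitSet T Y k ∩ A i) ≤ μ.real Y := fun k i =>
    ENNReal.toReal_mono hY_fin.ne ((measure_mono Set.inter_subset_left).trans
      (measure_firstVisitSet_le hTm hY k))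
  have hint : ∀ (g : X → ℝ) (M : ℝ) (s : Set X), Measurable g → (∀ x, |g x| ≤ M) → μ s < ∞ →
      IntegrableOn g s μ := fun g M s hg hgM hs =>
    IntegrableOn.of_bound hs hg.aestronglyMeasurable M (ae_of_all _ hgM)
  have hVabs : ∀ x, |V x| ≤ (1 - θ)⁻¹ := fun x => by rw [abs_of_nonneg (hV0 x)]; exact hVM x
  set F : X → ℝ := fun x => v (T x) * V (T x) - v x * V x with hF
  have hFm : Measurable F := ((hv.mul hVm).comp hTm.measurable).sub (hv.mul hVm)
  have hvV : ∀ x, |v x * V x| ≤ (1 - θ)⁻¹ := fun x => by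
    rw [abs_of_nonneg (mul_nonneg (hv0 x).le (hV0 x))]
    refine (mul_le_of_le_one_left (hV0 x) ((hvθ x).trans hθ.le)).trans (hVM x)
  have hFb : ∀ x, |F x| ≤ (1 - θ)⁻¹ + (1 - θ)⁻¹ := fun x =>
    (abs_sub _ _).trans (add_le_add (hvV _) (hvV _))
  have hF2 : ∀ x, F x = (1 - v x) * V x - 1 := fun x => by
    simp only [hF]
    linarith [hVeq x]
  have hlim := tendsto_setIntegral_coboundary hT hTm hY hY_fin (hv.mul hVm) hvV
  have hFY : ∫ x in Y, F x ∂μ = (1 - y) * ∫ x in Y, V x ∂μ - μ.real Y := by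
    rw [setIntegral_congr_fun (g := fun x => (1 - y) * V x - 1) hY fun x hx => by
      simp only; rw [hF2, hvY x hx]]
    rw [integral_sub ((hint V _ Y hVm hVabs hY_fin).const_mul _)
      (integrableOn_const hY_fin.ne), integral_const_mul, setIntegral_const, smul_eq_mul, mul_one]
  set a : ι → ℕ → ℝ := fun i k => μ.real (firstVisitSet T Y k ∩ A i) with ha
  set b : ι → ℕ → ℝ := fun i k => ∫ x in firstVisitSet T Y k ∩ A i, V (T^[k] x) ∂μ with hb
  -- The closed form on the cell of index `k + 1` carries `z ^ k`; the factor `1 / z i` restores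
  -- matching exponents. The cell of index `0` is empty, since `Y` is disjoint from `A i`.
  have hFcell : ∀ k i, ∫ x in firstVisitSet T Y k ∩ A i, F x ∂μ =
      -(z i ^ k * a i k) + (1 - z i) / z i * y * (z i ^ k * b i k) := by
    intro k i
    cases k with
    | zero => simp [ha, hb, firstVisitSet_zero_inter (T := T) (hYA i)]
    | succ k =>
      have hs : MeasurableSet (firstVisitSet T Y (k + 1) ∩ A i) := (hYkm _).inter (hA i)
      rw [setIntegral_congr_fun (g := fun x => -z i ^ (k + 1) +
        (1 - z i) * z i ^ k * y * V (T^[k + 1] x)) hs fun x hx => by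
          simp only
          rw [hF2, hvA i x hx.2]
          exact one_sub_mul_discountedSum_sub_one hv0 hvθ hθ hX hsep hvY (hvA i) k hx.1 hx.2]
      rw [integral_add (f := fun _ => -z i ^ (k + 1)) (integrableOn_const (hcell_fin _ i).ne)
        ((hint (fun x => V (T^[k + 1] x)) _ _ (hVm.comp (hTm.measurable.iterate _))
          (fun x => hVabs _) (hcell_fin _ i)).const_mul _), integral_const_mul, setIntegral_const,
        smul_eq_mul]
      simp only [ha, hb]
      have := (hz0 i).ne'
      field_simp
      ring
  have hFk : ∀ k, ∫ x in firstVisitSet T Y k, F x ∂μ =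
      (if k = 0 then ∫ x in Y, F x ∂μ else 0) + ∑ i, ∫ x in firstVisitSet T Y k ∩ A i, F x ∂μ := by
    intro k
    cases k with
    | zero =>
      rw [if_pos rfl, Finset.sum_eq_zero fun i _ => ?_, add_zero, firstVisitSet_zero]
      rw [firstVisitSet_zero_inter (hYA i), setIntegral_empty]
    | succ k =>
      rw [if_neg (Nat.succ_ne_zero k), zero_add, ← integral_iUnion_fintype
        (fun i => (hYkm _).inter (hA i))
        (fun i j hij => (hAA hij).mono Set.inter_subset_right Set.inter_subset_right)
        (fun i => hint F _ _ hFm hFb (hcell_fin _ i)), ← Set.inter_iUnion,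
        Set.inter_eq_left.2 (firstVisitSet_subset_iUnion hX k)]
  have hFn : ∀ n, ∫ x in ⋃ k ∈ Finset.range n, T^[k] ⁻¹' Y, F x ∂μ =
      ∑ k ∈ Finset.range n, ((if k = 0 then ∫ x in Y, F x ∂μ else 0) +
        ∑ i, (-(z i ^ k * a i k) + (1 - z i) / z i * y * (z i ^ k * b i k))) := by
    intro n
    rw [biUnion_preimage_iterate_eq, integral_biUnion_finset _ (fun k _ => hYkm k)
      (fun j _ k _ hjk => pairwise_disjoint_firstVisitSet hjk)
      (fun k _ => hint F _ _ hFm hFb (hYkfin k))]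
    refine Finset.sum_congr rfl fun k _ => ?_
    rw [hFk]
    simp only [hFcell]
  have hsa : ∀ i, Summable fun k => z i ^ k * a i k := fun i =>
    ((summable_geometric_of_lt_one (hz0 i).le (hz1 i)).mul_right (μ.real Y)).of_nonneg_of_le
      (fun k => mul_nonneg (pow_nonneg (hz0 i).le k) measureReal_nonneg)
      fun k => mul_le_mul_of_nonneg_left (hcell_le k i) (pow_nonneg (hz0 i).le k)
  have hsb : ∀ i, Summable fun k => z i ^ k * b i k := fun i => by
    refine ((summable_geometric_of_lt_one (hz0 i).le (hz1 i)).mul_right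
      ((1 - θ)⁻¹ * μ.real Y)).of_norm_bounded fun k => ?_
    rw [norm_mul, Real.norm_of_nonneg (pow_nonneg (hz0 i).le k)]
    refine mul_le_mul_of_nonneg_left ?_ (pow_nonneg (hz0 i).le k)
    refine (norm_setIntegral_le_of_norm_le_const (hcell_fin k i) fun x _ => hVabs _).trans ?_
    refine mul_le_mul_of_nonneg_left (hcell_le k i) ?_
    have : (0 : ℝ) < 1 - θ := by linarith
    positivity
  have hhas : HasSum (fun k => (if k = 0 then ∫ x in Y, F x ∂μ else 0) +
        ∑ i, (-(z i ^ k * a i k) + (1 - z i) / z i * y * (z i ^ k * b i k)))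
      (∫ x in Y, F x ∂μ + ∑ i, (-(∑' k, z i ^ k * a i k) +
        (1 - z i) / z i * y * ∑' k, z i ^ k * b i k)) :=
    (hasSum_ite_eq 0 _).add (hasSum_sum fun i _ =>
      (hsa i).hasSum.neg.add ((hsb i).hasSum.mul_left _))
  -- The same integrals converge to the sum of the series and, being integrals of a bounded
  -- coboundary, to `0`.
  have hzero := tendsto_nhds_unique hhas.tendsto_sum_nat (hlim.congr fun n => hFn n)
  rw [hFY, Finset.sum_add_distrib, Finset.sum_neg_distrib] at hzero
  linarith

end RenewalIdentity

/-! ### Consequences of uniform convergence of functions supported in `Y` -/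

section UniformLimit

variable {X : Type*} [MeasurableSpace X] {μ : Measure X} {Y : Set X} {h : ℕ → X → ℝ} {H : X → ℝ}

theorem ae_abs_sub_le_of_tendsto_eLpNorm_top
    (hlim : Tendsto (fun n => eLpNorm (fun x => h n x - H x) ∞ μ) atTop (𝓝 0))
    {ε : ℝ} (hε : 0 < ε) : ∀ᶠ n in atTop, ∀ᵐ x ∂μ, |h n x - H x| ≤ ε := by
  filter_upwards [hlim.eventually_le_const (ENNReal.ofReal_pos.2 hε)] with n hn
  rw [eLpNorm_exponent_top] at hn
  filter_upwards [ae_le_eLpNormEssSup (f := fun x => h n x - H x) (μ := μ)] with x hx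
  have h1 := hx.trans hn
  rwa [Real.enorm_eq_ofReal_abs, ENNReal.ofReal_le_ofReal_iff hε.le] at h1

theorem ae_nonneg_of_tendsto_eLpNorm_top
    (hlim : Tendsto (fun n => eLpNorm (fun x => h n x - H x) ∞ μ) atTop (𝓝 0))
    (h0 : ∀ n x, 0 ≤ h n x) : ∀ᵐ x ∂μ, 0 ≤ H x := by
  have h1 : ∀ k : ℕ, ∀ᵐ x ∂μ, -(1 / ((k : ℝ) + 1)) ≤ H x := by
    intro k
    obtain ⟨n, hn⟩ := (ae_abs_sub_le_of_tendsto_eLpNorm_top hlim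
      (Nat.one_div_pos_of_nat (n := k))).exists
    filter_upwards [hn] with x hx
    linarith [(abs_le.1 hx).2, h0 n x]
  filter_upwards [ae_all_iff.2 h1] with x hx
  have h2 := (tendsto_one_div_add_atTop_nhds_zero_nat (𝕜 := ℝ)).neg
  rw [neg_zero] at h2
  exact le_of_tendsto' h2 hx

theorem ae_eq_zero_of_tendsto_eLpNorm_top
    (hlim : Tendsto (fun n => eLpNorm (fun x => h n x - H x) ∞ μ) atTop (𝓝 0))
    (hY : ∀ n, ∀ᵐ x ∂μ, x ∉ Y → h n x = 0) : ∀ᵐ x ∂μ, x ∉ Y → H x = 0 := by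
  have h1 : ∀ k : ℕ, ∀ᵐ x ∂μ, x ∉ Y → |H x| ≤ 1 / ((k : ℝ) + 1) := by
    intro k
    obtain ⟨n, hn⟩ := (ae_abs_sub_le_of_tendsto_eLpNorm_top hlim
      (Nat.one_div_pos_of_nat (n := k))).exists
    filter_upwards [hn, hY n] with x hx hx2 hxY
    rwa [hx2 hxY, zero_sub, abs_neg] at hx
  filter_upwards [ae_all_iff.2 h1] with x hx hxY
  exact abs_nonpos_iff.1 (ge_of_tendsto' tendsto_one_div_add_atTop_nhds_zero_nat
    fun k => hx k hxY)

theorem integrable_of_bounded_of_ae_eq_zero (hYm : MeasurableSet Y) (hY_fin : μ Y < ∞)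
    {g : X → ℝ} (hg : AEStronglyMeasurable g μ) {B : ℝ} (hgB : ∀ᵐ x ∂μ, |g x| ≤ B)
    (hgY : ∀ᵐ x ∂μ, x ∉ Y → g x = 0) : Integrable g μ := by
  have h1 : IntegrableOn g Y μ := IntegrableOn.of_bound hY_fin hg.restrict B
    (ae_restrict_of_ae hgB)
  refine ((integrable_indicator_iff hYm).2 h1).congr ?_
  filter_upwards [hgY] with x hx
  by_cases hxY : x ∈ Y
  · rw [Set.indicator_of_mem hxY]
  · rw [Set.indicator_of_notMem hxY, hx hxY]

theorem exists_ae_abs_le_of_memLp_top (hH : MemLp H ∞ μ) : ∃ B : ℝ, ∀ᵐ x ∂μ, |H x| ≤ B := by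
  refine ⟨(eLpNormEssSup H μ).toReal, ?_⟩
  have hfin : eLpNormEssSup H μ ≠ ∞ := by
    rw [← eLpNorm_exponent_top]
    exact hH.2.ne
  filter_upwards [ae_le_eLpNormEssSup (f := H) (μ := μ)] with x hx
  rwa [Real.enorm_eq_ofReal_abs, ENNReal.ofReal_le_iff_le_toReal hfin] at hx

/-- An integral against a function supported in `Y` and bounded by `ε`. -/
theorem abs_integral_mul_le_of_ae_eq_zero (hYm : MeasurableSet Y) (hY_fin : μ Y < ∞)
    {g : X → ℝ} {ε : ℝ} (hgB : ∀ᵐ x ∂μ, |g x| ≤ ε)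
    (hgY : ∀ᵐ x ∂μ, x ∉ Y → g x = 0) {V : X → ℝ} (hV : Measurable V) (hV0 : ∀ x, 0 ≤ V x) {M : ℝ}
    (hVM : ∀ x, V x ≤ M) : |∫ x, g x * V x ∂μ| ≤ ε * ∫ x in Y, V x ∂μ := by
  have h1 : ∫ x, g x * V x ∂μ = ∫ x in Y, g x * V x ∂μ := by
    rw [← integral_indicator hYm]
    refine integral_congr_ae ?_
    filter_upwards [hgY] with x hx
    by_cases hxY : x ∈ Y
    · rw [Set.indicator_of_mem hxY]
    · rw [Set.indicator_of_notMem hxY, hx hxY, zero_mul]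
  rw [h1, ← integral_const_mul, ← Real.norm_eq_abs]
  refine norm_integral_le_of_norm_le ?_ (ae_restrict_of_ae ?_)
  · refine Integrable.const_mul (IntegrableOn.of_bound hY_fin hV.aestronglyMeasurable M
      (ae_of_all _ fun x => ?_)) ε
    rw [Real.norm_of_nonneg (hV0 x)]
    exact hVM x
  · filter_upwards [hgB] with x hx
    rw [norm_mul, Real.norm_eq_abs, Real.norm_of_nonneg (hV0 x)]
    exact mul_le_mul_of_nonneg_right hx (hV0 x)

/-- The threshold in `n` is chosen before `V`. This uniformity is essential, since `V` will vary
with the discount rates. -/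
theorem abs_integral_mul_sub_le (hYm : MeasurableSet Y) (hY_fin : μ Y < ∞)
    (hlim : Tendsto (fun n => eLpNorm (fun x => h n x - H x) ∞ μ) atTop (𝓝 0))
    (hh : ∀ n, Measurable (h n)) (hY : ∀ n, ∀ᵐ x ∂μ, x ∉ Y → h n x = 0) (hH : MemLp H ∞ μ)
    {ε : ℝ} (hε : 0 < ε) : ∀ᶠ n in atTop, ∀ V : X → ℝ, Measurable V → (∀ x, 0 ≤ V x) →
      ∀ M : ℝ, (∀ x, V x ≤ M) →
      |∫ x, h n x * V x ∂μ - ∫ x, H x * V x ∂μ| ≤ ε * ∫ x in Y, V x ∂μ := by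
  have hHY := ae_eq_zero_of_tendsto_eLpNorm_top hlim hY
  obtain ⟨B, hB⟩ := exists_ae_abs_le_of_memLp_top hH
  filter_upwards [ae_abs_sub_le_of_tendsto_eLpNorm_top hlim hε] with n hn V hV hV0 M hVM
  have hVb : ∀ᵐ x ∂μ, ‖V x‖ ≤ M := ae_of_all _ fun x => by
    rw [Real.norm_of_nonneg (hV0 x)]
    exact hVM x
  have h1 : Integrable H μ := integrable_of_bounded_of_ae_eq_zero hYm hY_fin hH.1 hB hHY
  have h2 : Integrable (h n) μ := by
    refine integrable_of_bounded_of_ae_eq_zero hYm hY_fin (hh n).aestronglyMeasurable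
      (B := ε + B) ?_ (hY n)
    filter_upwards [hn, hB] with x hx1 hx2
    calc |h n x| = |(h n x - H x) + H x| := by ring_nf
      _ ≤ |h n x - H x| + |H x| := abs_add_le _ _
      _ ≤ ε + B := add_le_add hx1 hx2
  rw [← integral_sub (h2.mul_bdd hV.aestronglyMeasurable hVb)
    (h1.mul_bdd hV.aestronglyMeasurable hVb)]
  simp only [← sub_mul]
  refine abs_integral_mul_le_of_ae_eq_zero hYm hY_fin hn ?_ hV hV0 hVM
  filter_upwards [hY n, hHY] with x h3 h4 hxY
  rw [h3 hxY, h4 hxY, sub_zero]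

end UniformLimit

/-! ### Generating functions of the cell integrals -/

section PowerSeries

variable {X : Type*} [MeasurableSpace X] {μ : Measure X} {T : X → X} {Y A : Set X}

theorem setIntegral_comp_iterate_mem_Icc (hT : MeasurePreserving T μ μ) (hY : MeasurableSet Y)
    (hY_fin : μ Y < ∞) {V : X → ℝ} (hV : Measurable V) (hV0 : ∀ x, 0 ≤ V x) {M : ℝ}
    (hVM : ∀ x, V x ≤ M) (k : ℕ) :
    ∫ x in firstVisitSet T Y k ∩ A, V (T^[k] x) ∂μ ∈ Set.Icc 0 (∫ x in Y, V x ∂μ) := by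
  refine ⟨integral_nonneg fun x => hV0 _, ?_⟩
  have hTk := hT.iterate k
  have h1 : ∫ x in Y, V x ∂μ = ∫ x in T^[k] ⁻¹' Y, V (T^[k] x) ∂μ := by
    conv_lhs => rw [← hTk.map_eq]
    exact setIntegral_map hY hV.aestronglyMeasurable hTk.measurable.aemeasurable
  rw [h1]
  refine setIntegral_mono_set ?_ (ae_of_all _ fun x => hV0 _)
    (Set.inter_subset_left.trans Set.sdiff_subset).eventuallyLE
  refine IntegrableOn.of_bound ?_ (hV.comp hTk.measurable).aestronglyMeasurable M
    (ae_of_all _ fun x => ?_)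
  · rw [hTk.measure_preimage hY.nullMeasurableSet]
    exact hY_fin
  · exact (Real.norm_of_nonneg (hV0 _)).trans_le (hVM _)

theorem measureReal_firstVisitSet_inter_le (hT : MeasurePreserving T μ μ) (hY : MeasurableSet Y)
    (hY_fin : μ Y < ∞) (k : ℕ) : μ.real (firstVisitSet T Y k ∩ A) ≤ μ.real Y :=
  ENNReal.toReal_mono hY_fin.ne ((measure_mono Set.inter_subset_left).trans
    (measure_firstVisitSet_le hT hY k))

theorem toReal_wanderingRate_eq_sum (hT : MeasurePreserving T μ μ) (hY : MeasurableSet Y)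
    (hY_fin : μ Y < ∞) (hA : MeasurableSet A) (n : ℕ) :
    (wanderingRate μ T Y A n).toReal =
      ∑ k ∈ Finset.range n, μ.real (firstVisitSet T Y k ∩ A) := by
  rw [wanderingRate_eq_sum hT.measurable hY hA, ENNReal.toReal_sum]
  · rfl
  · exact fun k _ => ((measure_mono Set.inter_subset_left).trans_lt
      ((measure_firstVisitSet_le hT hY k).trans_lt hY_fin)).ne

theorem summable_pow_mul_of_mem_Icc {a : ℕ → ℝ} {B : ℝ} (ha : ∀ k, a k ∈ Set.Icc 0 B) {z : ℝ}
    (hz0 : 0 ≤ z) (hz1 : z < 1) : Summable fun k => z ^ k * a k :=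
  ((summable_geometric_of_lt_one hz0 hz1).mul_right B).of_nonneg_of_le
    (fun k => mul_nonneg (pow_nonneg hz0 k) (ha k).1)
    fun k => mul_le_mul_of_nonneg_left (ha k).2 (pow_nonneg hz0 k)

/-- Comparison of the generating functions of `b` and `a` from a comparison of partial sums. -/
theorem tsum_pow_mul_le_of_sum_le_mul_sum_add {a b : ℕ → ℝ} {Ba Bb B x y : ℝ}
    (ha : ∀ k, a k ∈ Set.Icc 0 Ba) (hb : ∀ k, b k ∈ Set.Icc 0 Bb)
    (h : ∀ n, x * ∑ k ∈ Finset.range n, b k ≤ y * ∑ k ∈ Finset.range n, a k + B)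
    {z : ℝ} (hz0 : 0 ≤ z) (hz1 : z < 1) :
    x * ∑' k, z ^ k * b k ≤ y * ∑' k, z ^ k * a k + B := by
  have hsa := (summable_pow_mul_of_mem_Icc ha hz0 hz1).mul_left y
  have hsb := (summable_pow_mul_of_mem_Icc hb hz0 hz1).mul_left x
  have he : ∀ k, x * (z ^ k * b k) - y * (z ^ k * a k) = z ^ k * (x * b k - y * a k) :=
    fun k => by ring
  have h1 := tsum_pow_mul_le_of_sum_le (f := fun k => x * b k - y * a k) (B := B) (fun n => by
    rw [Finset.sum_sub_distrib, ← Finset.mul_sum, ← Finset.mul_sum]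
    linarith [h n]) hz0 hz1.le ((hsb.sub hsa).congr fun k => he k)
  rw [← tsum_congr he, hsb.tsum_sub hsa, tsum_mul_left, tsum_mul_left] at h1
  linarith

variable [SigmaFinite μ]

/-- Uniform convergence of `h_n` says that the partial sums of the cell integrals are `w_n ∫ H V` up
to `ε w_n ∫_Y V`, for all large `n`. The finitely many remaining `n` go into `C`, and summation by
parts carries the comparison to power series. `C` depends neither on `V` nor on `z`. -/
theorem abs_tsum_setIntegral_sub_le (hT : MeasurePreserving T μ μ) (hY : MeasurableSet Y)
    (hY_fin : μ Y < ∞) (hA : MeasurableSet A)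
    (hw : ∀ᶠ n in atTop, wanderingRate μ T Y A n ≠ 0) {H : X → ℝ} (hH : MemLp H ∞ μ)
    (hlim : Tendsto (fun n => eLpNorm (fun x => (entranceAverage μ T Y A n x).toReal - H x) ∞ μ)
      atTop (𝓝 0)) {B : ℝ} (hB : ∀ᵐ x ∂μ, |H x| ≤ B) {ε : ℝ} (hε : 0 < ε) :
    ∃ C, ∀ V : X → ℝ, Measurable V → (∀ x, 0 ≤ V x) → ∀ M : ℝ, (∀ x, V x ≤ M) →
      ∀ z : ℝ, 0 ≤ z → z < 1 →
      |∑' k, z ^ k * ∫ x in firstVisitSet T Y k ∩ A, V (T^[k] x) ∂μ -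
        (∑' k, z ^ k * μ.real (firstVisitSet T Y k ∩ A)) * ∫ x, H x * V x ∂μ| ≤
      (ε * (∑' k, z ^ k * μ.real (firstVisitSet T Y k ∩ A)) + C) * ∫ x in Y, V x ∂μ := by
  have hhm : ∀ n, Measurable fun x => (entranceAverage μ T Y A n x).toReal := fun n =>
    (measurable_entranceAverage hT.measurable hY hA n).ennreal_toReal
  have hhY : ∀ n, ∀ᵐ x ∂μ, x ∉ Y → (entranceAverage μ T Y A n x).toReal = 0 := fun n => by
    filter_upwards [entranceAverage_ae_eq_zero hT hY hA n] with x hx hxY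
    rw [hx hxY, ENNReal.toReal_zero]
  have hHY := ae_eq_zero_of_tendsto_eLpNorm_top hlim hhY
  obtain ⟨n₁, hn₁⟩ := eventually_atTop.1
    (hw.and (abs_integral_mul_sub_le hY hY_fin hlim hhm hhY hH hε))
  set a : ℕ → ℝ := fun k => μ.real (firstVisitSet T Y k ∩ A) with ha
  have haI : ∀ k, a k ∈ Set.Icc 0 (μ.real Y) := fun k =>
    ⟨measureReal_nonneg, measureReal_firstVisitSet_inter_le hT hY hY_fin k⟩
  -- For `n < n₁` the two sums are at most `n₁ ∫_Y V` and `n₁ μ(Y)`, and `|∫ H V| ≤ |B| ∫_Y V`.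
  refine ⟨n₁ + n₁ * μ.real Y * |B|, fun V hV hV0 M hVM z hz0 hz1 => ?_⟩
  set b : ℕ → ℝ := fun k => ∫ x in firstVisitSet T Y k ∩ A, V (T^[k] x) ∂μ with hb
  set I := ∫ x in Y, V x ∂μ with hI
  set J := ∫ x, H x * V x ∂μ with hJ
  have hI0 : 0 ≤ I := integral_nonneg hV0
  have hbI : ∀ k, b k ∈ Set.Icc 0 I := fun k =>
    setIntegral_comp_iterate_mem_Icc hT hY hY_fin hV hV0 hVM k
  have hJB : |J| ≤ |B| * I := by
    refine (abs_integral_mul_le_of_ae_eq_zero hY hY_fin hB hHY hV hV0 hVM).trans ?_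
    exact mul_le_mul_of_nonneg_right (le_abs_self B) hI0
  set C := (n₁ + n₁ * μ.real Y * |B|) * I with hC
  have hkey : ∀ n, |∑ k ∈ Finset.range n, b k - (∑ k ∈ Finset.range n, a k) * J| ≤
      ε * I * (∑ k ∈ Finset.range n, a k) + C := by
    intro n
    have hw0 : 0 ≤ ∑ k ∈ Finset.range n, a k := Finset.sum_nonneg fun k _ => (haI k).1
    have hC0 : 0 ≤ C := by positivity
    rcases le_or_gt n₁ n with hn | hn
    · have h1 := (hn₁ n hn).2 V hV hV0 M hVM
      rw [sum_setIntegral_comp_iterate hT hY hY_fin hA (hn₁ n hn).1 hV hV0 hVM,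
        toReal_wanderingRate_eq_sum hT hY hY_fin hA, ← mul_sub, abs_mul, abs_of_nonneg hw0]
      have := mul_le_mul_of_nonneg_left h1 hw0
      linarith
    · have hn' : (n : ℝ) ≤ n₁ := by exact_mod_cast hn.le
      have h1 : ∑ k ∈ Finset.range n, b k ≤ n * I := by
        refine (Finset.sum_le_card_nsmul _ _ I fun k _ => (hbI k).2).trans_eq ?_
        rw [Finset.card_range, nsmul_eq_mul]
      have h2 : ∑ k ∈ Finset.range n, a k ≤ n * μ.real Y := by
        refine (Finset.sum_le_card_nsmul _ _ _ fun k _ => (haI k).2).trans_eq ?_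
        rw [Finset.card_range, nsmul_eq_mul]
      have h3 : 0 ≤ ∑ k ∈ Finset.range n, b k := Finset.sum_nonneg fun k _ => (hbI k).1
      have hYr : 0 ≤ μ.real Y := measureReal_nonneg
      calc |∑ k ∈ Finset.range n, b k - (∑ k ∈ Finset.range n, a k) * J|
          ≤ |∑ k ∈ Finset.range n, b k| + |(∑ k ∈ Finset.range n, a k) * J| := abs_sub _ _
        _ = ∑ k ∈ Finset.range n, b k + (∑ k ∈ Finset.range n, a k) * |J| := by
          rw [abs_of_nonneg h3, abs_mul, abs_of_nonneg hw0]
        _ ≤ n₁ * I + (n₁ * μ.real Y) * (|B| * I) := by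
          have h4 := h1.trans (mul_le_mul_of_nonneg_right hn' hI0)
          have h5 := h2.trans (mul_le_mul_of_nonneg_right hn' hYr)
          exact add_le_add h4 (mul_le_mul h5 hJB (abs_nonneg _) (by positivity))
        _ = C := by rw [hC]; ring
        _ ≤ _ := le_add_of_nonneg_left (by positivity)
  have hup := tsum_pow_mul_le_of_sum_le_mul_sum_add (x := 1) (y := J + ε * I) (B := C) haI hbI
    (fun n => by linarith [(abs_le.1 (hkey n)).2]) hz0 hz1
  -- The lower bound is the same comparison applied with `x = -1`.
  have hlow := tsum_pow_mul_le_of_sum_le_mul_sum_add (x := -1) (y := ε * I - J) (B := C) haI hbI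
    (fun n => by linarith [(abs_le.1 (hkey n)).1]) hz0 hz1
  rw [abs_le]
  constructor <;> linarith

theorem tsum_setIntegral_le_of_bounded (hT : MeasurePreserving T μ μ) (hY : MeasurableSet Y)
    (hY_fin : μ Y < ∞) (hA : MeasurableSet A)
    (hw : ∀ᶠ n in atTop, wanderingRate μ T Y A n ≠ 0) {B : ℝ≥0}
    (hB : ∀ n, 2 ≤ n → eLpNorm (entranceAverage μ T Y A n) ∞ μ ≤ B) :
    ∃ C : ℝ, ∀ V : X → ℝ, Measurable V → (∀ x, 0 ≤ V x) → ∀ M : ℝ, (∀ x, V x ≤ M) →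
      ∀ z : ℝ, 0 ≤ z → z < 1 →
      ∑' k, z ^ k * ∫ x in firstVisitSet T Y k ∩ A, V (T^[k] x) ∂μ ≤
      (B * (∑' k, z ^ k * μ.real (firstVisitSet T Y k ∩ A)) + C) * ∫ x in Y, V x ∂μ := by
  obtain ⟨n₁, hn₁⟩ := eventually_atTop.1 (hw.and (eventually_ge_atTop 2))
  set a : ℕ → ℝ := fun k => μ.real (firstVisitSet T Y k ∩ A) with ha
  have haI : ∀ k, a k ∈ Set.Icc 0 (μ.real Y) := fun k =>
    ⟨measureReal_nonneg, measureReal_firstVisitSet_inter_le hT hY hY_fin k⟩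
  refine ⟨n₁, fun V hV hV0 M hVM z hz0 hz1 => ?_⟩
  set b : ℕ → ℝ := fun k => ∫ x in firstVisitSet T Y k ∩ A, V (T^[k] x) ∂μ with hb
  set I := ∫ x in Y, V x ∂μ with hI
  have hI0 : 0 ≤ I := integral_nonneg hV0
  have hbI : ∀ k, b k ∈ Set.Icc 0 I := fun k =>
    setIntegral_comp_iterate_mem_Icc hT hY hY_fin hV hV0 hVM k
  have hup := tsum_pow_mul_le_of_sum_le_mul_sum_add (x := 1) (y := B * I) (B := n₁ * I) haI hbI
    (fun n => by
      have hw0 : 0 ≤ ∑ k ∈ Finset.range n, a k := Finset.sum_nonneg fun k _ => (haI k).1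
      have hB0 : (0 : ℝ) ≤ B := B.coe_nonneg
      rw [one_mul]
      rcases le_or_gt n₁ n with hn | hn
      · have h1 : ∀ᵐ x ∂μ, |(entranceAverage μ T Y A n x).toReal| ≤ B := by
          have h2 := hB n (hn₁ n hn).2
          rw [eLpNorm_exponent_top] at h2
          filter_upwards [ae_le_eLpNormEssSup (f := entranceAverage μ T Y A n) (μ := μ)] with x hx
          rw [abs_of_nonneg ENNReal.toReal_nonneg]
          exact ENNReal.toReal_mono ENNReal.coe_ne_top (hx.trans h2)
        have h3 : ∀ᵐ x ∂μ, x ∉ Y → (entranceAverage μ T Y A n x).toReal = 0 := by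
          filter_upwards [entranceAverage_ae_eq_zero hT hY hA n] with x hx hxY
          rw [hx hxY, ENNReal.toReal_zero]
        have h4 := (le_abs_self _).trans
          (abs_integral_mul_le_of_ae_eq_zero hY hY_fin h1 h3 hV hV0 hVM)
        rw [sum_setIntegral_comp_iterate hT hY hY_fin hA (hn₁ n hn).1 hV hV0 hVM,
          toReal_wanderingRate_eq_sum hT hY hY_fin hA]
        have := mul_le_mul_of_nonneg_left h4 hw0
        have : 0 ≤ n₁ * I := by positivity
        linarith
      · have hn' : (n : ℝ) ≤ n₁ := by exact_mod_cast hn.le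
        have h1 : ∑ k ∈ Finset.range n, b k ≤ n * I := by
          refine (Finset.sum_le_card_nsmul _ _ I fun k _ => (hbI k).2).trans_eq ?_
          rw [Finset.card_range, nsmul_eq_mul]
        have h2 := h1.trans (mul_le_mul_of_nonneg_right hn' hI0)
        have : 0 ≤ B * I * ∑ k ∈ Finset.range n, a k := by positivity
        linarith) hz0 hz1
  linarith

/-- Sweeping is used for a single large `n`. Replacing `h_n` by its limit costs at most half of `∫_Y
V`, whence the tolerance `1 / (2 C₀)`, and that half is absorbed on the left. -/
theorem setIntegral_le_of_uniformlySweeping (hT : MeasurePreserving T μ μ) (hY : MeasurableSet Y)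
    (hY_fin : μ Y < ∞) (hA : MeasurableSet A) {H : X → ℝ} (hH : MemLp H ∞ μ)
    (hlim : Tendsto (fun n => eLpNorm (fun x => (entranceAverage μ T Y A n x).toReal - H x) ∞ μ)
      atTop (𝓝 0)) {N : ℕ} {F : Set (X → ℝ≥0∞)} (hF : UniformlySweeping μ T F (Y.indicator 1))
    (hFmem : ∀ n, N ≤ n → entranceAverage μ T Y A n ∈ F) {D : ℝ} (hD : 0 < D) :
    ∃ C : ℝ, 0 < C ∧ ∀ V : X → ℝ, Measurable V → (∀ x, 0 ≤ V x) → ∀ M : ℝ, (∀ x, V x ≤ M) →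
      (∀ x, V (T x) ≤ D * V x) → ∫ x in Y, V x ∂μ ≤ C * ∫ x, H x * V x ∂μ := by
  have hhm : ∀ n, Measurable fun x => (entranceAverage μ T Y A n x).toReal := fun n =>
    (measurable_entranceAverage hT.measurable hY hA n).ennreal_toReal
  have hhY : ∀ n, ∀ᵐ x ∂μ, x ∉ Y → (entranceAverage μ T Y A n x).toReal = 0 := fun n => by
    filter_upwards [entranceAverage_ae_eq_zero hT hY hA n] with x hx hxY
    rw [hx hxY, ENNReal.toReal_zero]
  obtain ⟨C, hC, K, hCK⟩ := hF
  set C₀ : ℝ := C * ∑ k ∈ Finset.range (K + 1), D ^ k with hC₀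
  have hC₀pos : 0 < C₀ := mul_pos (by exact_mod_cast hC)
    (Finset.sum_pos (fun k _ => pow_pos hD k) ⟨0, by simp⟩)
  obtain ⟨n, hn, hnN⟩ := ((abs_integral_mul_sub_le hY hY_fin hlim hhm hhY hH
    (show 0 < 1 / (2 * C₀) by positivity)).and (eventually_ge_atTop N)).exists
  refine ⟨2 * C₀, by positivity, fun V hV hV0 M hVM hVT => ?_⟩
  have h1 := setIntegral_le_of_sweeping hT hY
    (measurable_entranceAverage hT.measurable hY hA n)
    (lintegral_entranceAverage_ne_top hT hY hA n) (hCK _ (hFmem n hnN)) hV hV0 hVM hD.le hVT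
  have h2 := (abs_le.1 (hn V hV hV0 M hVM)).2
  rw [← hC₀] at h1
  have h3 := h1.trans (mul_le_mul_of_nonneg_left (sub_le_iff_le_add.1 h2) hC₀pos.le)
  have h4 : C₀ * (1 / (2 * C₀) * ∫ x in Y, V x ∂μ) = (∫ x in Y, V x ∂μ) / 2 := by
    field_simp
  rw [mul_add, h4] at h3
  linarith

end PowerSeries

/-! ### Asymptotic solution of the renewal equation -/

section RenewalAsymptotics

/-- Replaces `P b / D` by `c J` with an error small relative to `I`: the part `ε Q` is controlled
because `P Q / D` converges, and the constant `C` disappears because `P / D → 0`. -/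
theorem tendsto_mul_sub_div_zero_of_forall_abs_sub_le {P Q b J I D : ℕ → ℝ} {c B : ℝ}
    (hP0 : ∀ n, 0 ≤ P n) (hD : ∀ n, 0 < D n) (hI : ∀ n, 0 < I n)
    (hPQ : Tendsto (fun n => P n * Q n / D n) atTop (𝓝 c))
    (hP : Tendsto (fun n => P n / D n) atTop (𝓝 0)) (hJ : ∀ n, |J n| ≤ B * I n)
    (hb : ∀ ε > 0, ∃ C, ∀ n, |b n - Q n * J n| ≤ (ε * Q n + C) * I n) :
    Tendsto (fun n => (P n * b n / D n - c * J n) / I n) atTop (𝓝 0) := by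
  have h1 : Tendsto (fun n => P n / D n * ((b n - Q n * J n) / I n)) atTop (𝓝 0) := by
    rw [Metric.tendsto_nhds]
    intro ε hε
    set η := ε / (2 * (|c| + 1)) with hη
    have hη0 : 0 < η := by positivity
    obtain ⟨C, hC⟩ := hb η hη0
    have h2 : Tendsto (fun n => η * (P n * Q n / D n) + P n / D n * C) atTop
        (𝓝 (η * c + 0 * C)) := (hPQ.const_mul η).add (hP.mul_const C)
    have h3 : η * c + 0 * C < ε := by
      have h4 : η * c ≤ η * (|c| + 1) :=
        mul_le_mul_of_nonneg_left (by linarith [le_abs_self c]) hη0.le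
      have h5 : η * (|c| + 1) = ε / 2 := by rw [hη]; field_simp
      linarith
    filter_upwards [h2.eventually_lt_const h3] with n hn
    rw [Real.dist_eq, sub_zero, abs_mul, abs_of_nonneg (div_nonneg (hP0 n) (hD n).le), abs_div,
      abs_of_pos (hI n)]
    refine lt_of_le_of_lt ?_ hn
    have h4 : |b n - Q n * J n| / I n ≤ η * Q n + C := (div_le_iff₀ (hI n)).2 (hC n)
    calc P n / D n * (|b n - Q n * J n| / I n) ≤ P n / D n * (η * Q n + C) :=
          mul_le_mul_of_nonneg_left h4 (div_nonneg (hP0 n) (hD n).le)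
      _ = _ := by ring
  have h2 : Tendsto (fun n => (P n * Q n / D n - c) * (J n / I n)) atTop (𝓝 0) := by
    have h3 : Tendsto (fun n => |P n * Q n / D n - c| * B) atTop (𝓝 0) := by
      have := ((hPQ.sub_const c).abs).mul_const B
      simpa using this
    refine squeeze_zero_norm (fun n => ?_) h3
    rw [norm_mul, Real.norm_eq_abs, Real.norm_eq_abs, abs_div, abs_of_pos (hI n)]
    exact mul_le_mul_of_nonneg_left ((div_le_iff₀ (hI n)).2 (hJ n)) (abs_nonneg _)
  have h3 := h1.add h2
  rw [add_zero] at h3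
  refine h3.congr fun n => ?_
  have := (hD n).ne'
  have := (hI n).ne'
  field_simp
  ring

theorem tendsto_one_sub_exp_neg_div {s : ℕ → ℝ} (hs0 : ∀ n, 0 < s n)
    (hs : Tendsto s atTop (𝓝 0)) :
    Tendsto (fun n => (1 - Real.exp (-s n)) / s n) atTop (𝓝 1) := by
  have h1 := (Real.hasDerivAt_exp 0).tendsto_slope_zero
  rw [Real.exp_zero] at h1
  have h2 : Tendsto (fun n => -s n) atTop (𝓝[≠] 0) := by
    refine tendsto_nhdsWithin_iff.2 ⟨by simpa using hs.neg, Eventually.of_forall fun n => ?_⟩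
    exact neg_ne_zero.2 (hs0 n).ne'
  refine (h1.comp h2).congr fun n => ?_
  have := (hs0 n).ne'
  simp only [Function.comp, zero_add, smul_eq_mul]
  field_simp
  ring

/-- Asymptotics of the solution of a renewal equation whose coefficients are power series with
regularly varying partial sums, when one of the discount rates is negligible. -/
theorem tendsto_of_renewal_equation {ℓ : ℝ → ℝ} (hℓ : SlowlyVaryingAtInfty ℓ) {α : ℝ}
    (hα : α ∈ Set.Ioo (0 : ℝ) 1) {m : ℕ} {a : Fin (m + 1) → ℕ → ℝ} {Ba : ℝ}
    (ha : ∀ i k, a i k ∈ Set.Icc 0 Ba) {β : Fin (m + 1) → ℝ} (hβ : ∀ i, 0 < β i)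
    (hw : ∀ i, (fun n : ℕ => ∑ k ∈ Finset.range n, a i k) ~[atTop]
      fun n : ℕ => β i * (n : ℝ) ^ (1 - α) * ℓ n)
    {lam : Fin m → ℝ} (hlam : ∀ i, 0 < lam i) {q κ : ℕ → ℝ} (hq0 : ∀ n, 0 < q n)
    (hκ0 : ∀ n, 0 < κ n) (hq : Tendsto q atTop (𝓝 0)) (hκ : Tendsto κ atTop (𝓝 0))
    (hqκ : Tendsto (fun n => q n / κ n) atTop (𝓝 0)) {I : ℕ → ℝ} {J : Fin m → ℕ → ℝ}
    {b : Fin (m + 1) → ℕ → ℝ} (hI : ∀ n, 0 < I n) {B C c₀ : ℝ}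
    (hJ : ∀ i n, |J i n| ≤ B * I n)
    (hIJ : ∀ᶠ n in atTop, I n ≤ C * ∑ i, β i.castSucc * lam i ^ α * J i n)
    (hb : ∀ i : Fin m, ∀ ε > 0, ∃ C, ∀ n, |b i.castSucc n -
      (∑' k, Real.exp (-(q n + κ n * lam i)) ^ k * a i.castSucc k) * J i n| ≤
      (ε * (∑' k, Real.exp (-(q n + κ n * lam i)) ^ k * a i.castSucc k) + C) * I n)
    (hbl0 : ∀ n, 0 ≤ b (Fin.last m) n)
    (hbl : ∃ C₁ C₂, ∀ n, b (Fin.last m) n ≤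
      (C₁ * (∑' k, Real.exp (-q n) ^ k * a (Fin.last m) k) + C₂) * I n)
    (heq : ∀ n, c₀ + (∑ i : Fin m, (∑' k, Real.exp (-(q n + κ n * lam i)) ^ k * a i.castSucc k) +
        ∑' k, Real.exp (-q n) ^ k * a (Fin.last m) k) =
      (1 - Real.exp (-q n)) * I n + (∑ i : Fin m, (1 - Real.exp (-(q n + κ n * lam i))) /
        Real.exp (-(q n + κ n * lam i)) * Real.exp (-q n) * b i.castSucc n +
        (1 - Real.exp (-q n)) * b (Fin.last m) n)) :
    Tendsto (fun n => (∑ i, β i.castSucc * lam i ^ α * J i n) * (κ n ^ α * ℓ (1 / κ n)) /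
      ((1 / q n) ^ (1 - α) * ℓ (1 / q n))) atTop (𝓝 (β (Fin.last m))) := by
  obtain ⟨hα0, hα1⟩ := hα
  set Γ := Real.Gamma (1 + (1 - α)) with hΓdef
  have hΓ : 0 < Γ := Real.Gamma_pos_of_pos (by linarith)
  set W : ℝ → ℝ := fun s => (1 / s) ^ (1 - α) * ℓ (1 / s) with hW
  have hW0 : ∀ s, 0 < s → 0 < W s := fun s hs =>
    mul_pos (Real.rpow_pos_of_pos (by positivity) _) (hℓ.pos _ (by positivity))
  set D : ℕ → ℝ := fun n => κ n ^ α * ℓ (1 / κ n) with hD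
  have hD0 : ∀ n, 0 < D n := fun n =>
    mul_pos (Real.rpow_pos_of_pos (hκ0 n) _) (hℓ.pos _ (one_div_pos.2 (hκ0 n)))
  set Q : Fin (m + 1) → ℝ → ℝ := fun i s => ∑' k, Real.exp (-s) ^ k * a i k with hQ
  have hinv : ∀ s : ℕ → ℝ, (∀ n, 0 < s n) → Tendsto s atTop (𝓝 0) →
      Tendsto (fun n => 1 / s n) atTop atTop := fun s hs0 hs => by
    simp only [one_div]
    exact tendsto_inv_nhdsGT_zero.comp
      (tendsto_nhdsWithin_iff.2 ⟨hs, Eventually.of_forall hs0⟩)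
  have hQW : ∀ i, ∀ s : ℕ → ℝ, (∀ n, 0 < s n) → Tendsto s atTop (𝓝 0) →
      Tendsto (fun n => Q i (s n) / W (s n)) atTop (𝓝 (β i * Γ)) := by
    intro i s hs0 hs
    have h1 := (tendsto_tsum_exp_neg_mul_div hℓ (fun k => (ha i k).1) (fun k => (ha i k).2)
      (σ := 1 - α) (by linarith) (by linarith) (hβ i) (hw i)).comp (hinv s hs0 hs)
    refine h1.congr fun n => ?_
    simp only [Function.comp, hQ, hW]
    congr 1
    refine tsum_congr fun k => ?_
    rw [← Real.exp_nat_mul, div_div_eq_mul_div, div_one, mul_neg]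
  have hWtop : ∀ s : ℕ → ℝ, (∀ n, 0 < s n) → Tendsto s atTop (𝓝 0) →
      Tendsto (fun n => W (s n)) atTop atTop := fun s hs0 hs =>
    (hℓ.tendsto_rpow_mul_atTop (by linarith)).comp (hinv s hs0 hs)
  have hQtop : ∀ i, ∀ s : ℕ → ℝ, (∀ n, 0 < s n) → Tendsto s atTop (𝓝 0) →
      Tendsto (fun n => Q i (s n)) atTop atTop := by
    intro i s hs0 hs
    have h1 := (hWtop s hs0 hs).atTop_mul_pos (mul_pos (hβ i) hΓ) (hQW i s hs0 hs)
    refine h1.congr fun n => ?_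
    have := (hW0 _ (hs0 n)).ne'
    field_simp
  -- Turns the growth `s^{-(1-α)}` of the generating functions, multiplied by a factor of order `s`,
  -- into the scale `s^α ℓ(1/s)` of the right-hand side.
  have hsW : ∀ s, 0 < s → s * W s = s ^ α * ℓ (1 / s) := by
    intro s hs
    simp only [hW]
    rw [← mul_assoc, one_div, Real.inv_rpow hs.le, ← Real.rpow_neg hs.le]
    congr 1
    nth_rewrite 1 [← Real.rpow_one s]
    rw [← Real.rpow_add hs]
    congr 1
    ring
  set s : Fin m → ℕ → ℝ := fun i n => q n + κ n * lam i with hs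
  have hs0 : ∀ i n, 0 < s i n := fun i n => add_pos (hq0 n) (mul_pos (hκ0 n) (hlam i))
  have hslim : ∀ i, Tendsto (s i) atTop (𝓝 0) := fun i => by
    have := hq.add (hκ.mul_const (lam i))
    simpa using this
  have hsκ : ∀ i, Tendsto (fun n => s i n / κ n) atTop (𝓝 (lam i)) := fun i => by
    have h1 := hqκ.add_const (lam i)
    rw [zero_add] at h1
    refine h1.congr fun n => ?_
    have := (hκ0 n).ne'
    simp only [hs]
    field_simp
  have hsq : ∀ i, Tendsto (fun n => s i n / q n) atTop atTop := fun i => by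
    have h1 := (hinv _ (fun n => div_pos (hq0 n) (hκ0 n)) hqκ).atTop_mul_pos (hlam i) (hsκ i)
    refine h1.congr fun n => ?_
    have := (hκ0 n).ne'
    have := (hq0 n).ne'
    field_simp
  have hWs : ∀ i, Tendsto (fun n => W (s i n) / W (q n)) atTop (𝓝 0) := by
    intro i
    have h1 := (hℓ.tendsto_rpow_mul_div_zero (hinv q hq0 hq) (hinv _ (hs0 i) (hslim i))
      (show 0 < 1 - α by linarith) ((hsq i).congr fun n => by
        rw [div_div_div_eq, one_mul, mul_one])).2
    refine h1.congr fun n => ?_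
    simp only [hW]
    have h2 := one_div_pos.2 (hs0 i n)
    have h3 := one_div_pos.2 (hq0 n)
    rw [Real.div_rpow h2.le h3.le, div_mul_div_comm]
  have hQs : ∀ i : Fin m, Tendsto (fun n => Q i.castSucc (s i n) / W (q n)) atTop (𝓝 0) := by
    intro i
    have h1 := (hQW i.castSucc _ (hs0 i) (hslim i)).mul (hWs i)
    rw [mul_zero] at h1
    refine h1.congr fun n => ?_
    have := (hW0 _ (hs0 i n)).ne'
    have := (hW0 _ (hq0 n)).ne'
    field_simp
  -- Left side of the renewal equation. Since `s i / q → ∞`, the first `m` series are negligible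
  -- against the last one, which alone determines the limit.
  set L : ℕ → ℝ := fun n => c₀ + (∑ i : Fin m, Q i.castSucc (s i n) + Q (Fin.last m) (q n))
    with hL
  have hLlim : Tendsto (fun n => L n / W (q n)) atTop (𝓝 (β (Fin.last m) * Γ)) := by
    have h1 : Tendsto (fun n => c₀ / W (q n)) atTop (𝓝 0) := (hWtop q hq0 hq).const_div_atTop c₀
    have h2 : Tendsto (fun n => ∑ i : Fin m, Q i.castSucc (s i n) / W (q n)) atTop
        (𝓝 (∑ _i : Fin m, 0)) := tendsto_finsetSum _ fun i _ => hQs i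
    have h3 := h1.add (h2.add (hQW (Fin.last m) q hq0 hq))
    rw [Finset.sum_const_zero, zero_add, zero_add] at h3
    refine h3.congr fun n => ?_
    simp only [hL]
    rw [add_div, add_div, Finset.sum_div]
  have hsD : ∀ i, Tendsto (fun n => s i n * W (s i n) / D n) atTop (𝓝 (lam i ^ α)) := by
    intro i
    have h1 := (hsκ i).rpow_const (p := α) (Or.inl (hlam i).ne')
    have h2 := hℓ.tendsto_div_of_tendsto_div (hinv _ (hs0 i) (hslim i)) (hinv κ hκ0 hκ)
      (inv_pos.2 (hlam i)) (((hsκ i).inv₀ (hlam i).ne').congr fun n => by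
        rw [div_div_div_eq, one_mul, mul_one, inv_div])
    have h3 := h1.mul h2
    rw [mul_one] at h3
    refine h3.congr fun n => ?_
    rw [hsW _ (hs0 i n), Real.div_rpow (hs0 i n).le (hκ0 n).le, div_mul_div_comm]
  -- Here `q / κ → 0` makes the contributions of `Y` and of the last set to the right side
  -- negligible.
  have hqD : Tendsto (fun n => q n * W (q n) / D n) atTop (𝓝 0) := by
    have h1 := (hℓ.tendsto_rpow_mul_div_zero (hinv q hq0 hq) (hinv κ hκ0 hκ) hα0
      ((hinv _ (fun n => div_pos (hq0 n) (hκ0 n)) hqκ).congr fun n => by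
        rw [div_div_div_eq, one_mul, mul_one, one_div_div])).1
    refine h1.congr fun n => ?_
    rw [hsW _ (hq0 n), div_div_div_eq, one_mul, mul_one, Real.div_rpow (hq0 n).le (hκ0 n).le,
      div_mul_div_comm]
  set P : Fin m → ℕ → ℝ := fun i n =>
    (1 - Real.exp (-s i n)) / Real.exp (-s i n) * Real.exp (-q n) with hP
  have hexp1 : ∀ t : ℝ, 0 < t → 0 ≤ 1 - Real.exp (-t) := fun t ht => by
    have : Real.exp (-t) ≤ 1 := Real.exp_le_one_iff.2 (by linarith)
    linarith
  have hP0 : ∀ i n, 0 ≤ P i n := fun i n =>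
    mul_nonneg (div_nonneg (hexp1 _ (hs0 i n)) (Real.exp_pos _).le) (Real.exp_pos _).le
  have hexplim : ∀ t : ℕ → ℝ, Tendsto t atTop (𝓝 0) →
      Tendsto (fun n => Real.exp (-t n)) atTop (𝓝 1) := fun t ht => by
    have h1 := (Real.continuous_exp.tendsto 0).comp (by simpa using ht.neg)
    rwa [Real.exp_zero] at h1
  have hPs : ∀ i, Tendsto (fun n => P i n / s i n) atTop (𝓝 1) := by
    intro i
    have h1 := ((tendsto_one_sub_exp_neg_div (hs0 i) (hslim i)).div
      (hexplim _ (hslim i)) one_ne_zero).mul (hexplim q hq)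
    rw [div_one, mul_one] at h1
    refine h1.congr fun n => ?_
    simp only [hP, Pi.div_apply]
    ring
  have hPQ : ∀ i : Fin m, Tendsto (fun n => P i n * Q i.castSucc (s i n) / D n) atTop
      (𝓝 (β i.castSucc * lam i ^ α * Γ)) := by
    intro i
    have h1 := ((hPs i).mul (hQW i.castSucc _ (hs0 i) (hslim i))).mul (hsD i)
    rw [show 1 * (β i.castSucc * Γ) * lam i ^ α = β i.castSucc * lam i ^ α * Γ by ring] at h1
    refine h1.congr fun n => ?_
    have := (hW0 _ (hs0 i n)).ne'
    have := (hs0 i n).ne'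
    have := (hD0 n).ne'
    field_simp
  -- `P Q / D` converges while `Q → ∞`.
  have hPD : ∀ i : Fin m, Tendsto (fun n => P i n / D n) atTop (𝓝 0) := by
    intro i
    have hQt := hQtop i.castSucc _ (hs0 i) (hslim i)
    refine ((hPQ i).div_atTop hQt).congr' ?_
    filter_upwards [hQt.eventually_gt_atTop 0] with n hn
    have := hn.ne'
    field_simp
  set p : ℕ → ℝ := fun n => 1 - Real.exp (-q n) with hp
  have hpQ : Tendsto (fun n => p n * Q (Fin.last m) (q n) / D n) atTop (𝓝 0) := by
    have h1 := ((tendsto_one_sub_exp_neg_div hq0 hq).mul (hQW (Fin.last m) q hq0 hq)).mul hqD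
    rw [mul_zero] at h1
    refine h1.congr fun n => ?_
    have := (hW0 _ (hq0 n)).ne'
    have := (hq0 n).ne'
    have := (hD0 n).ne'
    simp only [hp]
    field_simp
  have hpD : Tendsto (fun n => p n / D n) atTop (𝓝 0) := by
    have hQt := hQtop (Fin.last m) q hq0 hq
    refine (hpQ.div_atTop hQt).congr' ?_
    filter_upwards [hQt.eventually_gt_atTop 0] with n hn
    have := hn.ne'
    field_simp
  set Jt : ℕ → ℝ := fun n => ∑ i, β i.castSucc * lam i ^ α * J i n with hJt
  have herr : ∀ i : Fin m, Tendsto (fun n => (P i n * b i.castSucc n / D n -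
      β i.castSucc * lam i ^ α * Γ * J i n) / I n) atTop (𝓝 0) := fun i =>
    tendsto_mul_sub_div_zero_of_forall_abs_sub_le (hP0 i) hD0 hI (hPQ i) (hPD i) (hJ i) (hb i)
  have herrl : Tendsto (fun n => p n * b (Fin.last m) n / D n / I n) atTop (𝓝 0) := by
    obtain ⟨C₁, C₂, hC⟩ := hbl
    have h1 := (hpQ.const_mul C₁).add (hpD.const_mul C₂)
    rw [mul_zero, mul_zero, add_zero] at h1
    refine squeeze_zero (fun n => ?_) (fun n => ?_) h1
    · exact div_nonneg (div_nonneg (mul_nonneg (hexp1 _ (hq0 n)) (hbl0 n)) (hD0 n).le) (hI n).le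
    · rw [div_le_iff₀ (hI n)]
      have h2 := mul_le_mul_of_nonneg_left (hC n) (div_nonneg (hexp1 _ (hq0 n)) (hD0 n).le)
      calc p n * b (Fin.last m) n / D n = (1 - Real.exp (-q n)) / D n * b (Fin.last m) n := by
            simp only [hp]; ring
        _ ≤ _ := h2
        _ = _ := by simp only [hp, hQ]; ring
  have herrsum : Tendsto (fun n => p n / D n + (∑ i : Fin m, (P i n * b i.castSucc n / D n -
      β i.castSucc * lam i ^ α * Γ * J i n) / I n + p n * b (Fin.last m) n / D n / I n)) atTop
      (𝓝 0) := by
    have h1 := hpD.add ((tendsto_finsetSum Finset.univ fun i _ => herr i).add herrl)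
    rwa [Finset.sum_const_zero, zero_add, zero_add] at h1
  -- All errors so far are relative to `I`; the hypothesis `I ≤ C Jt` makes `I / Jt` bounded and
  -- converts them into errors relative to `Jt`.
  have hsq2 : Tendsto (fun n => (p n / D n + (∑ i : Fin m, (P i n * b i.castSucc n / D n -
      β i.castSucc * lam i ^ α * Γ * J i n) / I n + p n * b (Fin.last m) n / D n / I n)) *
      (I n / Jt n)) atTop (𝓝 0) := by
    have h1 := herrsum.abs.mul_const |C|
    rw [abs_zero, zero_mul] at h1
    refine squeeze_zero_norm' ?_ h1
    filter_upwards [hIJ] with n hn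
    rw [norm_mul, Real.norm_eq_abs, Real.norm_eq_abs]
    refine mul_le_mul_of_nonneg_left ?_ (abs_nonneg _)
    have hJne : Jt n ≠ 0 := fun h0 => by
      have h2 : I n ≤ C * Jt n := hn
      rw [h0, mul_zero] at h2
      exact absurd (hI n) (not_lt.2 h2)
    rw [abs_div, div_le_iff₀ (abs_pos.2 hJne), ← abs_mul, abs_of_pos (hI n)]
    exact le_trans hn (le_abs_self _)
  have hRlim : Tendsto (fun n => L n / (D n * Jt n)) atTop (𝓝 Γ) := by
    have h1 := hsq2.add_const Γ
    rw [zero_add] at h1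
    refine h1.congr' ?_
    filter_upwards [hIJ] with n hn
    have hJne : Jt n ≠ 0 := fun h0 => by
      have h2 : I n ≤ C * Jt n := hn
      rw [h0, mul_zero] at h2
      exact absurd (hI n) (not_lt.2 h2)
    have hIne := (hI n).ne'
    have hDne := (hD0 n).ne'
    have hLn : L n = p n * I n + (∑ i : Fin m, P i n * b i.castSucc n +
        p n * b (Fin.last m) n) := heq n
    have h2 : ∑ i : Fin m, (P i n * b i.castSucc n / D n -
        β i.castSucc * lam i ^ α * Γ * J i n) / I n =
        ((∑ i : Fin m, P i n * b i.castSucc n) / D n - Γ * Jt n) / I n := by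
      rw [← Finset.sum_div, Finset.sum_sub_distrib, Finset.sum_div]
      simp only [hJt]
      rw [Finset.mul_sum]
      congr 2
      exact Finset.sum_congr rfl fun i _ => by ring
    rw [h2, hLn]
    field_simp
    ring
  -- Dividing the two asymptotics of `L` cancels the common factor `Γ(2-α)`.
  have hfin := hLlim.div hRlim hΓ.ne'
  rw [mul_div_cancel_right₀ _ hΓ.ne'] at hfin
  refine hfin.congr' ?_
  filter_upwards [hIJ, hRlim.eventually_ne hΓ.ne'] with n hn hR
  have hne : L n ≠ 0 := fun h0 => hR (by rw [h0, zero_div])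
  have hJne : Jt n ≠ 0 := fun h0 => hR (by rw [h0, mul_zero, div_zero])
  have hDne := (hD0 n).ne'
  have hWne := (hW0 _ (hq0 n)).ne'
  simp only [Pi.div_apply]
  change L n / W (q n) / (L n / (D n * Jt n)) = Jt n * D n / W (q n)
  field_simp

end RenewalAsymptotics

/-! ### The weight encoding the occupation times -/

section OrbitWeight

variable {X : Type*} {m : ℕ} (A : Fin (m + 1) → Set X) (lam : Fin m → ℝ)

/-- The function equal to `lam i` on the `i`-th set, for all but the last set. -/
noncomputable def occupationRate (x : X) : ℝ :=
  ∑ i : Fin m, lam i * (A i.castSucc).indicator 1 x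

/-- The discount factor `exp (-(q + κ r))`, where `r` is the occupation rate. -/
noncomputable def orbitWeight (q κ : ℝ) (x : X) : ℝ :=
  Real.exp (-(q + κ * occupationRate A lam x))

variable {A lam}

theorem occupationTime_eq_sum_range (T : X → X) (S : Set X) (n : ℕ) (x : X) :
    occupationTime T S n x = ∑ k ∈ Finset.range n, S.indicator 1 (T^[k + 1] x) := by
  unfold occupationTime
  induction n with
  | zero => simp
  | succ n ih => rw [Finset.sum_Icc_succ_top (by omega), ih, Finset.sum_range_succ]

/-- Products start at `T x`, in agreement with occupation times counted from `k = 1`. The discounted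
sum is therefore a generating function in `n` of the Laplace transforms. -/
theorem prod_orbitWeight (T : X → X) (q κ : ℝ) (n : ℕ) (x : X) :
    ∏ k ∈ Finset.range n, orbitWeight A lam q κ (T^[k + 1] x) =
      Real.exp (-(q * n)) *
        Real.exp (-(κ * ∑ i : Fin m, lam i * occupationTime T (A i.castSucc) n x)) := by
  unfold orbitWeight occupationRate
  rw [← Real.exp_sum, ← Real.exp_add]
  congr 1
  simp only [occupationTime_eq_sum_range, Finset.mul_sum (Finset.range n)]
  rw [Finset.sum_comm (s := Finset.univ), Finset.sum_neg_distrib, Finset.sum_add_distrib,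
    ← Finset.mul_sum, Finset.sum_const, Finset.card_range, nsmul_eq_mul]
  ring

theorem occupationRate_nonneg (hlam : ∀ i, 0 < lam i) (x : X) : 0 ≤ occupationRate A lam x :=
  Finset.sum_nonneg fun i _ =>
    mul_nonneg (hlam i).le (Set.indicator_nonneg (fun _ _ => zero_le_one) x)

theorem occupationRate_le (hlam : ∀ i, 0 < lam i) (x : X) :
    occupationRate A lam x ≤ ∑ i, lam i :=
  Finset.sum_le_sum fun i _ => mul_le_of_le_one_right (hlam i).le
    (Set.indicator_le_self' (fun _ _ => zero_le_one) x)

theorem occupationRate_of_mem (hAA : Pairwise fun i j => Disjoint (A i) (A j)) (i : Fin (m + 1))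
    {x : X} (hx : x ∈ A i) :
    occupationRate A lam x = (Fin.snoc lam 0 : Fin (m + 1) → ℝ) i := by
  unfold occupationRate
  have hne : ∀ j, j ≠ i → x ∉ A j := fun j hj hxj =>
    Set.disjoint_left.1 (hAA hj) hxj hx
  refine Fin.lastCases ?_ (fun i => ?_) i (motive := fun i => x ∈ A i → (∀ j, j ≠ i → x ∉ A j) →
    ∑ i : Fin m, lam i * (A i.castSucc).indicator 1 x = (Fin.snoc lam 0 : Fin (m + 1) → ℝ) i)
    hx hne
  · intro _ h
    rw [Fin.snoc_last]
    refine Finset.sum_eq_zero fun j _ => ?_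
    rw [Set.indicator_of_notMem (h _ (Fin.castSucc_lt_last j).ne), mul_zero]
  · intro hxi h
    rw [Fin.snoc_castSucc, Finset.sum_eq_single i]
    · rw [Set.indicator_of_mem hxi, Pi.one_apply, mul_one]
    · intro j _ hj
      rw [Set.indicator_of_notMem (h _ fun h' => hj (Fin.castSucc_injective m h')), mul_zero]
    · simp

theorem occupationRate_of_mem_of_disjoint {Y : Set X} (hYA : ∀ i, Disjoint Y (A i)) {x : X}
    (hx : x ∈ Y) : occupationRate A lam x = 0 :=
  Finset.sum_eq_zero fun i _ => by
    rw [Set.indicator_of_notMem (Set.disjoint_left.1 (hYA _) hx), mul_zero]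

theorem measurable_orbitWeight [MeasurableSpace X] (hA : ∀ i, MeasurableSet (A i)) (q κ : ℝ) :
    Measurable (orbitWeight A lam q κ) := by
  have h1 : Measurable (occupationRate A lam) :=
    Finset.measurable_fun_sum _ fun i _ => (measurable_one.indicator (hA _)).const_mul _
  unfold orbitWeight
  fun_prop

theorem orbitWeight_le (hlam : ∀ i, 0 < lam i) {q κ : ℝ} (hκ : 0 ≤ κ) (x : X) :
    orbitWeight A lam q κ x ≤ Real.exp (-q) :=
  Real.exp_le_exp.2 (by have := mul_nonneg hκ (occupationRate_nonneg (A := A) hlam x); linarith)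

/-- The recursion gives `V x ≥ v (T x) V (T x)`, and `v ≥ e⁻¹` for small rates. This supplies the
growth condition of the sweeping estimate with a constant independent of the rates. -/
theorem discountedSum_comp_le (hlam : ∀ i, 0 < lam i) (T : X → X) {q κ : ℝ} (hq : 0 < q)
    (hκ : 0 ≤ κ) (h1 : q + κ * ∑ i, lam i ≤ 1) (x : X) :
    discountedSum T (orbitWeight A lam q κ) (T x) ≤
      Real.exp 1 * discountedSum T (orbitWeight A lam q κ) x := by
  have hv0 : ∀ x, 0 < orbitWeight A lam q κ x := fun _ => Real.exp_pos _
  have hθ : Real.exp (-q) < 1 := Real.exp_lt_one_iff.2 (by linarith)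
  have h2 := discountedSum_eq hv0 (orbitWeight_le hlam hκ) hθ (T := T) x
  have h3 : Real.exp (-1) ≤ orbitWeight A lam q κ (T x) := by
    refine Real.exp_le_exp.2 ?_
    have := mul_le_mul_of_nonneg_left (occupationRate_le (A := A) hlam (T x)) hκ
    linarith
  have h4 := mul_le_mul_of_nonneg_right h3 (discountedSum_nonneg (T := T) hv0 (T x))
  calc discountedSum T (orbitWeight A lam q κ) (T x)
      = Real.exp 1 * (Real.exp (-1) * discountedSum T (orbitWeight A lam q κ) (T x)) := by
        rw [← mul_assoc, ← Real.exp_add, add_neg_cancel, Real.exp_zero, one_mul]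
    _ ≤ Real.exp 1 * discountedSum T (orbitWeight A lam q κ) x := by
        refine mul_le_mul_of_nonneg_left ?_ (Real.exp_pos _).le
        linarith

theorem integral_mul_discountedSum [MeasurableSpace X] {μ : Measure X} {T : X → X}
    (hT : Measurable T) (hA : ∀ i, MeasurableSet (A i)) (hlam : ∀ i, 0 < lam i) {q κ : ℝ}
    (hq : 0 < q) (hκ : 0 ≤ κ) {G : X → ℝ} (hG : Integrable G μ) :
    ∫ x, G x * discountedSum T (orbitWeight A lam q κ) x ∂μ =
      ∑' n : ℕ, Real.exp (-(q * n)) * ∫ x, G x *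
        Real.exp (-(κ * ∑ i : Fin m, lam i * occupationTime T (A i.castSucc) n x)) ∂μ := by
  have hv0 : ∀ x, 0 < orbitWeight A lam q κ x := fun _ => Real.exp_pos _
  have hvθ : ∀ x, orbitWeight A lam q κ x ≤ Real.exp (-q) := orbitWeight_le hlam hκ
  have hθ : Real.exp (-q) < 1 := Real.exp_lt_one_iff.2 (by linarith)
  set F : ℕ → X → ℝ := fun n x =>
    G x * ∏ k ∈ Finset.range n, orbitWeight A lam q κ (T^[k + 1] x) with hF
  have hpm : ∀ n, Measurable fun x =>
      ∏ k ∈ Finset.range n, orbitWeight A lam q κ (T^[k + 1] x) := fun n =>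
    Finset.measurable_fun_prod _ fun k _ =>
      (measurable_orbitWeight hA q κ).comp (hT.iterate (k + 1))
  have hpb : ∀ n x, ‖∏ k ∈ Finset.range n, orbitWeight A lam q κ (T^[k + 1] x)‖ ≤
      Real.exp (-q) ^ n := fun n x => by
    rw [Real.norm_of_nonneg (Finset.prod_nonneg fun _ _ => (hv0 _).le)]
    exact prod_orbit_le_pow hv0 hvθ n x
  have hFi : ∀ n, Integrable (F n) μ := fun n =>
    hG.mul_bdd (hpm n).aestronglyMeasurable (ae_of_all _ (hpb n))
  have hsum : Summable fun n => ∫ x, ‖F n x‖ ∂μ := by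
    refine ((summable_geometric_of_lt_one (Real.exp_pos _).le hθ).mul_right
      (∫ x, ‖G x‖ ∂μ)).of_nonneg_of_le (fun n => integral_nonneg fun x => norm_nonneg _) fun n => ?_
    rw [← integral_const_mul]
    refine integral_mono (hFi n).norm (hG.norm.const_mul _) fun x => ?_
    simp only [hF]
    rw [norm_mul, mul_comm]
    exact mul_le_mul_of_nonneg_right (hpb n x) (norm_nonneg _)
  have h1 := integral_tsum_of_summable_integral_norm hFi hsum
  have h2 : ∀ x, G x * discountedSum T (orbitWeight A lam q κ) x = ∑' n, F n x := fun x => by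
    rw [discountedSum, ← tsum_mul_left]
  simp only [h2]
  rw [← h1]
  refine tsum_congr fun n => ?_
  rw [← integral_const_mul]
  refine integral_congr_ae (ae_of_all _ fun x => ?_)
  simp only [hF]
  rw [prod_orbitWeight]
  ring

end OrbitWeight

/-! ### The double Laplace transform of the occupation times -/

section Main

variable {X : Type*} [MeasurableSpace X] {μ : Measure X} [SigmaFinite μ] {T : X → X}
  {m : ℕ} {Y : Set X} {A : Fin (m + 1) → Set X}

/-- Asymptotics of the double Laplace transform of the weighted occupation times. -/
theorem tendsto_integral_mul_discountedSum (hT : Conservative T μ) (hTm : MeasurePreserving T μ μ)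
    (hm : 1 ≤ m) (hY : MeasurableSet Y) (hA : ∀ i, MeasurableSet (A i))
    (hYA : ∀ i, Disjoint Y (A i)) (hAA : Pairwise fun i j => Disjoint (A i) (A j))
    (hX : Y ∪ ⋃ i, A i = Set.univ) (hY_pos : 0 < μ Y) (hY_fin : μ Y < ∞)
    (hsep : DynamicallySeparates T A) {α : ℝ} (hα : α ∈ Set.Ioo (0 : ℝ) 1)
    {β : Fin (m + 1) → ℝ} (hβ : ∀ i, 0 < β i) {ℓ : ℝ → ℝ} (hℓ : SlowlyVaryingAtInfty ℓ)
    (hw : ∀ i, (fun n : ℕ => (wanderingRate μ T Y (A i) n).toReal)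
      ~[atTop] (fun n : ℕ => β i * (n : ℝ) ^ (1 - α) * ℓ n))
    (hbdd : ∃ C : ℝ≥0, ∀ n : ℕ, 2 ≤ n →
      eLpNorm (entranceAverage μ T Y (A (Fin.last m)) n) ∞ μ ≤ C)
    (hsweep : ∃ N : ℕ, 2 ≤ N ∧ UniformlySweeping μ T
      {F | ∃ n : ℕ, N ≤ n ∧ ∃ i : Fin m, F = entranceAverage μ T Y (A i.castSucc) n}
      (Y.indicator 1))
    {H : Fin m → X → ℝ} (hH : ∀ i, MemLp (H i) ∞ μ)
    (hlim : ∀ i : Fin m, Tendsto (fun n : ℕ =>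
      eLpNorm (fun x => (entranceAverage μ T Y (A i.castSucc) n x).toReal - H i x) ∞ μ)
      atTop (𝓝 0))
    {lam : Fin m → ℝ} (hlam : ∀ i, 0 < lam i) {q κ : ℕ → ℝ} (hq0 : ∀ n, 0 < q n)
    (hκ0 : ∀ n, 0 < κ n) (hq : Tendsto q atTop (𝓝 0)) (hκ : Tendsto κ atTop (𝓝 0))
    (hqκ : Tendsto (fun n => q n / κ n) atTop (𝓝 0)) :
    Tendsto (fun n => (∑ i, β i.castSucc * lam i ^ α *
        ∫ x, H i x * discountedSum T (orbitWeight A lam (q n) (κ n)) x ∂μ) *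
        (κ n ^ α * ℓ (1 / κ n)) / ((1 / q n) ^ (1 - α) * ℓ (1 / q n)))
      atTop (𝓝 (β (Fin.last m))) := by
  set V : ℕ → X → ℝ := fun n => discountedSum T (orbitWeight A lam (q n) (κ n)) with hV
  have hv0 : ∀ n x, 0 < orbitWeight A lam (q n) (κ n) x := fun _ _ => Real.exp_pos _
  have hvθ : ∀ n x, orbitWeight A lam (q n) (κ n) x ≤ Real.exp (-q n) := fun n =>
    orbitWeight_le hlam (hκ0 n).le
  have hθ : ∀ n, Real.exp (-q n) < 1 := fun n => Real.exp_lt_one_iff.2 (by linarith [hq0 n])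
  have hvm : ∀ n, Measurable (orbitWeight A lam (q n) (κ n)) := fun n =>
    measurable_orbitWeight hA _ _
  have hVm : ∀ n, Measurable (V n) := fun n =>
    measurable_discountedSum (hv0 n) (hvθ n) (hθ n) hTm.measurable (hvm n)
  have hV0 : ∀ n x, 0 ≤ V n x := fun n => discountedSum_nonneg (hv0 n)
  have hVM : ∀ n x, V n x ≤ (1 - Real.exp (-q n))⁻¹ := fun n =>
    discountedSum_le (hv0 n) (hvθ n) (hθ n)
  have hV1 : ∀ n x, 1 ≤ V n x := fun n => one_le_discountedSum (hv0 n) (hvθ n) (hθ n)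
  have hVint : ∀ n, IntegrableOn (V n) Y μ := fun n =>
    IntegrableOn.of_bound hY_fin (hVm n).aestronglyMeasurable _
      (ae_of_all _ fun x => (Real.norm_of_nonneg (hV0 n x)).trans_le (hVM n x))
  have hwne : ∀ i, ∀ᶠ n in atTop, wanderingRate μ T Y (A i) n ≠ 0 := by
    intro i
    have hne : ∀ᶠ n : ℕ in atTop, β i * (n : ℝ) ^ (1 - α) * ℓ n ≠ 0 := by
      filter_upwards [eventually_gt_atTop 0] with n hn
      have hn' : (0 : ℝ) < n := by exact_mod_cast hn
      have := hℓ.pos n hn'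
      have := hβ i
      positivity
    filter_upwards [((isEquivalent_iff_tendsto_one hne).1 (hw i)).eventually_ne one_ne_zero]
      with n hn h0
    exact hn (by simp [h0])
  have hentY : ∀ i n, ∀ᵐ x ∂μ, x ∉ Y → (entranceAverage μ T Y (A i) n x).toReal = 0 :=
    fun i n => by
      filter_upwards [entranceAverage_ae_eq_zero hTm hY (hA i) n] with x hx hxY
      rw [hx hxY, ENNReal.toReal_zero]
  have hHY : ∀ i, ∀ᵐ x ∂μ, x ∉ Y → H i x = 0 := fun i =>
    ae_eq_zero_of_tendsto_eLpNorm_top (hlim i) (hentY i.castSucc)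
  have hH0 : ∀ i, ∀ᵐ x ∂μ, 0 ≤ H i x := fun i =>
    ae_nonneg_of_tendsto_eLpNorm_top (hlim i) fun n x => ENNReal.toReal_nonneg
  choose B hB using fun i => exists_ae_abs_le_of_memLp_top (hH i)
  set I : ℕ → ℝ := fun n => ∫ x in Y, V n x ∂μ with hI
  set J : Fin m → ℕ → ℝ := fun i n => ∫ x, H i x * V n x ∂μ with hJ
  have hI0 : ∀ n, 0 < I n := by
    intro n
    have h1 : μ.real Y ≤ I n := by
      have := setIntegral_mono (μ := μ) (s := Y) (integrableOn_const hY_fin.ne (C := (1 : ℝ)))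
        (hVint n) (fun x => hV1 n x)
      simpa using this
    exact (ENNReal.toReal_pos hY_pos.ne' hY_fin.ne).trans_le h1
  have hJ0 : ∀ i n, 0 ≤ J i n := fun i n => integral_nonneg_of_ae (by
    filter_upwards [hH0 i] with x hx
    exact mul_nonneg hx (hV0 n x))
  have hJI : ∀ i n, |J i n| ≤ (∑ j, |B j|) * I n := by
    intro i n
    refine (abs_integral_mul_le_of_ae_eq_zero hY hY_fin (hB i) (hHY i) (hVm n) (hV0 n)
      (hVM n)).trans (mul_le_mul_of_nonneg_right ?_ (hI0 n).le)
    exact (le_abs_self _).trans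
      (Finset.single_le_sum (f := fun j => |B j|) (fun j _ => abs_nonneg _) (Finset.mem_univ i))
  -- One index is enough for the sweeping bound, since all the terms `J i` are nonnegative.
  set i₀ : Fin m := ⟨0, hm⟩ with hi₀
  have hc0 : ∀ i : Fin m, 0 < β i.castSucc * lam i ^ α := fun i =>
    mul_pos (hβ _) (Real.rpow_pos_of_pos (hlam i) _)
  have hIJ : ∃ C, ∀ᶠ n in atTop, I n ≤ C * ∑ i, β i.castSucc * lam i ^ α * J i n := by
    obtain ⟨N, -, hN⟩ := hsweep
    obtain ⟨C, hC0, hC⟩ := setIntegral_le_of_uniformlySweeping hTm hY hY_fin (hA i₀.castSucc)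
      (hH i₀) (hlim i₀) hN (fun n hn => ⟨n, hn, i₀, rfl⟩) (Real.exp_pos 1)
    refine ⟨C / (β i₀.castSucc * lam i₀ ^ α), ?_⟩
    have h1 : Tendsto (fun n => q n + κ n * ∑ i, lam i) atTop (𝓝 0) := by
      simpa using hq.add (hκ.mul_const (∑ i, lam i))
    filter_upwards [h1.eventually_le_const one_pos] with n hn
    have h2 := hC (V n) (hVm n) (hV0 n) _ (hVM n)
      (discountedSum_comp_le hlam T (hq0 n) (hκ0 n).le hn)
    refine h2.trans ?_
    rw [div_mul_eq_mul_div, le_div_iff₀ (hc0 i₀), mul_assoc]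
    refine mul_le_mul_of_nonneg_left ?_ hC0.le
    rw [mul_comm]
    exact Finset.single_le_sum (f := fun i => β i.castSucc * lam i ^ α * J i n)
      (fun i _ => mul_nonneg (hc0 i).le (hJ0 i n)) (Finset.mem_univ i₀)
  obtain ⟨C, hIJ⟩ := hIJ
  -- The last set has rate `0`, so its discount is `e^{-q}`, the same as on `Y`.
  set rate : Fin (m + 1) → ℝ := Fin.snoc lam 0 with hrate
  have hrate0 : ∀ i, 0 ≤ rate i := by
    refine Fin.lastCases ?_ fun i => ?_
    · simp [hrate]
    · rw [hrate, Fin.snoc_castSucc]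
      exact (hlam i).le
  have hs0 : ∀ i n, 0 < q n + κ n * rate i := fun i n =>
    add_pos_of_pos_of_nonneg (hq0 n) (mul_nonneg (hκ0 n).le (hrate0 i))
  have hz1 : ∀ i n, Real.exp (-(q n + κ n * rate i)) < 1 := fun i n =>
    Real.exp_lt_one_iff.2 (by linarith [hs0 i n])
  set a : Fin (m + 1) → ℕ → ℝ := fun i k => μ.real (firstVisitSet T Y k ∩ A i) with ha
  set b : Fin (m + 1) → ℕ → ℝ := fun i n => ∑' k, Real.exp (-(q n + κ n * rate i)) ^ k *
    ∫ x in firstVisitSet T Y k ∩ A i, V n (T^[k] x) ∂μ with hb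
  refine tendsto_of_renewal_equation hℓ hα (a := a) (Ba := μ.real Y) (fun i k =>
    ⟨measureReal_nonneg, measureReal_firstVisitSet_inter_le hTm hY hY_fin k⟩) hβ (fun i => ?_)
    hlam hq0 hκ0 hq hκ hqκ (I := I) (b := b) (c₀ := μ.real Y) hI0 hJI hIJ (fun i ε hε => ?_)
    (fun n => ?_) ?_ (fun n => ?_)
  · refine (hw i).congr_left (Eventually.of_forall fun n => ?_)
    exact toReal_wanderingRate_eq_sum hTm hY hY_fin (hA i) n
  · obtain ⟨C', hC'⟩ := abs_tsum_setIntegral_sub_le hTm hY hY_fin (hA i.castSucc)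
      (hwne i.castSucc) (hH i) (hlim i) (hB i) hε
    refine ⟨C', fun n => ?_⟩
    have h1 := hC' (V n) (hVm n) (hV0 n) _ (hVM n) _ (Real.exp_pos _).le (hz1 i.castSucc n)
    simp only [hrate, Fin.snoc_castSucc] at h1
    simp only [hb, hrate, Fin.snoc_castSucc]
    exact h1
  · exact tsum_nonneg fun k => mul_nonneg (pow_nonneg (Real.exp_pos _).le k)
      (integral_nonneg fun x => hV0 n _)
  · obtain ⟨B', hB'⟩ := hbdd
    obtain ⟨C', hC'⟩ := tsum_setIntegral_le_of_bounded hTm hY hY_fin (hA (Fin.last m))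
      (hwne (Fin.last m)) hB'
    refine ⟨B', C', fun n => ?_⟩
    have h1 := hC' (V n) (hVm n) (hV0 n) _ (hVM n) _ (Real.exp_pos _).le (hz1 (Fin.last m) n)
    simp only [hrate, Fin.snoc_last, mul_zero, add_zero] at h1
    simp only [hb, hrate, Fin.snoc_last, mul_zero, add_zero]
    exact h1
  · have h1 := measureReal_add_sum_tsum_eq hT hTm hY hY_fin hA hYA hAA hX hsep (hvm n) (hv0 n)
      (hvθ n) (hθ n) (y := Real.exp (-q n)) (z := fun i => Real.exp (-(q n + κ n * rate i)))
      (fun i => Real.exp_pos _) (fun i => hz1 i n)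
      (fun x hx => by
        rw [orbitWeight, occupationRate_of_mem_of_disjoint hYA hx, mul_zero, add_zero])
      (fun i x hx => by rw [orbitWeight, occupationRate_of_mem hAA i hx])
    rw [Fin.sum_univ_castSucc, Fin.sum_univ_castSucc] at h1
    simp only [hrate, Fin.snoc_castSucc, Fin.snoc_last, mul_zero, add_zero] at h1
    rw [div_mul_cancel₀ _ (Real.exp_pos _).ne'] at h1
    simp only [hb, hrate, Fin.snoc_castSucc, Fin.snoc_last, mul_zero, add_zero]
    exact h1

end Main

/-! ### Inversion of the double Laplace transform -/

theorem integral_withDensity_ofReal {X : Type*} [MeasurableSpace X] {μ : Measure X} {G : X → ℝ}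
    (hG : AEMeasurable G μ) (hG0 : ∀ᵐ x ∂μ, 0 ≤ G x) (f : X → ℝ) :
    ∫ x, f x ∂(μ.withDensity fun x => ENNReal.ofReal (G x)) = ∫ x, G x * f x ∂μ := by
  rw [integral_withDensity_eq_integral_toReal_smul₀ hG.ennreal_ofReal
    (ae_of_all _ fun _ => ENNReal.ofReal_lt_top)]
  refine integral_congr_ae ?_
  filter_upwards [hG0] with x hx
  rw [ENNReal.toReal_ofReal hx, smul_eq_mul]

/-- The scaling limit at a single time of a family of non-decreasing processes is determined by
the asymptotics of the double Laplace transform. -/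
theorem tendsto_setIntegral_le_of_tendsto_double_laplace {X : Type*} [MeasurableSpace X]
    {μ : Measure X} {G : X → ℝ} (hG : Integrable G μ) (hG0 : ∀ᵐ x ∂μ, 0 ≤ G x)
    {R : ℕ → X → ℝ} (hR : ∀ k, Measurable (R k)) (hR0 : ∀ k x, 0 ≤ R k x)
    (hRmono : ∀ x, Monotone fun k => R k x) {r g : ℕ → ℝ} (hr : ∀ n, 0 < r n)
    (hg : ∀ n, 0 < g n) {α b : ℝ} (hα : α ∈ Set.Ioo (0 : ℝ) 1) (hb : 0 ≤ b)
    (hlim : ∀ q κ : ℝ, 0 < q → 0 < κ → Tendsto (fun n : ℕ => 1 / (n : ℝ) *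
      ∑' k : ℕ, Real.exp (-(q / n * k)) * ((∫ x, G x * Real.exp (-(κ / r n * R k x)) ∂μ) / g n))
      atTop (𝓝 (b * κ ^ (-α) * q ^ (-(1 - α))))) :
    Tendsto (fun n => (∫ x in {x | R n x / r n ≤ 1}, G x ∂μ) / g n) atTop
      (𝓝 (b * (Real.sin (Real.pi * α) / (Real.pi * α)))) := by
  obtain ⟨hα0, hα1⟩ := hα
  have hexpb : ∀ κ : ℝ, 0 < κ → ∀ n k x, ‖Real.exp (-(κ / r n * R k x))‖ ≤ 1 := by
    intro κ hκ n k x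
    rw [Real.norm_of_nonneg (Real.exp_pos _).le, Real.exp_le_one_iff, neg_nonpos]
    exact mul_nonneg (div_pos hκ (hr n)).le (hR0 k x)
  have hint : ∀ κ : ℝ, 0 < κ → ∀ n k,
      Integrable (fun x => G x * Real.exp (-(κ / r n * R k x))) μ := fun κ hκ n k =>
    hG.mul_bdd (c := 1) (by have := hR k; fun_prop) (ae_of_all _ (hexpb κ hκ n k))
  -- Inversion in time for fixed `κ`: the integrals decrease in `k` because `R` increases, so the
  -- monotone density theorem applies with exponent `1 - α`.
  have hdiag : ∀ κ : ℝ, 0 < κ → Tendsto (fun n =>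
      (∫ x, G x * Real.exp (-(κ / r n * R n x)) ∂μ) / g n) atTop
      (𝓝 (b * κ ^ (-α) / Real.Gamma (1 - α))) := by
    intro κ hκ
    refine tendsto_diagonal_of_antitone_of_tendsto_laplace
      (u := fun n k => (∫ x, G x * Real.exp (-(κ / r n * R k x)) ∂μ) / g n)
      (fun n k => div_nonneg (integral_nonneg_of_ae ?_) (hg n).le) (fun n j k hjk => ?_)
      (by linarith) (mul_nonneg hb (Real.rpow_nonneg hκ.le _)) fun q hq => hlim q κ hq hκ
    · filter_upwards [hG0] with x hx
      exact mul_nonneg hx (Real.exp_pos _).le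
    · refine div_le_div_of_nonneg_right ?_ (hg n).le
      refine integral_mono_ae (hint κ hκ n k) (hint κ hκ n j) ?_
      filter_upwards [hG0] with x hx
      refine mul_le_mul_of_nonneg_left (Real.exp_le_exp.2 (neg_le_neg ?_)) hx
      exact mul_le_mul_of_nonneg_left (hRmono x hjk) (div_pos hκ (hr n)).le
  have hGn : ∀ n, AEMeasurable (fun x => G x / g n) μ := fun n => hG.1.aemeasurable.div_const _
  have hGn0 : ∀ n, ∀ᵐ x ∂μ, 0 ≤ G x / g n := fun n => by
    filter_upwards [hG0] with x hx
    exact div_nonneg hx (hg n).le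
  have hfin : ∀ n, IsFiniteMeasure (μ.withDensity fun x => ENNReal.ofReal (G x / g n)) := fun n =>
    isFiniteMeasure_withDensity_ofReal (hG.div_const _).2
  -- Inversion in space: under the measures with density `G / g n`, the variables `R n / r n` have
  -- Laplace transforms converging to a multiple of `κ^{-α}`.
  have hfinal := tendsto_measureReal_le_one_of_tendsto_laplace (l := atTop)
    (P := fun n => μ.withDensity fun x => ENNReal.ofReal (G x / g n))
    (Z := fun n x => R n x / r n) (ρ := α) (C := b / Real.Gamma (1 - α)) hα0
    (div_nonneg hb (Real.Gamma_pos_of_pos (by linarith)).le) (fun n => (hR n).div_const _)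
    (fun n x => div_nonneg (hR0 n x) (hr n).le)
    (fun n => by
      have := hfin n
      refine Integrable.of_bound (by have := hR n; fun_prop) 1 (ae_of_all _ fun x => ?_)
      rw [Real.norm_of_nonneg (Real.exp_pos _).le, Real.exp_le_one_iff, neg_nonpos]
      exact div_nonneg (hR0 n x) (hr n).le)
    (fun κ hκ => by
      have h1 := hdiag κ hκ
      rw [mul_div_right_comm] at h1
      refine h1.congr fun n => ?_
      rw [integral_withDensity_ofReal (hGn n) (hGn0 n), ← integral_div]
      refine integral_congr_ae (ae_of_all _ fun x => ?_)
      simp only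
      rw [show κ / r n * R n x = κ * (R n x / r n) by ring]
      ring)
  -- Euler's reflection formula together with `Γ(1+α) = α Γ(α)`.
  have hconst : b / Real.Gamma (1 - α) / Real.Gamma (1 + α) =
      b * (Real.sin (Real.pi * α) / (Real.pi * α)) := by
    have h1 := Real.Gamma_mul_Gamma_one_sub α
    have hs : 0 < Real.sin (Real.pi * α) :=
      Real.sin_pos_of_pos_of_lt_pi (by positivity) (by nlinarith [Real.pi_pos])
    have hp := Real.pi_pos
    have hΓ1 : 0 < Real.Gamma α := Real.Gamma_pos_of_pos hα0
    have hΓ2 : 0 < Real.Gamma (1 - α) := Real.Gamma_pos_of_pos (by linarith)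
    rw [add_comm 1 α, Real.Gamma_add_one hα0.ne']
    rw [eq_div_iff hs.ne'] at h1
    rw [mul_comm Real.pi α] at h1 hs ⊢
    field_simp
    linear_combination (-b) * h1
  rw [hconst] at hfinal
  refine hfinal.congr fun n => ?_
  have hS : MeasurableSet {x | R n x / r n ≤ 1} :=
    measurableSet_le ((hR n).div_const _) measurable_const
  rw [measureReal_def, withDensity_apply _ hS, ← integral_div,
    integral_eq_lintegral_of_nonneg_ae (ae_restrict_of_ae (hGn0 n))
      (hGn n).aestronglyMeasurable.restrict]

/-- At the rates `q/N` and `κ/(cN)` all powers of `N` cancel after division by `N`, and slow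
variation removes the constants `q` and `κ` from the arguments of `ℓ`. -/
theorem tendsto_scale_ratio {ℓ : ℝ → ℝ} (hℓ : SlowlyVaryingAtInfty ℓ) {α : ℝ} {N c : ℕ → ℝ}
    (hN0 : ∀ n, 0 < N n) (hc0 : ∀ n, 0 < c n) (hN : Tendsto N atTop atTop)
    (hcN : Tendsto (fun n => c n * N n) atTop atTop) {q κ : ℝ} (hq : 0 < q) (hκ : 0 < κ) :
    Tendsto (fun n => ((1 / (q / N n)) ^ (1 - α) * ℓ (1 / (q / N n))) /
      ((κ / (c n * N n)) ^ α * ℓ (1 / (κ / (c n * N n)))) /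
      (N n * (c n ^ α * ℓ (N n) / ℓ (c n * N n)))) atTop (𝓝 (κ ^ (-α) * q ^ (-(1 - α)))) := by
  have h1 : Tendsto (fun n => ℓ (N n / q) / ℓ (N n)) atTop (𝓝 1) := by
    refine hℓ.tendsto_div_of_tendsto_div (hN.atTop_div_const hq) hN (inv_pos.2 hq)
      (tendsto_const_nhds.congr fun n => ?_)
    have := (hN0 n).ne'
    field_simp
  have h2 : Tendsto (fun n => ℓ (c n * N n) / ℓ (c n * N n / κ)) atTop (𝓝 1) := by
    refine hℓ.tendsto_div_of_tendsto_div hcN (hcN.atTop_div_const hκ) hκ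
      (tendsto_const_nhds.congr fun n => ?_)
    have := (hN0 n).ne'
    have := (hc0 n).ne'
    field_simp
  have h3 := (h1.mul h2).const_mul (κ ^ (-α) * q ^ (-(1 - α)))
  rw [mul_one, mul_one] at h3
  refine h3.congr fun n => ?_
  have hn := hN0 n
  have hc := hc0 n
  have e1 : (N n / q) ^ (1 - α) = N n * (N n ^ α)⁻¹ * q ^ (-(1 - α)) := by
    rw [Real.div_rpow hn.le hq.le, Real.rpow_sub hn, Real.rpow_one, Real.rpow_neg hq.le,
      div_eq_mul_inv, div_eq_mul_inv]
  have e2 : (κ / (c n * N n)) ^ α = (κ ^ (-α))⁻¹ * (c n ^ α * N n ^ α)⁻¹ := by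
    rw [Real.div_rpow hκ.le (by positivity), Real.mul_rpow hc.le hn.le, Real.rpow_neg hκ.le,
      inv_inv, div_eq_mul_inv]
  rw [one_div_div, one_div_div, e1, e2]
  have := hℓ.pos _ hn
  have := hℓ.pos _ (mul_pos hc hn)
  have := hℓ.pos _ (div_pos (mul_pos hc hn) hκ)
  have := hℓ.pos _ (div_pos hn hq)
  have := Real.rpow_pos_of_pos hn α
  have := Real.rpow_pos_of_pos hc α
  have := Real.rpow_pos_of_pos hκ (-α)
  have := Real.rpow_pos_of_pos hq (-(1 - α))
  field_simp

end InfiniteErgodic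

/-! ### The theorem -/

/-- Here `d = m + 1 ≥ 2`; the sets `A_1, …, A_{d-1}` are `A i.castSucc` for `i : Fin m`, and `A_d`
is `A (Fin.last m)`. -/
theorem mainTheorem3 {X : Type*} [MeasurableSpace X] (μ : Measure X) [SigmaFinite μ]
    (T : X → X) (hT_cons : Conservative T μ) (hT_erg : Ergodic T μ)
    (m : ℕ) (hm : 1 ≤ m) (Y : Set X) (A : Fin (m + 1) → Set X)
    (hY : MeasurableSet Y) (hA : ∀ i, MeasurableSet (A i))
    (hYA : ∀ i, Disjoint Y (A i)) (hAA : Pairwise (fun i j => Disjoint (A i) (A j)))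
    (hX : Y ∪ ⋃ i, A i = Set.univ)
    (hY_pos : 0 < μ Y) (hY_fin : μ Y < ∞) (hA_inf : ∀ i, μ (A i) = ∞)
    (hsep : InfiniteErgodic.DynamicallySeparates T A)
    (α : ℝ) (hα : α ∈ Set.Ioo (0 : ℝ) 1)
    (β : Fin (m + 1) → ℝ) (hβ : ∀ i, β i ∈ Set.Ioo (0 : ℝ) 1) (hβ_sum : ∑ i, β i = 1)
    (ℓ : ℝ → ℝ) (hℓ : InfiniteErgodic.SlowlyVaryingAtInfty ℓ)
    (hw : ∀ i, (fun n : ℕ => (InfiniteErgodic.wanderingRate μ T Y (A i) n).toReal)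
      ~[atTop] (fun n : ℕ => β i * (n : ℝ) ^ (1 - α) * ℓ n))
    (hbdd : ∃ C : ℝ≥0, ∀ n : ℕ, 2 ≤ n →
      eLpNorm (InfiniteErgodic.entranceAverage μ T Y (A (Fin.last m)) n) ∞ μ ≤ C)
    (hsweep : ∃ N : ℕ, 2 ≤ N ∧ InfiniteErgodic.UniformlySweeping μ T
      {F | ∃ n : ℕ, N ≤ n ∧ ∃ i : Fin m,
        F = InfiniteErgodic.entranceAverage μ T Y (A i.castSucc) n}
      (Y.indicator 1))
    (H : Fin m → X → ℝ) (hH : ∀ i, MemLp (H i) ∞ μ)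
    (hH_lim : ∀ i : Fin m, Tendsto (fun n : ℕ =>
      eLpNorm (fun x => (InfiniteErgodic.entranceAverage μ T Y (A i.castSucc) n x).toReal - H i x)
        ∞ μ) atTop (𝓝 0))
    (lam : Fin m → ℝ) (hlam : ∀ i, 0 < lam i)
    (c : ℕ → ℝ) (hc_pos : ∀ n, 0 < c n) (hc_zero : Tendsto c atTop (𝓝 0))
    (hc_inf : Tendsto (fun n : ℕ => c n * n) atTop atTop)
    (Htilde : X → ℝ) (hHtilde : Htilde = fun x => ∑ i : Fin m, β i.castSucc * lam i ^ α * H i x) :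
    Integrable Htilde μ ∧
    (fun n : ℕ => InfiniteErgodic.densityMeasure μ Htilde
        {x | 1 / (n : ℝ) * ∑ i : Fin m,
          lam i * InfiniteErgodic.occupationTime T (A i.castSucc) n x ≤ c n})
      ~[atTop] (fun n : ℕ => β (Fin.last m) * (Real.sin (Real.pi * α) / (Real.pi * α)) *
        (c n ^ α * ℓ n / ℓ (c n * n))) := by
  have hTm : MeasurePreserving T μ μ := hT_erg.toMeasurePreserving
  have hβ0 : ∀ i, 0 < β i := fun i => (hβ i).1
  have hentY : ∀ (i : Fin m) n, ∀ᵐ x ∂μ, x ∉ Y →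
      (InfiniteErgodic.entranceAverage μ T Y (A i.castSucc) n x).toReal = 0 := fun i n => by
    filter_upwards [InfiniteErgodic.entranceAverage_ae_eq_zero hTm hY (hA i.castSucc) n]
      with x hx hxY
    rw [hx hxY, ENNReal.toReal_zero]
  have hH0 : ∀ i, ∀ᵐ x ∂μ, 0 ≤ H i x := fun i =>
    InfiniteErgodic.ae_nonneg_of_tendsto_eLpNorm_top (hH_lim i) fun n x => ENNReal.toReal_nonneg
  have hHint : ∀ i, Integrable (H i) μ := fun i => by
    obtain ⟨B, hB⟩ := InfiniteErgodic.exists_ae_abs_le_of_memLp_top (hH i)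
    exact InfiniteErgodic.integrable_of_bounded_of_ae_eq_zero hY hY_fin (hH i).1 hB
      (InfiniteErgodic.ae_eq_zero_of_tendsto_eLpNorm_top (hH_lim i) (hentY i))
  have hGint : Integrable Htilde μ := by
    rw [hHtilde]
    exact integrable_finsetSum _ fun i _ => (hHint i).const_mul _
  refine ⟨hGint, ?_⟩
  have hG0 : ∀ᵐ x ∂μ, 0 ≤ Htilde x := by
    filter_upwards [ae_all_iff.2 hH0] with x hx
    rw [hHtilde]
    exact Finset.sum_nonneg fun i _ => mul_nonneg
      (mul_nonneg (hβ0 _).le (Real.rpow_nonneg (hlam i).le _)) (hx i)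
  -- Replacing `n` by `max n 1` keeps all rates and scales positive at `n = 0`, without affecting
  -- the limit.
  set N : ℕ → ℝ := fun n => max n 1 with hN
  have hN0 : ∀ n, 0 < N n := fun n => lt_max_of_lt_right one_pos
  have hNeq : ∀ᶠ n : ℕ in atTop, N n = n := by
    filter_upwards [eventually_ge_atTop 1] with n hn
    exact max_eq_left (by exact_mod_cast hn)
  have hNtop : Tendsto N atTop atTop :=
    tendsto_natCast_atTop_atTop.congr' (hNeq.mono fun n hn => hn.symm)
  have hcN : Tendsto (fun n => c n * N n) atTop atTop :=
    hc_inf.congr' (hNeq.mono fun n hn => by simp only [hn])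
  have hcN0 : ∀ n, 0 < c n * N n := fun n => mul_pos (hc_pos n) (hN0 n)
  set g : ℕ → ℝ := fun n => c n ^ α * ℓ (N n) / ℓ (c n * N n) with hg
  have hg0 : ∀ n, 0 < g n := fun n => div_pos (mul_pos (Real.rpow_pos_of_pos (hc_pos n) _)
    (hℓ.pos _ (hN0 n))) (hℓ.pos _ (hcN0 n))
  set R : ℕ → X → ℝ := fun k x =>
    ∑ i : Fin m, lam i * InfiniteErgodic.occupationTime T (A i.castSucc) k x with hR
  have hRm : ∀ k, Measurable (R k) := fun k => by
    simp only [hR, InfiniteErgodic.occupationTime]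
    exact Finset.measurable_fun_sum _ fun i _ => (Finset.measurable_fun_sum _ fun j _ =>
      (measurable_one.indicator (hA _)).comp (hTm.measurable.iterate j)).const_mul _
  have hind : ∀ (S : Set X) (x : X), (0 : ℝ) ≤ S.indicator 1 x := fun S x =>
    Set.indicator_nonneg (fun _ _ => zero_le_one) x
  have hR0 : ∀ k x, 0 ≤ R k x := fun k x => Finset.sum_nonneg fun i _ =>
    mul_nonneg (hlam i).le (Finset.sum_nonneg fun j _ => hind _ _)
  have hRmono : ∀ x, Monotone fun k => R k x := fun x j k hjk =>
    Finset.sum_le_sum fun i _ => mul_le_mul_of_nonneg_left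
      (Finset.sum_le_sum_of_subset_of_nonneg (Finset.Icc_subset_Icc_right hjk)
        fun l _ _ => hind _ _) (hlam i).le
  have hmain := InfiniteErgodic.tendsto_setIntegral_le_of_tendsto_double_laplace hGint hG0 hRm hR0
    hRmono hcN0 hg0 hα (hβ0 (Fin.last m)).le (fun q κ hq hκ => by
      have hqn : Tendsto (fun n => q / N n) atTop (𝓝 0) := hNtop.const_div_atTop q
      have hκn : Tendsto (fun n => κ / (c n * N n)) atTop (𝓝 0) := hcN.const_div_atTop κ
      -- The quotient of the two rates is `c n * (q / κ)`; this is where `c(n) → 0` enters.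
      have hqκ : Tendsto (fun n => q / N n / (κ / (c n * N n))) atTop (𝓝 0) := by
        have h1 := hc_zero.const_mul (q / κ)
        rw [mul_zero] at h1
        refine h1.congr fun n => ?_
        have := (hN0 n).ne'
        have := (hc_pos n).ne'
        field_simp
      have h1 := InfiniteErgodic.tendsto_integral_mul_discountedSum hT_cons hTm hm hY hA hYA hAA hX
        hY_pos hY_fin hsep hα hβ0 hℓ hw hbdd hsweep hH hH_lim hlam
        (fun n => div_pos hq (hN0 n)) (fun n => div_pos hκ (hcN0 n)) hqn hκn hqκ
      have h2 := h1.mul (InfiniteErgodic.tendsto_scale_ratio (α := α) hℓ hN0 hc_pos hNtop hcN hq hκ)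
      rw [← mul_assoc] at h2
      refine h2.congr' ?_
      filter_upwards [hNeq] with n hn
      set V := InfiniteErgodic.discountedSum T
        (InfiniteErgodic.orbitWeight A lam (q / N n) (κ / (c n * N n))) with hV
      have hqp := div_pos hq (hN0 n)
      have hκp := div_pos hκ (hcN0 n)
      have hv0 : ∀ x, 0 < InfiniteErgodic.orbitWeight A lam (q / N n) (κ / (c n * N n)) x :=
        fun _ => Real.exp_pos _
      have hvθ := InfiniteErgodic.orbitWeight_le (A := A) hlam (q := q / N n) hκp.le
      have hθ : Real.exp (-(q / N n)) < 1 := Real.exp_lt_one_iff.2 (by linarith)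
      have hVm : Measurable V := InfiniteErgodic.measurable_discountedSum hv0 hvθ hθ
        hTm.measurable (InfiniteErgodic.measurable_orbitWeight hA _ _)
      have hsum : ∑ i : Fin m, β i.castSucc * lam i ^ α * ∫ x, H i x * V x ∂μ =
          ∫ x, Htilde x * V x ∂μ := by
        rw [hHtilde]
        simp only [Finset.sum_mul, mul_assoc]
        rw [integral_finsetSum]
        · refine Finset.sum_congr rfl fun i _ => ?_
          rw [integral_const_mul, integral_const_mul]
        · intro i _
          refine (((hHint i).mul_bdd (c := (1 - Real.exp (-(q / N n)))⁻¹)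
            hVm.aestronglyMeasurable (ae_of_all _ fun x => ?_)).const_mul _).const_mul _
          rw [Real.norm_of_nonneg (InfiniteErgodic.discountedSum_nonneg hv0 x)]
          exact InfiniteErgodic.discountedSum_le hv0 hvθ hθ x
      rw [hsum, hV, InfiniteErgodic.integral_mul_discountedSum hTm.measurable hA hlam hqp hκp.le
        hGint]
      have hW : 0 < (1 / (q / N n)) ^ (1 - α) * ℓ (1 / (q / N n)) :=
        mul_pos (Real.rpow_pos_of_pos (one_div_pos.2 hqp) _) (hℓ.pos _ (one_div_pos.2 hqp))
      have hD : 0 < (κ / (c n * N n)) ^ α * ℓ (1 / (κ / (c n * N n))) :=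
        mul_pos (Real.rpow_pos_of_pos hκp _) (hℓ.pos _ (one_div_pos.2 hκp))
      have hgn := hg0 n
      have hNn := hN0 n
      have hfold : c n ^ α * ℓ (N n) / ℓ (c n * N n) = g n := rfl
      rw [hfold]
      have halg : ∀ S W D G M : ℝ, W ≠ 0 → D ≠ 0 → G ≠ 0 → M ≠ 0 →
          S * D / W * (W / D / (M * G)) = 1 / M * S / G := fun S W D G M h1 h2 h3 h4 => by
        field_simp
      rw [halg _ _ _ _ _ hW.ne' hD.ne' hgn.ne' hNn.ne', mul_div_assoc, ← tsum_div_const,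
        ← hn]
      exact congrArg _ (tsum_congr fun k => mul_div_assoc _ _ _))
  have hsin : 0 < Real.sin (Real.pi * α) := Real.sin_pos_of_pos_of_lt_pi
    (mul_pos Real.pi_pos hα.1) (by nlinarith [Real.pi_pos, hα.2])
  have hK : 0 < β (Fin.last m) * (Real.sin (Real.pi * α) / (Real.pi * α)) :=
    mul_pos (hβ0 _) (div_pos hsin (mul_pos Real.pi_pos hα.1))
  have hgeq : ∀ᶠ n : ℕ in atTop, g n = c n ^ α * ℓ n / ℓ (c n * n) := by
    filter_upwards [hNeq] with n hn
    simp only [hg, hn]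
  refine (isEquivalent_iff_tendsto_one ?_).2 ?_
  · filter_upwards [hgeq] with n hn
    rw [← hn]
    exact (mul_pos hK (hg0 n)).ne'
  · have h1 := hmain.div_const (β (Fin.last m) * (Real.sin (Real.pi * α) / (Real.pi * α)))
    rw [div_self hK.ne'] at h1
    refine h1.congr' ?_
    filter_upwards [hgeq, hNeq] with n hn hn2
    -- The normalization `R n / (c n * N n) ≤ 1` is the event of the theorem as soon as `N n = n`.
    have hset : {x | R n x / (c n * N n) ≤ 1} = {x | 1 / (n : ℝ) * ∑ i : Fin m,
        lam i * InfiniteErgodic.occupationTime T (A i.castSucc) n x ≤ c n} := by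
      ext x
      have h2 := hN0 n
      rw [Set.mem_ofPred_eq, Set.mem_ofPred_eq, div_le_one (hcN0 n), one_div_mul_eq_div, ← hn2,
        div_le_iff₀ h2]
    simp only [Pi.div_apply, InfiniteErgodic.densityMeasure]
    rw [← hn, hset, div_div, mul_comm (g n)]
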